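/- Let $p$ be a prime. All rings are commutative with $1\neq 0$ and of characteristic $p$. Let $A\subset C$ be a ring extension that is finite (i.e. $C$ is a finitely generated $A$-module) and of finite exponent, i.e. there is $e\ge 0$ with $x^{p^e}\in A$ for all $x\in C$; the least such $e$ is denoted $\exp(C/A)$. For $e\ge 0$ let $C^{[e]}:=A[C^{p^e}]$ be the $A$-subalgebra of $C$ generated by all $x^{p^e}$, $x\in C$. Then the following conditions are equivalent: 1. $A\subset C$ is purely inseparable, i.e. it is finite of finite exponent, $C$ is a projective $A$-module, and for each prime ideal $\mathfrak p\subset A$ there is a faithfully flat extension $A_{\mathfrak p}\to A'$ such that $C_{\mathfrak p}\otimes_{A_{\mathfrak p}}A'$ is isomorphic as an $A'$-algebra to $A'[X_1,\dots,X_n]/\langle X_1^{p^{e_1}},\dots,X_n^{p^{e_n}}\rangle$ for some $n\ge 0$ and some $e_i>0$. 2. The module of principal parts $\operatorname{P}^k_{C/A}=(C\otimes_A C)/J^{k+1}$, where $J$ is the kernel of the multiplication map $C\otimes_A C\to C$, is a projective $C$-module (via the left factor) for all $k\ge 0$. 3. $\operatorname{P}^{p^e}_{C/A}$ is a projective $C$-module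 for all $0\le e<\exp(C/A)$. 4. $A\subset C$ is an $\mathcal F$-extension, i.e. $C$ is a projective $C^{[e]}$-module for all $e\ge 0$, and for all $k\ge 0$ the module $\operatorname{Diff}_A^k(C)$ of $A$-differential operators $C\to C$ of order $\le k$ is a direct summand of $\operatorname{End}_A(C)$ as a left $C$-module. 5. $A\subset C$ is an $\mathcal F$-extension and $\operatorname{Diff}_A^{p^e}(C)$ is a $C$-module direct summand of $\operatorname{End}_A(C)$ for all $0\le e<\exp(C/A)$. 6. For all $0\le e<\exp(C/A)$ the extension $C^{[e+1]}\subset C^{[e]}$ is Galois of exponent one. Here a finite extension $R\subset S$ of exponent one is called Galois if $S$ is a projective $R$-module and for each prime ideal $\mathfrak p\subset R$ there are $x_1,\dots,x_n\in S_{\mathfrak p}$ (a $p$-basis) generating $S_{\mathfrak p}$ as an $R_{\mathfrak p}$-algebra and such that the monomials $x_1^{\alpha_1}\cdots x_n^{\alpha_n}$, $0\le\alpha_i<p$, are linearly independent over $R_{\mathfrak p}$. 7. The module of Kähler differentials $\Omega_{C^{[e]}/A}$ is a projective $C^{[e]}$-module for all $0\le e<\exp(C/A)$. Here an $A$-linear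 map $D\colon C\to C$ is a differential operator of order $\le k$ if $[x_0,[x_1,\dots,[x_k,D]\dots]]=0$ for all $x_0,\dots,x_k\in C$, where $[x,D](c)=xD(c)-D(xc)$. -/

import Mathlib

open scoped TensorProduct

namespace RingExt

section Exponent

variable (p : ℕ) (A C : Type*) [CommRing A] [CommRing C] [Algebra A C]

/-- `x ^ (p ^ e)` lies in (the image of) `A` for every `x` in `C`. -/
def HasExponentLE (e : ℕ) : Prop :=
  ∀ x : C, x ^ p ^ e ∈ (algebraMap A C).range

/-- The extension `A ⊂ C` has finite exponent. -/
def HasFiniteExponent : Prop :=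
  ∃ e : ℕ, HasExponentLE p A C e

/-- The exponent `exp(C/A)`: the least `e` such that `x ^ (p ^ e)` lies in `A` for every `x` in `C`.
It is meaningful only for extensions of finite exponent. -/
noncomputable def exponent : ℕ :=
  sInf {e : ℕ | HasExponentLE p A C e}

/-- `C^[e] = A[C^(p^e)]`: the `A`-subalgebra of `C` generated by the `p^e`-th powers. -/
def frob (e : ℕ) : Subalgebra A C :=
  Algebra.adjoin A (Set.range fun x : C => x ^ p ^ e)

/-- `C^[e+1] ⊂ C^[e]`. -/
theorem frob_succ_le (e : ℕ) : frob p A C (e + 1) ≤ frob p A C e := by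
  refine Algebra.adjoin_le ?_
  rintro _ ⟨x, rfl⟩
  have h : x ^ p ^ (e + 1) = (x ^ p) ^ p ^ e := by
    rw [← pow_mul, pow_succ']
  show x ^ p ^ (e + 1) ∈ frob p A C e
  rw [h]
  exact Algebra.subset_adjoin ⟨x ^ p, rfl⟩

/-- `A ⊂ C` is an `F`-extension: `C` is a projective `C^[e]`-module for all `e`.
(Used for finite extensions of finite exponent.) -/
def IsFExtension : Prop :=
  ∀ e : ℕ, Module.Projective (frob p A C e) C

end Exponent

section PurelyInseparable

/-- The truncated polynomial algebra `R[X_1, …, X_n] / (X_1^(p^e_1), …, X_n^(p^e_n))`. -/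
abbrev TruncatedPolynomial (p : ℕ) (R : Type*) [CommRing R] {n : ℕ} (e : Fin n → ℕ) : Type _ :=
  MvPolynomial (Fin n) R ⧸
    Ideal.span (Set.range fun i : Fin n => (MvPolynomial.X i : MvPolynomial (Fin n) R) ^ p ^ e i)

universe u v

/-- Purely inseparable extensions of rings. Here `C_𝔭` is `A_𝔭 ⊗[A] C`. The number `n` of
variables may be `0`. -/
structure IsPurelyInseparable (p : ℕ) (A : Type u) (C : Type v)
    [CommRing A] [CommRing C] [Algebra A C] : Prop where
  finite : Module.Finite A C
  finiteExponent : HasFiniteExponent p A C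
  projective : Module.Projective A C
  locallyTruncated : ∀ (𝔭 : Ideal A) [𝔭.IsPrime],
    ∃ (A' : Type (max u v)) (_ : CommRing A') (_ : Algebra (Localization.AtPrime 𝔭) A'),
      Module.FaithfullyFlat (Localization.AtPrime 𝔭) A' ∧
      ∃ (n : ℕ) (e : Fin n → ℕ), (∀ i, 0 < e i) ∧
        Nonempty ((A' ⊗[Localization.AtPrime 𝔭] (Localization.AtPrime 𝔭 ⊗[A] C))
          ≃ₐ[A'] TruncatedPolynomial p A' e)

end PurelyInseparable

section Galois

/-- `x_1, …, x_n` is a `p`-basis of `C` over `A`: it generates `C` as an `A`-algebra and the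
monomials `x_1^α_1 ⋯ x_n^α_n` with `0 ≤ α_i < p` are linearly independent over `A`.
(Used for extensions in which all `p`-th powers lie in `A`.) -/
def IsPBasis (p : ℕ) (A C : Type*) [CommRing A] [CommRing C] [Algebra A C]
    {n : ℕ} (x : Fin n → C) : Prop :=
  Algebra.adjoin A (Set.range x) = ⊤ ∧
    LinearIndependent A (fun α : Fin n → Fin p => ∏ i, x i ^ (α i : ℕ))

/-- Galois extensions of exponent one. Here `C_𝔭` is `A_𝔭 ⊗[A] C`. -/
structure IsGaloisExponentOne (p : ℕ) (A C : Type*)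
    [CommRing A] [CommRing C] [Algebra A C] : Prop where
  injective : Function.Injective (algebraMap A C)
  finite : Module.Finite A C
  finiteExponent : HasFiniteExponent p A C
  exponent_eq_one : exponent p A C = 1
  projective : Module.Projective A C
  locallyPBasis : ∀ (𝔭 : Ideal A) [𝔭.IsPrime],
    ∃ (n : ℕ) (x : Fin n → Localization.AtPrime 𝔭 ⊗[A] C),
      IsPBasis p (Localization.AtPrime 𝔭) (Localization.AtPrime 𝔭 ⊗[A] C) x

/-- The extension `C^[e+1] ⊂ C^[e]` is Galois of exponent one. -/
def IsGaloisStep (p : ℕ) (A C : Type*) [CommRing A] [CommRing C] [Algebra A C] (e : ℕ) : Prop :=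
  letI : Algebra (frob p A C (e + 1)) (frob p A C e) :=
    (Subalgebra.inclusion (frob_succ_le p A C e)).toRingHom.toAlgebra
  IsGaloisExponentOne p (frob p A C (e + 1)) (frob p A C e)

end Galois

section DifferentialOperators

variable (A C : Type*) [CommRing A] [CommRing C] [Algebra A C]

/-- The module of principal parts `P^k_{C/A} = (C ⊗[A] C) / J^(k+1)`, where `J` is the kernel of the
multiplication map; the `C`-module structure comes from the left factor. -/
abbrev PrincipalParts (k : ℕ) : Type _ :=
  (C ⊗[A] C) ⧸ (RingHom.ker (Algebra.TensorProduct.lmul' A : C ⊗[A] C →ₐ[A] C)) ^ (k + 1)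

variable (M : Type*) [AddCommGroup M] [Module A M] [Module C M] [IsScalarTower A C M]

/-- The bracket `D ↦ [x, D]`, where `[x, D] c = x • D c - D (x * c)`, as a `C`-linear endomorphism
of the left `C`-module `Hom_A(C, M)`. -/
def bracket (x : C) : (C →ₗ[A] M) →ₗ[C] (C →ₗ[A] M) where
  toFun D := x • D - D ∘ₗ LinearMap.mulLeft A x
  map_add' D E := by
    ext c
    simp only [LinearMap.sub_apply, LinearMap.add_apply, LinearMap.smul_apply,
      LinearMap.comp_apply, smul_add]
    abel
  map_smul' r D := by
    ext c
    simp only [LinearMap.sub_apply, LinearMap.smul_apply, LinearMap.comp_apply, smul_sub,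
      RingHom.id_apply, smul_comm r x]

/-- `Diff_A^n(C, M)`: the `C`-submodule of `Hom_A(C, M)` of the differential operators of order
at most `n`, i.e. of the `D` with `[x_0, [x_1, …, [x_n, D] … ]] = 0` for all `x_0, …, x_n`. -/
def diffOp : ℕ → Submodule C (C →ₗ[A] M)
  | 0 => ⨅ x : C, LinearMap.ker (bracket A C M x)
  | n + 1 => ⨅ x : C, (diffOp n).comap (bracket A C M x)

end DifferentialOperators

end RingExt

open scoped TensorProduct

/-! ### Derivations, Frobenius and independence of reduced monomials -/

namespace RingExt

/-! The pivot is the projectivity of the modules of differentials of `C^[e]` over `A`. As d(x^p) =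
0, these are also the differentials of `C^[e]` over `C^[e+1]`
(`exists_kaehler_equiv_of_adjoin_pow`), so the condition concerns single steps of exponent one. For
such a step, projective differentials amount to local p-bases. If the dx_i form a basis, its
coordinates give derivations dual to the x_i, which make the reduced monomials independent; and the
x_i generate, because a finite extension of finite exponent without differentials is a quotient of
its base (`isPBasis_of_basis`). Conversely, a p-basis has partial derivatives.

To read off these differentials from principal parts of C over A, compare operators on `C^[e]` and
on C. Bracketing with x^(p^e) is the p^e-fold bracket with x, so restriction to `C^[e]` divides
orders by p^e. If the steps below e are Galois, extending an operator constantly along local p-bases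
multiplies orders by p at each step (`extendOp_mem_diffOp`). Hence the base change to C of P^1 of
`C^[e]` is a retract of P^(p^e) of C, and the differentials are a retract of P^1. Induction on e,
with descent along the split inclusion of `C^[e]` in C, turns projective P^(p^e) into projective
differentials.

If only the operators of order p^e split off, the same retracts show that the dual of Ω is split, so
that Ω = L ⊕ K with L finite projective and K without nonzero functionals (`IsDualSplit`). Over a
local base K vanishes: a non-nilpotent element kills K, and inverting its p-th power computes the
rank as p^n with n = rank L; then p^n monomials, independent in the residue fibre, span by Nakayama,
and their variables already generate Ω (`subsingleton_of_kaehler_equiv_prod`).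

From projective differentials to truncated polynomials: over a local ring, generators can be chosen
with x_i^(p^e_i) in the algebra of p^e_i-th powers of the x_j with e_j > e_i; adjoining p-power
roots of finitely many scalars lets one correct each x_i to an element of p^e_i-th power zero.
Conversely, for a truncated polynomial algebra, P^k is free on the monomials of degree at most k in
the 1 ⊗ x_i - x_i ⊗ 1, and flatness descends. Finally, if P^k is projective, then C ⊗ C → P^k
splits, and dually Diff^k is a summand of End. -/

open MvPolynomial in
/-- The chain rule for derivations on polynomial expressions. -/
theorem derivation_aeval {R S M ι : Type*} [Fintype ι] [CommRing R] [CommRing S] [Algebra R S]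
    [AddCommGroup M] [Module R M] [Module S M] [IsScalarTower R S M]
    (D : Derivation R S M) (x : ι → S) (f : MvPolynomial ι R) :
    D (aeval x f) = ∑ i, aeval x (pderiv i f) • D (x i) := by
  classical
  induction f using MvPolynomial.induction_on with
  | C a => simp
  | add f g hf hg => simp [hf, hg, add_smul, Finset.sum_add_distrib]
  | mul_X f i hf =>
    simp only [map_mul, aeval_X, Derivation.leibniz, hf, pderiv_X, map_add, add_smul,
      Finset.sum_add_distrib, Finset.smul_sum, mul_smul, smul_eq_mul]
    congr 1
    · rw [Finset.sum_eq_single i]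
      · simp
      · intro j _ hj
        simp [Pi.single_eq_of_ne hj.symm]
      · simp

/-- Iterated Frobenius of a ring in which `p` vanishes. -/
def powHom {p : ℕ} [hp : Fact p.Prime] {T : Type*} [CommRing T] (h : (p : T) = 0) (n : ℕ) :
    T →+* T where
  toFun x := x ^ p ^ n
  map_one' := one_pow _
  map_mul' x y := mul_pow _ _ _
  map_zero' := zero_pow (pow_pos hp.out.pos n).ne'
  map_add' x y := by
    cases subsingleton_or_nontrivial T
    · exact Subsingleton.elim _ _
    · have := (CharP.charP_iff_prime_eq_zero hp.out).2 h
      exact add_pow_char_pow ..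

theorem powHom_apply {p : ℕ} [hp : Fact p.Prime] {T : Type*} [CommRing T] (h : (p : T) = 0)
    (n : ℕ) (x : T) : powHom h n x = x ^ p ^ n := rfl

theorem cast_eq_zero_of_algebra {p : ℕ} {R : Type*} (T : Type*) [CommRing R] [CommRing T]
    [Algebra R T] (h : (p : R) = 0) : (p : T) = 0 := by
  simpa using congrArg (algebraMap R T) h

theorem isUnit_natCast_of_lt {p : ℕ} [hp : Fact p.Prime] {T : Type*} [CommRing T]
    (h : (p : T) = 0) {j : ℕ} (h0 : j ≠ 0) (hj : j < p) : IsUnit (j : T) := by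
  have hc : IsCoprime (j : ℤ) (p : ℤ) :=
    Nat.isCoprime_iff_coprime.2 (Nat.coprime_of_lt_prime h0 hj hp.out).symm
  obtain ⟨a, b, hab⟩ := hc
  have := congrArg (Int.cast : ℤ → T) hab
  push_cast at this
  rw [h, mul_zero, add_zero] at this
  exact IsUnit.of_mul_eq_one_right _ this

section Independence

variable {p : ℕ} [hp : Fact p.Prime] {R S : Type*} [CommRing R] [CommRing S] [Algebra R S]

open MvPolynomial in
/-- If there are derivations dual to `x`, a polynomial of degree less than `p` in each variable
whose value at `x` lies in a differential ideal has all its coefficients in that ideal. -/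
theorem coeff_mem_of_aeval_mem {ι : Type*} [Fintype ι] [DecidableEq ι] (h : (p : R) = 0)
    (x : ι → S) (D : ι → Derivation R S S) (hD : ∀ i j, D i (x j) = if i = j then 1 else 0)
    (N : Ideal S) (hN : ∀ i, ∀ s ∈ N, D i s ∈ N) (f : MvPolynomial ι R)
    (hf : ∀ m ∈ f.support, ∀ i, m i < p) (hfN : aeval x f ∈ N) (m : ι →₀ ℕ) :
    algebraMap R S (f.coeff m) ∈ N := by
  generalize hd : f.totalDegree = d
  induction d using Nat.strong_induction_on generalizing f m with
  | _ d ih =>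
  -- Up to the unit `m i`, a coefficient with `m i ≠ 0` is a coefficient of `pderiv i f`. That
  -- polynomial has smaller degree, and its value `D i (aeval x f)` stays in `N`; the constant
  -- coefficient is then what remains.
  have key : ∀ m : ι →₀ ℕ, m ≠ 0 → algebraMap R S (f.coeff m) ∈ N := by
    intro m hm
    by_cases hms : f.coeff m = 0
    · simp [hms]
    have hms' : m ∈ f.support := by simpa using hms
    obtain ⟨i, hi⟩ : ∃ i, m i ≠ 0 := by
      by_contra! hcon
      exact hm (Finsupp.ext hcon)
    have hDi : D i (aeval x f) = aeval x (pderiv i f) := by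
      rw [derivation_aeval]
      simp [hD]
    have hcoeff : ∀ m', (pderiv i f).coeff m' = f.coeff (m' + Finsupp.single i 1) * (m' i + 1) := by
      intro m'
      rw [coeff_pderiv]
    have hsupp : ∀ m' ∈ (pderiv i f).support, m' + Finsupp.single i 1 ∈ f.support := by
      intro m' hm'
      rw [mem_support_iff, hcoeff] at hm'
      rw [mem_support_iff]
      exact left_ne_zero_of_mul hm'
    by_cases hz : pderiv i f = 0
    · have hc := hcoeff (m - Finsupp.single i 1)
      have hle : Finsupp.single i 1 ≤ m := by
        rw [Finsupp.single_le_iff]; omega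
      rw [hz, coeff_zero, tsub_add_cancel_of_le hle] at hc
      have hu : IsUnit ((m i : ℕ) : R) := isUnit_natCast_of_lt h hi (hf m hms' i)
      have he : (((m - Finsupp.single i 1 : ι →₀ ℕ) i : ℕ) : R) + 1 = (m i : ℕ) := by
        rw [Finsupp.tsub_apply, Finsupp.single_eq_same]
        rw [← Nat.cast_succ]
        congr 1
        omega
      rw [he] at hc
      exact absurd ((hu.mul_left_eq_zero).1 hc.symm) hms
    have hlt : (pderiv i f).totalDegree < d := by
      rw [totalDegree, Finset.sup_lt_iff]
      · intro m' hm'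
        have := le_totalDegree (hsupp m' hm')
        rw [hd, Finsupp.sum_add_index' (by simp) (by simp), Finsupp.sum_single_index rfl] at this
        exact this
      · have := le_totalDegree hms'
        rw [hd] at this
        refine lt_of_lt_of_le ?_ this
        rw [Finsupp.sum, bot_eq_zero, Finset.sum_pos_iff]
        exact ⟨i, by simpa using hi, Nat.pos_of_ne_zero hi⟩
    have := ih _ hlt (pderiv i f) (fun m' hm' j ↦
      lt_of_le_of_lt (by simp) (hf _ (hsupp m' hm') j)) (hDi ▸ hN i _ hfN)
      (m - Finsupp.single i 1) rfl
    have hle : Finsupp.single i 1 ≤ m := by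
      rw [Finsupp.single_le_iff]; omega
    rw [hcoeff, tsub_add_cancel_of_le hle] at this
    have he : (((m - Finsupp.single i 1 : ι →₀ ℕ) i : ℕ) : R) + 1 = (m i : ℕ) := by
      rw [Finsupp.tsub_apply, Finsupp.single_eq_same]
      rw [← Nat.cast_succ]
      congr 1
      omega
    have hu : IsUnit ((m i : ℕ) : R) := isUnit_natCast_of_lt h hi (hf m hms' i)
    rw [he, map_mul] at this
    obtain ⟨c, hc⟩ := (hu.map (algebraMap R S)).exists_right_inv
    have := N.mul_mem_right c this
    rwa [mul_assoc, hc, mul_one] at this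
  by_cases hm : m = 0
  · subst hm
    have : algebraMap R S (f.coeff 0) =
        aeval x f - ∑ m ∈ f.support.erase 0, aeval x (monomial m (f.coeff m)) := by
      have hs : aeval x f = ∑ m ∈ f.support, aeval x (monomial m (f.coeff m)) := by
        rw [← map_sum, ← f.as_sum]
      rw [eq_sub_iff_add_eq, hs]
      by_cases h0 : (0 : ι →₀ ℕ) ∈ f.support
      · rw [← Finset.add_sum_erase _ _ h0]
        congr 1
        simp
      · have h0' : f.coeff 0 = 0 := by simpa using h0
        rw [Finset.erase_eq_of_notMem h0, h0', map_zero, zero_add]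
    rw [this]
    refine N.sub_mem hfN (N.sum_mem fun m hm ↦ ?_)
    rw [aeval_monomial]
    exact N.mul_mem_right _ (key m (Finset.ne_of_mem_erase hm))
  · exact key m hm

/-- Version of `coeff_mem_of_aeval_mem` for linear combinations of reduced monomials. -/
theorem mem_of_sum_monomials_mem {n : ℕ} (h : (p : R) = 0)
    (x : Fin n → S) (D : Fin n → Derivation R S S)
    (hD : ∀ i j, D i (x j) = if i = j then 1 else 0)
    (N : Ideal S) (hN : ∀ i, ∀ s ∈ N, D i s ∈ N) (r : (Fin n → Fin p) → R)
    (hr : ∑ α, r α • ∏ i, x i ^ (α i : ℕ) ∈ N) (α : Fin n → Fin p) :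
    algebraMap R S (r α) ∈ N := by
  classical
  let e : (Fin n → Fin p) → (Fin n →₀ ℕ) := fun α ↦ Finsupp.equivFunOnFinite.symm fun i ↦ α i
  have he : Function.Injective e := by
    intro α β hab
    funext i
    exact Fin.ext (DFunLike.congr_fun hab i)
  let f : MvPolynomial (Fin n) R := ∑ α, MvPolynomial.monomial (e α) (r α)
  have hc : ∀ m, f.coeff m = ∑ α, if e α = m then r α else 0 := by
    intro m
    simp [f, MvPolynomial.coeff_sum, MvPolynomial.coeff_monomial]
  have hα : f.coeff (e α) = r α := by
    rw [hc, Finset.sum_eq_single α]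
    · simp
    · intro β _ hb
      rw [if_neg (he.ne hb)]
    · simp
  rw [← hα]
  refine coeff_mem_of_aeval_mem h x D hD N hN f ?_ ?_ _
  · intro m hm i
    rw [MvPolynomial.mem_support_iff, hc] at hm
    obtain ⟨β, -, hb⟩ := Finset.exists_ne_zero_of_sum_ne_zero hm
    have : e β = m := by
      by_contra hne
      exact hb (if_neg hne)
    rw [← this]
    exact (β i).2
  · convert hr
    simp only [f, map_sum, MvPolynomial.aeval_monomial, Algebra.smul_def]
    refine Finset.sum_congr rfl fun β _ ↦ ?_
    congr 1
    rw [Finsupp.prod_fintype _ _ (by simp)]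
    simp [e]

end Independence

/-- If `x_i ^ q_i` is a scalar, the reduced monomials span the algebra generated by `x`. -/
theorem span_monomials_eq_top {R S : Type*} [CommRing R] [CommRing S] [Algebra R S] {n : ℕ}
    (x : Fin n → S) (q : Fin n → ℕ) (hq : ∀ i, 0 < q i)
    (hx : ∀ i, x i ^ q i ∈ (algebraMap R S).range) (hgen : Algebra.adjoin R (Set.range x) = ⊤) :
    Submodule.span R (Set.range fun α : (i : Fin n) → Fin (q i) ↦ ∏ i, x i ^ (α i : ℕ)) = ⊤ := by
  rw [eq_top_iff]
  intro s _
  have hs : s ∈ Algebra.adjoin R (Set.range x) := hgen ▸ Algebra.mem_top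
  rw [Algebra.adjoin_range_eq_range_aeval] at hs
  obtain ⟨f, rfl⟩ := hs
  induction f using MvPolynomial.induction_on' with
  | monomial m a =>
    choose c hc using hx
    rw [AlgHom.toRingHom_eq_coe, RingHom.coe_coe, MvPolynomial.aeval_monomial,
      Finsupp.prod_fintype _ _ (by simp)]
    have : ∏ i, x i ^ m i = algebraMap R S (∏ i, c i ^ (m i / q i)) * ∏ i, x i ^ (m i % q i) := by
      rw [map_prod, ← Finset.prod_mul_distrib]
      refine Finset.prod_congr rfl fun i _ ↦ ?_
      rw [map_pow, hc, ← pow_mul, ← pow_add, Nat.div_add_mod]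
    rw [this, ← mul_assoc, ← map_mul, ← Algebra.smul_def]
    refine Submodule.smul_mem _ _ (Submodule.subset_span ⟨fun i ↦ ⟨m i % q i,
      Nat.mod_lt _ (hq i)⟩, rfl⟩)
  | add f g hf hg =>
    rw [map_add]
    exact Submodule.add_mem _ (hf trivial) (hg trivial)

section Unramified

variable {p : ℕ} [hp : Fact p.Prime] {B S : Type*} [CommRing B] [CommRing S] [Algebra B S]

/-- A finite algebra of finite exponent without differentials is a quotient of the base. -/
theorem surjective_of_subsingleton_kaehler (h : (p : B) = 0) [Module.Finite B S] {N : ℕ}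
    (hpow : HasExponentLE p B S N) [hΩ : Subsingleton (Ω[S⁄B])] :
    Function.Surjective (algebraMap B S) := by
  have hT : (p : S ⊗[B] S) = 0 := cast_eq_zero_of_algebra _ h
  rw [← Algebra.isEpi_iff_surjective_algebraMap_of_finite, Algebra.isEpi_iff_forall_one_tmul_eq]
  -- Vanishing differentials mean J = J²; as J is finitely generated, it is generated by an
  -- idempotent `e`.
  have hidem : IsIdempotentElem (KaehlerDifferential.ideal B S) :=
    (Ideal.cotangent_subsingleton_iff _).1 hΩ
  obtain ⟨e, he, hJ⟩ := (Ideal.isIdempotentElem_iff_of_fg _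
    (KaehlerDifferential.ideal_fg B S)).1 hidem
  -- The p^N-th powers of elements of `S` are scalars, which pass through the tensor sign. So
  -- Frobenius kills J, and the idempotent in it is zero.
  have hle : KaehlerDifferential.ideal B S ≤ RingHom.ker (powHom hT N) := by
    rw [← KaehlerDifferential.span_range_eq_ideal, Ideal.span_le]
    rintro _ ⟨s, rfl⟩
    obtain ⟨b, hb⟩ := hpow s
    rw [SetLike.mem_coe, RingHom.mem_ker, map_sub, powHom_apply, powHom_apply,
      Algebra.TensorProduct.tmul_pow, Algebra.TensorProduct.tmul_pow, one_pow, ← hb,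
      Algebra.TensorProduct.tmul_one_eq_one_tmul, sub_self]
  have he0 : e = 0 := by
    have : e ∈ KaehlerDifferential.ideal B S := hJ ▸ Submodule.mem_span_singleton_self e
    have := hle this
    rwa [RingHom.mem_ker, powHom_apply,
      he.pow_eq (pow_pos hp.out.pos N).ne'] at this
  intro s
  rw [← sub_eq_zero, ← Submodule.mem_bot (R := S ⊗[B] S)]
  rw [he0, Submodule.span_zero_singleton] at hJ
  rw [← hJ, ← KaehlerDifferential.span_range_eq_ideal]
  exact Ideal.subset_span ⟨s, rfl⟩

end Unramified

end RingExt

/-! ### p-bases and Kähler differentials -/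

namespace RingExt

section LocalRing

variable {p : ℕ} [hp : Fact p.Prime] {A C : Type*} [CommRing A] [CommRing C] [Algebra A C]

/-- Invertibility can be tested on the p^N-th power inside `A`. Since Frobenius is additive,
nonunits of `C` inherit closure under addition from a local `A`. -/
theorem isUnit_of_isUnit_pow_algebraMap {N : ℕ} (hN : HasExponentLE p A C N)
    (hinj : Function.Injective (algebraMap A C)) (x : C) {a : A}
    (ha : algebraMap A C a = x ^ p ^ N) : IsUnit x ↔ IsUnit a := by
  constructor
  · intro hx
    obtain ⟨y, hy⟩ := hx.exists_right_inv
    obtain ⟨b, hb⟩ := hN y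
    refine IsUnit.of_mul_eq_one b (hinj ?_)
    rw [map_mul, map_one, ha, hb, ← mul_pow, hy, one_pow]
  · intro hu
    have := hu.map (algebraMap A C)
    rw [ha] at this
    exact (isUnit_pow_iff (pow_pos hp.out.pos N).ne').1 this

/-- An extension of finite exponent of a local ring is local. -/
theorem isLocalRing_of_hasExponentLE (h : (p : A) = 0) [IsLocalRing A] {N : ℕ}
    (hN : HasExponentLE p A C N) (hinj : Function.Injective (algebraMap A C)) :
    IsLocalRing C := by
  have : Nontrivial C := hinj.nontrivial
  have hC : (p : C) = 0 := cast_eq_zero_of_algebra C h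
  refine IsLocalRing.of_nonunits_add fun x y hx hy ↦ ?_
  obtain ⟨a, ha⟩ := hN x
  obtain ⟨b, hb⟩ := hN y
  have hab : algebraMap A C (a + b) = (x + y) ^ p ^ N := by
    rw [map_add, ha, hb, ← powHom_apply hC, ← powHom_apply hC, ← powHom_apply hC, map_add]
  rw [mem_nonunits_iff, isUnit_of_isUnit_pow_algebraMap hN hinj _ hab]
  rw [mem_nonunits_iff, isUnit_of_isUnit_pow_algebraMap hN hinj _ ha] at hx
  rw [mem_nonunits_iff, isUnit_of_isUnit_pow_algebraMap hN hinj _ hb] at hy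
  exact IsLocalRing.nonunits_add hx hy

end LocalRing

section PBasis

theorem hasExponentLE_one {p : ℕ} {R S : Type*} [CommRing R] [CommRing S] [Algebra R S]
    (hpow : ∀ s : S, s ^ p ∈ (algebraMap R S).range) :
    HasExponentLE p R S 1 := by
  intro s
  rw [pow_one]
  exact hpow s

variable {p : ℕ} [hp : Fact p.Prime] {R S : Type*} [CommRing R] [CommRing S] [Algebra R S]

/-- Elements whose differentials span the Kähler differentials generate the algebra. -/
theorem adjoin_eq_top_of_span_kaehler {ι : Type*} (h : (p : R) = 0) [Module.Finite R S] {N : ℕ}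
    (hpow : HasExponentLE p R S N) (x : ι → S)
    (hx : Submodule.span S (Set.range fun i ↦ KaehlerDifferential.D R S (x i)) = ⊤) :
    Algebra.adjoin R (Set.range x) = ⊤ := by
  set B := Algebra.adjoin R (Set.range x)
  have hB : (p : B) = 0 := cast_eq_zero_of_algebra B h
  have hfin : Module.Finite B S := Module.Finite.of_restrictScalars_finite R B S
  have hpB : HasExponentLE p B S N := by
    intro s
    obtain ⟨r, hr⟩ := hpow s
    exact ⟨algebraMap R B r, hr⟩
  -- Over `B = R[x]` the differentials of the x_i vanish, yet they still span; so nothing is left.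
  have hΩ : Subsingleton (Ω[S⁄B]) := by
    have hsur := KaehlerDifferential.map_surjective R B S
    have hz : ∀ ω : Ω[S⁄R], KaehlerDifferential.map R B S S ω = 0 := by
      intro ω
      have hω : ω ∈ Submodule.span S (Set.range fun i ↦ KaehlerDifferential.D R S (x i)) :=
        hx ▸ Submodule.mem_top
      induction hω using Submodule.span_induction with
      | mem _ hm =>
        obtain ⟨i, rfl⟩ := hm
        have : algebraMap S S (x i) =
            algebraMap B S ⟨x i, Algebra.subset_adjoin ⟨i, rfl⟩⟩ := rfl
        rw [KaehlerDifferential.map_D, this, Derivation.map_algebraMap]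
      | zero => simp
      | add _ _ _ _ h1 h2 => rw [map_add, h1, h2, add_zero]
      | smul _ _ _ h1 => rw [map_smul, h1, smul_zero]
    refine ⟨fun a b ↦ ?_⟩
    obtain ⟨a, rfl⟩ := hsur a
    obtain ⟨b, rfl⟩ := hsur b
    rw [hz, hz]
  have := surjective_of_subsingleton_kaehler hB hpB
  rw [eq_top_iff]
  intro s _
  obtain ⟨b, rfl⟩ := this s
  exact b.2

/-- Algebra generators span the Kähler differentials. -/
theorem span_kaehler_eq_top {ι : Type*} [Fintype ι] (x : ι → S)
    (hx : Algebra.adjoin R (Set.range x) = ⊤) :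
    Submodule.span S (Set.range fun i ↦ KaehlerDifferential.D R S (x i)) = ⊤ := by
  rw [eq_top_iff, ← KaehlerDifferential.span_range_derivation, Submodule.span_le]
  rintro _ ⟨s, rfl⟩
  have hs : s ∈ Algebra.adjoin R (Set.range x) := hx ▸ Algebra.mem_top
  rw [Algebra.adjoin_range_eq_range_aeval] at hs
  obtain ⟨f, rfl⟩ := hs
  rw [AlgHom.toRingHom_eq_coe, RingHom.coe_coe, derivation_aeval]
  exact Submodule.sum_mem _ fun i _ ↦
    Submodule.smul_mem _ _ (Submodule.subset_span ⟨i, rfl⟩)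

/-- The coordinates of the basis, composed with d, are derivations dual to `x`.
`mem_of_sum_monomials_mem` with the zero ideal gives independence, and
`adjoin_eq_top_of_span_kaehler` gives generation. -/
theorem isPBasis_of_basis (h : (p : R) = 0) (hinj : Function.Injective (algebraMap R S))
    [Module.Finite R S] (hpow : ∀ s : S, s ^ p ∈ (algebraMap R S).range) {n : ℕ} (x : Fin n → S)
    (b : Module.Basis (Fin n) S (Ω[S⁄R])) (hb : ∀ i, b i = KaehlerDifferential.D R S (x i)) :
    IsPBasis p R S x := by
  refine ⟨adjoin_eq_top_of_span_kaehler h (hasExponentLE_one hpow) x ?_, ?_⟩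
  · rw [← show (⇑b : Fin n → _) = fun i ↦ KaehlerDifferential.D R S (x i) from funext hb]
    exact b.span_eq
  · rw [Fintype.linearIndependent_iff]
    intro r hr α
    have := mem_of_sum_monomials_mem h x
      (fun i ↦ (b.coord i).compDer (KaehlerDifferential.D R S))
      (fun i j ↦ by
        change b.coord i (KaehlerDifferential.D R S (x j)) = _
        rw [← hb, Module.Basis.coord_apply, Module.Basis.repr_self,
          Finsupp.single_apply]
        simp only [eq_comm]) ⊥
      (fun i s hs ↦ by
        rw [Ideal.mem_bot] at hs
        simp [hs]) r (by rw [hr]; exact Ideal.zero_mem _) α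
    rw [Ideal.mem_bot] at this
    exact (map_eq_zero_iff _ hinj).1 this

theorem IsPBasis.span_eq_top (hpow : ∀ s : S, s ^ p ∈ (algebraMap R S).range) {n : ℕ}
    {x : Fin n → S} (hx : IsPBasis p R S x) :
    Submodule.span R (Set.range fun α : Fin n → Fin p ↦ ∏ i, x i ^ (α i : ℕ)) = ⊤ :=
  span_monomials_eq_top x (fun _ ↦ p) (fun _ ↦ hp.out.pos) (fun i ↦ hpow (x i)) hx.1

/-- The basis of reduced monomials given by a `p`-basis. -/
noncomputable def IsPBasis.basis (hpow : ∀ s : S, s ^ p ∈ (algebraMap R S).range) {n : ℕ}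
    {x : Fin n → S} (hx : IsPBasis p R S x) : Module.Basis (Fin n → Fin p) R S :=
  Module.Basis.mk hx.2 (hx.span_eq_top hpow).ge

theorem IsPBasis.basis_apply (hpow : ∀ s : S, s ^ p ∈ (algebraMap R S).range) {n : ℕ}
    {x : Fin n → S} (hx : IsPBasis p R S x) (α : Fin n → Fin p) :
    hx.basis hpow α = ∏ i, x i ^ (α i : ℕ) := by
  rw [IsPBasis.basis, Module.Basis.mk_apply]

theorem IsPBasis.finrank_eq [Nontrivial R] (hpow : ∀ s : S, s ^ p ∈ (algebraMap R S).range)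
    {n : ℕ} {x : Fin n → S} (hx : IsPBasis p R S x) : Module.finrank R S = p ^ n := by
  rw [Module.finrank_eq_card_basis (hx.basis hpow)]
  simp

/-- The monomial with exponent vector `m`. -/
def mon {n : ℕ} (x : Fin n → S) (m : Fin n → ℕ) : S := ∏ i, x i ^ m i

theorem mon_add {n : ℕ} (x : Fin n → S) (m m' : Fin n → ℕ) :
    mon x (m + m') = mon x m * mon x m' := by
  simp only [mon, ← Finset.prod_mul_distrib, Pi.add_apply, pow_add]

theorem mon_single {n : ℕ} (x : Fin n → S) (j : Fin n) (k : ℕ) :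
    mon x (Pi.single j k) = x j ^ k := by
  classical
  rw [mon, Finset.prod_eq_single j]
  · simp
  · intro i _ hi
    simp [Pi.single_eq_of_ne hi]
  · simp

/-- The partial derivative with respect to an element of a `p`-basis, as a linear map. -/
noncomputable def IsPBasis.pdLinear (hpow : ∀ s : S, s ^ p ∈ (algebraMap R S).range) {n : ℕ}
    {x : Fin n → S} (hx : IsPBasis p R S x) (j : Fin n) : S →ₗ[R] S :=
  (hx.basis hpow).constr R fun α ↦ (α j : ℕ) • mon x ((fun i ↦ (α i : ℕ)) - Pi.single j 1)

/-- The map is defined on reduced monomials only. The formula persists for all exponents because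
p-th powers are scalars and the factor `m j` matters only modulo p; this makes the Leibniz rule
checkable on products. -/
theorem IsPBasis.pdLinear_mon (h : (p : R) = 0) (hpow : ∀ s : S, s ^ p ∈ (algebraMap R S).range)
    {n : ℕ} {x : Fin n → S} (hx : IsPBasis p R S x) (j : Fin n) (m : Fin n → ℕ) :
    hx.pdLinear hpow j (mon x m) = m j • mon x (m - Pi.single j 1) := by
  have hS : (p : S) = 0 := cast_eq_zero_of_algebra S h
  choose c hc using fun i ↦ hpow (x i)
  set r : R := ∏ i, c i ^ (m i / p)
  have hr : ∀ m' : Fin n → ℕ, mon x (fun i ↦ p * (m i / p) + m' i) = r • mon x m' := by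
    intro m'
    rw [Algebra.smul_def, map_prod, mon, mon, ← Finset.prod_mul_distrib]
    refine Finset.prod_congr rfl fun i _ ↦ ?_
    rw [map_pow, hc, ← pow_mul, ← pow_add]
  have hm : mon x m = r • mon x (fun i ↦ m i % p) := by
    rw [← hr]
    simp only [Nat.div_add_mod]
  have hred : hx.pdLinear hpow j (mon x (fun i ↦ m i % p)) =
      (m j % p) • mon x ((fun i ↦ m i % p) - Pi.single j 1) := by
    have := (hx.basis hpow).constr_basis R
      (fun α ↦ (α j : ℕ) • mon x ((fun i ↦ (α i : ℕ)) - Pi.single j 1))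
      (fun i ↦ ⟨m i % p, Nat.mod_lt _ hp.out.pos⟩)
    rw [IsPBasis.basis_apply] at this
    exact this
  have hmj : ((m j : ℕ) : S) = ((m j % p : ℕ) : S) := by
    conv_lhs => rw [← Nat.div_add_mod (m j) p]
    rw [Nat.cast_add, Nat.cast_mul, hS, zero_mul, zero_add]
  rw [hm, map_smul, hred, nsmul_eq_mul, nsmul_eq_mul, hmj]
  by_cases hz : m j % p = 0
  · simp [hz]
  rw [← mul_smul_comm, ← hr]
  congr 2
  funext i
  by_cases hij : i = j
  · subst hij
    have := Nat.div_add_mod (m i) p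
    simp only [Pi.sub_apply, Pi.single_eq_same]
    omega
  · simp [Pi.single_eq_of_ne hij, Nat.div_add_mod]

/-- The partial derivative with respect to an element of a `p`-basis. -/
noncomputable def IsPBasis.pd (h : (p : R) = 0) (hpow : ∀ s : S, s ^ p ∈ (algebraMap R S).range)
    {n : ℕ} {x : Fin n → S} (hx : IsPBasis p R S x) (j : Fin n) : Derivation R S S :=
  Derivation.mk' (hx.pdLinear hpow j) fun a b ↦ by
    have ha : a ∈ Submodule.span R (Set.range fun α : Fin n → Fin p ↦ ∏ i, x i ^ (α i : ℕ)) :=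
      hx.span_eq_top hpow ▸ Submodule.mem_top
    have hb : b ∈ Submodule.span R (Set.range fun α : Fin n → Fin p ↦ ∏ i, x i ^ (α i : ℕ)) :=
      hx.span_eq_top hpow ▸ Submodule.mem_top
    induction ha using Submodule.span_induction with
    | zero => simp
    | add _ _ _ _ h1 h2 => simp only [add_mul, map_add, h1, h2, add_smul, smul_add]; abel
    | smul r _ _ h1 =>
      simp only [smul_mul_assoc, map_smul, h1, smul_add, smul_assoc, smul_comm r b]
    | mem _ hm =>
    obtain ⟨α, rfl⟩ := hm
    induction hb using Submodule.span_induction with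
    | zero => simp
    | add _ _ _ _ h1 h2 => simp only [mul_add, map_add, h1, h2, add_smul, smul_add]; abel
    | smul r c _ h1 =>
      simp only [mul_smul_comm, map_smul, h1, smul_add, smul_assoc, smul_comm r (∏ i, _)]
    | mem _ hm =>
    obtain ⟨β, rfl⟩ := hm
    have h1 : ∀ α : Fin n → Fin p, ∏ i, x i ^ (α i : ℕ) = mon x (fun i ↦ (α i : ℕ)) := fun _ ↦ rfl
    -- The subtraction in the exponent is truncated; where it would misbehave, at `m j = 0`, the
    -- coefficient vanishes.
    have h2 : ∀ m m' : Fin n → ℕ, m j • mon x (m + m' - Pi.single j 1) =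
        m j • (mon x m' * mon x (m - Pi.single j 1)) := by
      intro m m'
      by_cases hz : m j = 0
      · rw [hz, zero_smul, zero_smul]
      rw [← mon_add]
      congr 2
      funext i
      by_cases hij : i = j
      · subst hij
        simp only [Pi.sub_apply, Pi.add_apply, Pi.single_eq_same]
        omega
      · simp [Pi.single_eq_of_ne hij, add_comm]
    dsimp only
    have e1 := h2 (fun i ↦ (α i : ℕ)) (fun i ↦ (β i : ℕ))
    have e2 := h2 (fun i ↦ (β i : ℕ)) (fun i ↦ (α i : ℕ))
    rw [add_comm (fun i ↦ (β i : ℕ))] at e2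
    rw [h1, h1, ← mon_add, hx.pdLinear_mon h, hx.pdLinear_mon h, hx.pdLinear_mon h,
      Pi.add_apply, add_smul, e1, e2]
    simp only [smul_eq_mul, mul_smul_comm]
    rw [add_comm]

theorem IsPBasis.pd_apply (h : (p : R) = 0) (hpow : ∀ s : S, s ^ p ∈ (algebraMap R S).range)
    {n : ℕ} {x : Fin n → S} (hx : IsPBasis p R S x) (i j : Fin n) :
    hx.pd h hpow i (x j) = if i = j then 1 else 0 := by
  have h1 : x j = mon x (Pi.single j 1) := by rw [mon_single, pow_one]
  rw [h1]
  refine (hx.pdLinear_mon h hpow i _).trans ?_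
  by_cases hij : i = j
  · subst hij
    rw [if_pos rfl, tsub_self, Pi.single_eq_same, one_smul]
    simp [mon]
  · rw [if_neg hij, Pi.single_eq_of_ne hij, zero_smul]

/-- The differentials of a `p`-basis form a basis. -/
theorem IsPBasis.exists_basis_kaehler (h : (p : R) = 0)
    (hpow : ∀ s : S, s ^ p ∈ (algebraMap R S).range) {n : ℕ} {x : Fin n → S}
    (hx : IsPBasis p R S x) :
    ∃ b : Module.Basis (Fin n) S (Ω[S⁄R]), ∀ i, b i = KaehlerDifferential.D R S (x i) := by
  have hli : LinearIndependent S fun i ↦ KaehlerDifferential.D R S (x i) := by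
    rw [Fintype.linearIndependent_iff]
    intro c hc j
    have := congrArg (hx.pd h hpow j).liftKaehlerDifferential hc
    simpa [hx.pd_apply h hpow] using this
  exact ⟨Module.Basis.mk hli (span_kaehler_eq_top x hx.1).ge, fun i ↦ Module.Basis.mk_apply _ _ _⟩

end PBasis

end RingExt

/-! ### Differential operators: brackets, restriction and extension -/

namespace RingExt

set_option linter.unusedSectionVars false

section DiffOp

variable {A C M : Type*} [CommRing A] [CommRing C] [Algebra A C]
  [AddCommGroup M] [Module A M] [Module C M] [IsScalarTower A C M]

theorem bracket_apply (x : C) (D : C →ₗ[A] M) (c : C) :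
    bracket A C M x D c = x • D c - D (x * c) := rfl

theorem mem_diffOp_zero {D : C →ₗ[A] M} :
    D ∈ diffOp A C M 0 ↔ ∀ x, bracket A C M x D = 0 := by
  simp [diffOp]

theorem mem_diffOp_succ {n : ℕ} {D : C →ₗ[A] M} :
    D ∈ diffOp A C M (n + 1) ↔ ∀ x, bracket A C M x D ∈ diffOp A C M n := by
  simp [diffOp]

theorem diffOp_le_succ (n : ℕ) : diffOp A C M n ≤ diffOp A C M (n + 1) := by
  induction n with
  | zero =>
    intro D hD
    rw [mem_diffOp_zero] at hD
    rw [mem_diffOp_succ]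
    intro x
    rw [hD]
    exact zero_mem _
  | succ n ih =>
    intro D hD
    rw [mem_diffOp_succ] at hD ⊢
    exact fun x ↦ ih (hD x)

theorem diffOp_mono : Monotone (diffOp A C M) := monotone_nat_of_le_succ diffOp_le_succ

theorem bracket_mul (x y : C) (D : C →ₗ[A] M) :
    bracket A C M (x * y) D =
      x • bracket A C M y D + bracket A C M x D ∘ₗ LinearMap.mulLeft A y := by
  ext c
  simp only [bracket_apply, smul_sub, LinearMap.add_apply, LinearMap.smul_apply,
    LinearMap.comp_apply, LinearMap.mulLeft_apply, mul_smul, mul_assoc]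
  abel

theorem bracket_add (x y : C) (D : C →ₗ[A] M) :
    bracket A C M (x + y) D = bracket A C M x D + bracket A C M y D := by
  ext c
  simp only [bracket_apply, LinearMap.add_apply, add_smul, add_mul, map_add]
  abel

theorem bracket_algebraMap (a : A) (D : C →ₗ[A] M) :
    bracket A C M (algebraMap A C a) D = 0 := by
  ext c
  rw [bracket_apply, algebraMap_smul, ← Algebra.smul_def, map_smul, sub_self,
    LinearMap.zero_apply]

theorem bracket_comp_mulLeft (x y : C) (D : C →ₗ[A] M) :
    bracket A C M x (D ∘ₗ LinearMap.mulLeft A y) =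
      bracket A C M x D ∘ₗ LinearMap.mulLeft A y := by
  ext c
  simp only [bracket_apply, LinearMap.comp_apply, LinearMap.mulLeft_apply, mul_left_comm x y]

theorem comp_mulLeft_mem_diffOp {n : ℕ} {D : C →ₗ[A] M} (hD : D ∈ diffOp A C M n) (y : C) :
    D ∘ₗ LinearMap.mulLeft A y ∈ diffOp A C M n := by
  induction n generalizing D with
  | zero =>
    rw [mem_diffOp_zero] at hD ⊢
    intro x
    rw [bracket_comp_mulLeft, hD, LinearMap.zero_comp]
  | succ n ih =>
    rw [mem_diffOp_succ] at hD ⊢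
    intro x
    rw [bracket_comp_mulLeft]
    exact ih (hD x)

/-- By `bracket_mul` and `bracket_algebraMap`, the elements whose bracket with `D` falls in `N` form
a kind of closure computation along the generators, provided `N` is also stable under multiplication
in the source. Orders may thus be checked on algebra generators. -/
theorem bracket_mem_of_adjoin {X : Set C} (hX : Algebra.adjoin A X = ⊤)
    (N : Submodule C (C →ₗ[A] M)) (hN : ∀ D ∈ N, ∀ y, D ∘ₗ LinearMap.mulLeft A y ∈ N)
    {D : C →ₗ[A] M} (hD : ∀ x ∈ X, bracket A C M x D ∈ N) (x : C) :
    bracket A C M x D ∈ N := by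
  have hx : x ∈ Algebra.adjoin A X := hX ▸ Algebra.mem_top
  induction hx using Algebra.adjoin_induction with
  | mem x hx => exact hD x hx
  | algebraMap a => rw [bracket_algebraMap]; exact zero_mem _
  | add x y _ _ hx hy => rw [bracket_add]; exact add_mem hx hy
  | mul x y _ _ hx hy =>
    rw [bracket_mul]
    exact add_mem (N.smul_mem _ hy) (hN _ hx _)

theorem mem_diffOp_succ_of_adjoin {X : Set C} (hX : Algebra.adjoin A X = ⊤) {n : ℕ}
    {D : C →ₗ[A] M} (hD : ∀ x ∈ X, bracket A C M x D ∈ diffOp A C M n) :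
    D ∈ diffOp A C M (n + 1) :=
  mem_diffOp_succ.2 (bracket_mem_of_adjoin hX _ (fun _ h y ↦ comp_mulLeft_mem_diffOp h y) hD)

theorem mem_diffOp_zero_of_adjoin {X : Set C} (hX : Algebra.adjoin A X = ⊤)
    {D : C →ₗ[A] M} (hD : ∀ x ∈ X, bracket A C M x D = 0) : D ∈ diffOp A C M 0 :=
  mem_diffOp_zero.2 fun x ↦ by
    simpa using bracket_mem_of_adjoin hX ⊥ (fun D h y ↦ by
      rw [Submodule.mem_bot] at h ⊢
      rw [h, LinearMap.zero_comp]) (fun x hx ↦ by simpa using hD x hx) x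

theorem bracket_comp (x : C) (ψ : C →ₗ[A] M) (θ : C →ₗ[A] C) :
    bracket A C M x (ψ ∘ₗ θ) = bracket A C M x ψ ∘ₗ θ + ψ ∘ₗ bracket A C C x θ := by
  ext c
  simp only [bracket_apply, LinearMap.comp_apply, LinearMap.add_apply, map_sub, smul_eq_mul]
  abel

theorem comp_mem_diffOp {a b : ℕ} {ψ : C →ₗ[A] M} {θ : C →ₗ[A] C} (hψ : ψ ∈ diffOp A C M a)
    (hθ : θ ∈ diffOp A C C b) : ψ ∘ₗ θ ∈ diffOp A C M (a + b) := by
  generalize hn : a + b = n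
  induction n generalizing a b ψ θ with
  | zero =>
    obtain ⟨rfl, rfl⟩ : a = 0 ∧ b = 0 := by omega
    rw [mem_diffOp_zero] at *
    intro x
    rw [bracket_comp, hψ, hθ, LinearMap.zero_comp, LinearMap.comp_zero, add_zero]
  | succ n ih =>
    rw [mem_diffOp_succ]
    intro x
    rw [bracket_comp]
    refine add_mem ?_ ?_
    · cases a with
      | zero => rw [mem_diffOp_zero.1 hψ, LinearMap.zero_comp]; exact zero_mem _
      | succ a => exact ih (mem_diffOp_succ.1 hψ x) hθ (by omega)
    · cases b with
      | zero => rw [mem_diffOp_zero.1 hθ, LinearMap.comp_zero]; exact zero_mem _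
      | succ b => exact ih hψ (mem_diffOp_succ.1 hθ x) (by omega)

theorem pow_bracket_mem_diffOp (x : C) {n m : ℕ} {D : C →ₗ[A] M}
    (hD : D ∈ diffOp A C M (n + m)) : ((bracket A C M x) ^ m) D ∈ diffOp A C M n := by
  induction m generalizing D with
  | zero => simpa using hD
  | succ m ih =>
    rw [pow_succ, Module.End.mul_apply]
    exact ih (mem_diffOp_succ.1 hD x)

/-- The bracket is the difference of two commuting operators, multiplication by `x` on the target
and on the source, so in characteristic p its p-th power is the difference of their p-th powers. -/
theorem bracket_pow {p : ℕ} [hp : Fact p.Prime] (h : (p : C) = 0) (x : C) (D : C →ₗ[A] M) :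
    bracket A C M (x ^ p) D = ((bracket A C M x) ^ p) D := by
  let r : C → Module.End C (C →ₗ[A] M) := fun x ↦ algebraMap C _ x - bracket A C M x
  have hr : ∀ x (D : C →ₗ[A] M) c, r x D c = D (x * c) := by
    intro x D c
    simp [r, bracket_apply]
  have hrp : ∀ (n : ℕ) (D : C →ₗ[A] M) c, (r x ^ n) D c = D (x ^ n * c) := by
    intro n
    induction n with
    | zero => simp
    | succ n ih =>
      intro D c
      rw [pow_succ, Module.End.mul_apply, ih, hr, pow_succ', mul_assoc]
  have hb : bracket A C M x = algebraMap C _ x - r x := (sub_sub_cancel _ _).symm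
  have hE : ((p : ℕ) : Module.End C (C →ₗ[A] M)) = 0 := by
    rw [← map_natCast (algebraMap C (Module.End C (C →ₗ[A] M))), h, map_zero]
  have hpow : (algebraMap C (Module.End C (C →ₗ[A] M)) x - r x) ^ p =
      algebraMap C _ x ^ p - r x ^ p := by
    cases subsingleton_or_nontrivial (Module.End C (C →ₗ[A] M))
    · exact Subsingleton.elim _ _
    · have : CharP (Module.End C (C →ₗ[A] M)) p := by
        obtain ⟨q, hq⟩ := CharP.exists (Module.End C (C →ₗ[A] M))
        have hd := (CharP.cast_eq_zero_iff _ q p).1 hE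
        rcases (Nat.dvd_prime hp.out).1 hd with rfl | rfl
        · exact absurd rfl (CharP.char_ne_one (Module.End C (C →ₗ[A] M)) 1)
        · exact hq
      exact sub_pow_char_of_commute _ (Algebra.commutes x (r x))
  ext c
  rw [hb, hpow, LinearMap.sub_apply, LinearMap.sub_apply, hrp, ← map_pow, bracket_apply]
  rfl

/-- A derivation that is linear over an intermediate ring is a differential operator of order `1`. -/
theorem derivation_mem_diffOp {B : Type*} [CommRing B] [Algebra A B] [Algebra B C]
    [IsScalarTower A B C] (D : Derivation B C C) :
    (D : C →ₗ[B] C).restrictScalars A ∈ diffOp A C C 1 := by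
  rw [mem_diffOp_succ]
  intro x
  rw [mem_diffOp_zero]
  intro y
  ext c
  simp only [bracket_apply, LinearMap.coe_restrictScalars, Derivation.coeFn_coe,
    Derivation.leibniz, smul_eq_mul, LinearMap.zero_apply]
  ring

theorem pow_mem_diffOp {k : ℕ} {θ : Module.End A C} (hθ : θ ∈ diffOp A C C 1) :
    (θ ^ k : Module.End A C) ∈ diffOp A C C k := by
  induction k with
  | zero =>
    rw [pow_zero, mem_diffOp_zero]
    intro x
    ext c
    simp [bracket_apply]
  | succ k ih => exact comp_mem_diffOp ih hθ

theorem bracket_pow_pow {p : ℕ} [hp : Fact p.Prime] (h : (p : C) = 0) (e : ℕ) (x : C) :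
    bracket A C M (x ^ p ^ e) = bracket A C M x ^ p ^ e := by
  induction e with
  | zero => simp
  | succ e ih => rw [pow_succ, pow_mul, pow_mul, ← ih]; exact LinearMap.ext (bracket_pow h _)

end DiffOp

section Restrict

variable {A R S M : Type*} [CommRing A] [CommRing R] [CommRing S] [Algebra A R] [Algebra A S]
  [Algebra R S] [IsScalarTower A R S] [AddCommGroup M] [Module A M] [Module R M] [Module S M]
  [IsScalarTower A R M] [IsScalarTower A S M] [IsScalarTower R S M]

variable (A R) in
/-- Restriction of operators along `R → S`. -/
def restrictOp (D : S →ₗ[A] M) : R →ₗ[A] M := D ∘ₗ (IsScalarTower.toAlgHom A R S).toLinearMap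

theorem restrictOp_apply (D : S →ₗ[A] M) (r : R) : restrictOp A R D r = D (algebraMap R S r) := rfl

theorem bracket_restrictOp (r : R) (D : S →ₗ[A] M) :
    bracket A R M r (restrictOp A R D) = restrictOp A R (bracket A S M (algebraMap R S r) D) := by
  ext c
  simp only [bracket_apply, restrictOp_apply, algebraMap_smul, map_mul]

theorem restrictOp_mem_diffOp {k : ℕ} {D : S →ₗ[A] M} (hD : D ∈ diffOp A S M k) :
    restrictOp A R D ∈ diffOp A R M k := by
  induction k generalizing D with
  | zero =>
    rw [mem_diffOp_zero] at *
    intro r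
    rw [bracket_restrictOp, hD]
    rfl
  | succ k ih =>
    rw [mem_diffOp_succ] at *
    intro r
    rw [bracket_restrictOp]
    exact ih (hD _)

/-- If `R` is generated by `p^e`-th powers of elements of `S`, restriction to `R` divides the order
of differential operators by `p^e`. -/
theorem restrictOp_mem_diffOp_of_pow {p : ℕ} [hp : Fact p.Prime] (h : (p : S) = 0) (e : ℕ)
    (hgen : Algebra.adjoin A {r : R | ∃ s : S, algebraMap R S r = s ^ p ^ e} = ⊤) {k : ℕ}
    {D : S →ₗ[A] M} (hD : D ∈ diffOp A S M (p ^ e * k)) : restrictOp A R D ∈ diffOp A R M k := by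
  induction k generalizing D with
  | zero => exact restrictOp_mem_diffOp hD
  | succ k ih =>
    refine mem_diffOp_succ_of_adjoin hgen ?_
    rintro r ⟨s, hs⟩
    rw [bracket_restrictOp, hs, bracket_pow_pow h]
    exact ih (pow_bracket_mem_diffOp s hD)

end Restrict

section Extend

variable {p : ℕ} [hp : Fact p.Prime] {A R S M : Type*} [CommRing A] [CommRing R] [CommRing S]
  [Algebra A R] [Algebra A S]
  [Algebra R S] [IsScalarTower A R S] [AddCommGroup M] [Module A M] [Module R M] [Module S M]
  [IsScalarTower A R M] [IsScalarTower A S M] [IsScalarTower R S M]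
  (hpow : ∀ s : S, s ^ p ∈ (algebraMap R S).range) {n : ℕ} {x : Fin n → S}
  (hx : IsPBasis p R S x)

/-- Extension of an operator on `R` to `S` that is constant on a `p`-basis. -/
noncomputable def extendOp (φ : R →ₗ[A] M) : S →ₗ[A] M :=
  ∑ α : Fin n → Fin p, mon x (fun i ↦ (α i : ℕ)) •
    (φ ∘ₗ ((hx.basis hpow).coord α).restrictScalars A)

theorem extendOp_apply (φ : R →ₗ[A] M) (s : S) :
    extendOp hpow hx φ s = ∑ α : Fin n → Fin p, mon x (fun i ↦ (α i : ℕ)) •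
      φ ((hx.basis hpow).repr s α) := by
  simp [extendOp]

theorem extendOp_zero : extendOp (A := A) (M := M) hpow hx 0 = 0 := by
  simp [extendOp]

theorem extendOp_smul_mon (φ : R →ₗ[A] M) (r : R) (m : Fin n → ℕ) (hm : ∀ i, m i < p) :
    extendOp hpow hx φ (r • mon x m) = mon x m • φ r := by
  have : mon x m = hx.basis hpow fun i ↦ ⟨m i, hm i⟩ :=
    (hx.basis_apply hpow fun i ↦ ⟨m i, hm i⟩).symm
  rw [extendOp_apply, Finset.sum_eq_single fun i ↦ ⟨m i, hm i⟩]
  · rw [this, map_smul, Module.Basis.repr_self]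
    simp
  · intro β _ hb
    rw [this, map_smul, Module.Basis.repr_self]
    simp [Finsupp.single_eq_of_ne hb]
  · simp

theorem extendOp_algebraMap (φ : R →ₗ[A] M) (r : R) :
    extendOp hpow hx φ (algebraMap R S r) = φ r := by
  have := extendOp_smul_mon hpow hx φ r 0 (fun _ ↦ hp.out.pos)
  simpa [mon, Algebra.smul_def] using this

theorem ext_of_mon (hpow : ∀ s : S, s ^ p ∈ (algebraMap R S).range) {n : ℕ} {x : Fin n → S}
    (hx : IsPBasis p R S x) {f g : S →ₗ[A] M}
    (hfg : ∀ (r : R) (m : Fin n → ℕ), (∀ i, m i < p) → f (r • mon x m) = g (r • mon x m)) :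
    f = g := by
  ext s
  rw [← (hx.basis hpow).sum_repr s, map_sum, map_sum]
  refine Finset.sum_congr rfl fun α _ ↦ ?_
  rw [hx.basis_apply]
  exact hfg _ (fun i ↦ (α i : ℕ)) fun i ↦ (α i).2

theorem bracket_algebraMap_extendOp (φ : R →ₗ[A] M) (r : R) :
    bracket A S M (algebraMap R S r) (extendOp hpow hx φ) =
      extendOp hpow hx (bracket A R M r φ) := by
  refine ext_of_mon hpow hx fun c m hm ↦ ?_
  rw [bracket_apply, extendOp_smul_mon _ _ _ _ _ hm, ← Algebra.smul_def, smul_smul r c,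
    extendOp_smul_mon _ _ _ _ _ hm, extendOp_smul_mon _ _ _ _ _ hm, bracket_apply, smul_sub,
    algebraMap_smul, smul_comm]

theorem pd_pow_mon (h : (p : R) = 0) (i : Fin n) (k : ℕ) (m : Fin n → ℕ) :
    ((hx.pdLinear hpow i) ^ k : Module.End R S) (mon x m) =
      (m i).descFactorial k • mon x (m - Pi.single i k) := by
  induction k with
  | zero => simp
  | succ k ih =>
    rw [pow_succ', Module.End.mul_apply, ih, map_nsmul, hx.pdLinear_mon h, smul_smul,
      Nat.descFactorial_succ]
    congr 1
    · rw [Pi.sub_apply, Pi.single_eq_same, mul_comm]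
    · congr 1
      funext j
      by_cases hj : j = i
      · subst hj
        simp only [Pi.sub_apply, Pi.single_eq_same]
        omega
      · simp [Pi.single_eq_of_ne hj]

theorem isUnit_factorial {T : Type*} [CommRing T] (h : (p : T) = 0) :
    IsUnit (((p - 1).factorial : ℕ) : T) := by
  have hlt : ∀ k, k < p → IsUnit ((k.factorial : ℕ) : T) := by
    intro k
    induction k with
    | zero => simp
    | succ k ih =>
      intro hk
      rw [Nat.factorial_succ, Nat.cast_mul]
      exact (isUnit_natCast_of_lt h k.succ_ne_zero hk).mul (ih (by omega))
  exact hlt _ (Nat.sub_lt hp.out.pos one_pos)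

/-- Multiplying a reduced monomial by x_i leaves it reduced unless its exponent at i is p - 1, so
the bracket sees only those monomials. There y = x_i^p appears as a scalar and yields the bracket of
φ with y. The operator θ = ∂_i^(p-1)/(p-1)! isolates these monomials and strips off x_i^(p-1). -/
theorem exists_bracket_extendOp (h : (p : R) = 0) (i : Fin n) :
    ∃ (y : R) (θ : S →ₗ[A] S), θ ∈ diffOp A S S (p - 1) ∧ ∀ φ : R →ₗ[A] M,
      bracket A S M (x i) (extendOp hpow hx φ) = extendOp hpow hx (bracket A R M y φ) ∘ₗ θ := by
  obtain ⟨y, hy⟩ := hpow (x i)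
  obtain ⟨u, hu⟩ := (isUnit_factorial h : IsUnit (((p - 1).factorial : ℕ) : R))
  have hp1 := hp.out.one_lt
  let δ : Module.End A S := (hx.pd h hpow i : S →ₗ[R] S).restrictScalars A
  have hδ : ∀ k s, (δ ^ k) s = ((hx.pdLinear hpow i) ^ k : Module.End R S) s := by
    intro k
    induction k with
    | zero => simp
    | succ k ih =>
      intro s
      rw [pow_succ, Module.End.mul_apply, ih, pow_succ, Module.End.mul_apply]
      rfl
  refine ⟨y, algebraMap R S ↑u⁻¹ • δ ^ (p - 1), Submodule.smul_mem _ _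
    (pow_mem_diffOp (derivation_mem_diffOp _)), fun φ ↦ ext_of_mon hpow hx fun r m hm ↦ ?_⟩
  have hxm : ∀ k, x i ^ k * mon x (m - Pi.single i k) = mon x (m - Pi.single i k + Pi.single i k) := by
    intro k
    rw [mon_add, mon_single, mul_comm]
  have hθ : (algebraMap R S ↑u⁻¹ • δ ^ (p - 1) : S →ₗ[A] S) (r • mon x m) =
      (↑u⁻¹ : R) • r • (m i).descFactorial (p - 1) • mon x (m - Pi.single i (p - 1)) := by
    rw [LinearMap.smul_apply, hδ, LinearMap.map_smul, pd_pow_mon hpow hx h, algebraMap_smul]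
  rw [bracket_apply, extendOp_smul_mon _ _ _ _ _ hm, LinearMap.comp_apply, hθ, mul_smul_comm]
  by_cases hmi : m i = p - 1
  · have hm' : ∀ j, (m - Pi.single i (p - 1) : Fin n → ℕ) j < p := fun j ↦
      lt_of_le_of_lt (by simp) (hm j)
    have hsub : m - Pi.single i (p - 1) + Pi.single i (p - 1) = m := by
      funext j
      by_cases hj : j = i
      · subst hj
        simp [hmi]
      · simp [Pi.single_eq_of_ne hj]
    have h1 : mon x m = x i ^ (p - 1) * mon x (m - Pi.single i (p - 1)) := by
      rw [hxm, hsub]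
    have h2 : x i * mon x m = y • mon x (m - Pi.single i (p - 1)) := by
      rw [h1, ← mul_assoc, ← pow_succ', Nat.sub_add_cancel hp1.le, ← hy, Algebra.smul_def]
    have h3 : ((↑u⁻¹ : R) • r • (m i).descFactorial (p - 1) • mon x (m - Pi.single i (p - 1))) =
        r • mon x (m - Pi.single i (p - 1)) := by
      rw [hmi, Nat.descFactorial_self, ← Nat.cast_smul_eq_nsmul R, ← hu, smul_comm r, smul_smul,
        Units.inv_mul, one_smul]
    rw [h3, smul_smul (x i), h2, smul_smul r y, mul_comm r y,
      extendOp_smul_mon _ _ _ _ _ hm', extendOp_smul_mon _ _ _ _ _ hm', bracket_apply, smul_sub,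
      smul_assoc, smul_comm y]
  -- Here both sides vanish: no carry occurs on the left, and p - 1 derivatives kill the monomial on
  -- the right.
  · have hlt : m i < p - 1 := lt_of_le_of_ne (Nat.le_sub_one_of_lt (hm i)) hmi
    rw [Nat.descFactorial_eq_zero_iff_lt.2 hlt, zero_smul, smul_zero, smul_zero, map_zero]
    have h1 : x i * mon x m = mon x (m + Pi.single i 1) := by
      rw [mon_add, mon_single, pow_one, mul_comm]
    rw [h1, extendOp_smul_mon, ← h1, mul_smul, sub_self]
    intro j
    by_cases hj : j = i
    · subst hj
      simp only [Pi.add_apply, Pi.single_eq_same]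
      omega
    · simpa [Pi.single_eq_of_ne hj] using hm j

theorem adjoin_range_union_eq_top (hpow : ∀ s : S, s ^ p ∈ (algebraMap R S).range) {n : ℕ} {x : Fin n → S}
    (hx : IsPBasis p R S x) :
    Algebra.adjoin A (Set.range (algebraMap R S) ∪ Set.range x) = ⊤ := by
  rw [eq_top_iff]
  intro s _
  rw [← (hx.basis hpow).sum_repr s]
  refine Subalgebra.sum_mem _ fun α _ ↦ ?_
  rw [hx.basis_apply, Algebra.smul_def]
  refine Subalgebra.mul_mem _ (Algebra.subset_adjoin (Set.mem_union_left _ ⟨_, rfl⟩))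
    (Subalgebra.prod_mem _ fun i _ ↦ Subalgebra.pow_mem _ ?_ _)
  exact Algebra.subset_adjoin (Set.mem_union_right _ (Set.mem_range_self i))

/-- The count is p(k+1) = pk + (p-1) + 1: pk for the extension of a bracket of φ, p - 1 for θ in
`exists_bracket_extendOp`, and 1 for the bracket taken. Only the elements of `R` and the p-basis
need testing. -/
theorem extendOp_mem_diffOp (h : (p : R) = 0) {k : ℕ} {φ : R →ₗ[A] M}
    (hφ : φ ∈ diffOp A R M k) : extendOp hpow hx φ ∈ diffOp A S M (p * k) := by
  induction k generalizing φ with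
  | zero =>
    refine mem_diffOp_zero_of_adjoin (adjoin_range_union_eq_top hpow hx) ?_
    rw [mem_diffOp_zero] at hφ
    rintro _ (⟨r, rfl⟩ | ⟨i, rfl⟩)
    · rw [bracket_algebraMap_extendOp, hφ, extendOp_zero]
    · obtain ⟨y, θ, -, hθ⟩ := exists_bracket_extendOp (A := A) (M := M) hpow hx h i
      rw [hθ, hφ, extendOp_zero, LinearMap.zero_comp]
  | succ k ih =>
    have hp1 := hp.out.pos
    have hk : p * (k + 1) = (p * k + (p - 1)) + 1 := by
      rw [mul_add]; omega
    rw [hk]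
    refine mem_diffOp_succ_of_adjoin (adjoin_range_union_eq_top hpow hx) ?_
    rw [mem_diffOp_succ] at hφ
    rintro _ (⟨r, rfl⟩ | ⟨i, rfl⟩)
    · rw [bracket_algebraMap_extendOp]
      exact diffOp_mono (Nat.le_add_right _ _) (ih (hφ r))
    · obtain ⟨y, θ, hθ, hθ'⟩ := exists_bracket_extendOp (A := A) (M := M) hpow hx h i
      rw [hθ']
      exact comp_mem_diffOp (ih (hφ y)) hθ

end Extend

end RingExt

/-! ### Principal parts as universal operators; extension over localizations -/

namespace RingExt

set_option linter.unusedSectionVars false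

section PrincipalParts

variable {A C M : Type*} [CommRing A] [CommRing C] [Algebra A C]
  [AddCommGroup M] [Module A M] [Module C M] [IsScalarTower A C M]

/-- This is the dictionary between brackets and the ideal of the diagonal: multiplying by a
generator of J before the linearization of `D` amounts, up to sign, to taking a bracket. -/
theorem liftBaseChange_one_sub_mul (x : C) (D : C →ₗ[A] M) (t : C ⊗[A] C) :
    D.liftBaseChange C ((1 ⊗ₜ[A] x - x ⊗ₜ[A] 1) * t) =
      -(bracket A C M x D).liftBaseChange C t := by
  induction t with
  | zero => simp
  | add a b ha hb => rw [mul_add, map_add, ha, hb, map_add, neg_add]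
  | tmul a b =>
    simp only [sub_mul, Algebra.TensorProduct.tmul_mul_tmul, one_mul, map_sub,
      LinearMap.liftBaseChange_tmul, bracket_apply, smul_sub, mul_smul, smul_comm x a]
    abel

theorem liftBaseChange_eq_zero_iff (D : C →ₗ[A] M) : (∀ t, D.liftBaseChange C t = 0) ↔ D = 0 := by
  constructor
  · intro h
    ext c
    simpa using h (1 ⊗ₜ c)
  · rintro rfl t
    simp

theorem forall_mem_ideal_mul_iff (K : Ideal (C ⊗[A] C)) (D : C →ₗ[A] M) :
    (∀ t ∈ KaehlerDifferential.ideal A C * K, D.liftBaseChange C t = 0) ↔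
      ∀ x, ∀ t ∈ K, (bracket A C M x D).liftBaseChange C t = 0 := by
  constructor
  · intro h x t ht
    have := h _ (Ideal.mul_mem_mul (KaehlerDifferential.one_smul_sub_smul_one_mem_ideal A x) ht)
    rwa [liftBaseChange_one_sub_mul, neg_eq_zero] at this
  · intro h t ht
    induction ht using Submodule.mul_induction_on' with
    | add _ _ _ _ h1 h2 => rw [map_add, h1, h2, add_zero]
    | mem_mul_mem a ha b hb =>
      rw [← KaehlerDifferential.span_range_eq_ideal] at ha
      induction ha using Submodule.span_induction generalizing b with
      | zero => rw [zero_mul, map_zero]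
      | add _ _ _ _ h1 h2 => rw [add_mul, map_add, h1 b hb, h2 b hb, add_zero]
      | smul c a _ h1 =>
        rw [smul_eq_mul, mul_comm c, mul_assoc]
        exact h1 _ (K.mul_mem_left c hb)
      | mem _ hm =>
        obtain ⟨x, rfl⟩ := hm
        rw [liftBaseChange_one_sub_mul, h x b hb, neg_zero]

/-- Each bracket trades one factor of J. This gives the universal property: operators of order at
most k are exactly the linear maps on C ⊗ C that factor through P^k. -/
theorem mem_diffOp_iff {k : ℕ} {D : C →ₗ[A] M} :
    D ∈ diffOp A C M k ↔
      ∀ t ∈ KaehlerDifferential.ideal A C ^ (k + 1), D.liftBaseChange C t = 0 := by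
  induction k generalizing D with
  | zero =>
    rw [zero_add, pow_one, mem_diffOp_zero, ← Ideal.mul_top (KaehlerDifferential.ideal A C),
      forall_mem_ideal_mul_iff]
    simp [liftBaseChange_eq_zero_iff]
  | succ k ih =>
    rw [mem_diffOp_succ, pow_succ', forall_mem_ideal_mul_iff]
    simp only [ih]

variable (A C) in
/-- The quotient map onto the module of principal parts. -/
noncomputable def PrincipalParts.mk (k : ℕ) : C ⊗[A] C →ₗ[C] PrincipalParts A C k :=
  (Ideal.Quotient.mkₐ C (KaehlerDifferential.ideal A C ^ (k + 1))).toLinearMap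

theorem PrincipalParts.mk_surjective (k : ℕ) : Function.Surjective (PrincipalParts.mk A C k) :=
  Ideal.Quotient.mk_surjective

theorem PrincipalParts.mk_eq_zero_iff {k : ℕ} {t : C ⊗[A] C} :
    PrincipalParts.mk A C k t = 0 ↔ t ∈ KaehlerDifferential.ideal A C ^ (k + 1) :=
  Ideal.Quotient.eq_zero_iff_mem

variable (A C) in
/-- The universal differential operator of order `k`. -/
noncomputable def PrincipalParts.d (k : ℕ) : C →ₗ[A] PrincipalParts A C k :=
  (PrincipalParts.mk A C k).restrictScalars A ∘ₗ
    (Algebra.TensorProduct.includeRight : C →ₐ[A] C ⊗[A] C).toLinearMap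

theorem PrincipalParts.liftBaseChange_d (k : ℕ) (t : C ⊗[A] C) :
    (PrincipalParts.d A C k).liftBaseChange C t = PrincipalParts.mk A C k t := by
  induction t with
  | zero => simp
  | add a b ha hb => rw [map_add, ha, hb, map_add]
  | tmul a b =>
    rw [LinearMap.liftBaseChange_tmul]
    change a • PrincipalParts.mk A C k (1 ⊗ₜ b) = _
    rw [← map_smul, TensorProduct.smul_tmul', smul_eq_mul, mul_one]

theorem PrincipalParts.d_mem (k : ℕ) :
    PrincipalParts.d A C k ∈ diffOp A C (PrincipalParts A C k) k := by
  rw [mem_diffOp_iff]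
  intro t ht
  rw [liftBaseChange_d, mk_eq_zero_iff]
  exact ht

/-- The linear map on principal parts induced by a differential operator. -/
noncomputable def PrincipalParts.lift {k : ℕ} (D : C →ₗ[A] M) (hD : D ∈ diffOp A C M k) :
    PrincipalParts A C k →ₗ[C] M :=
  { (QuotientAddGroup.lift (KaehlerDifferential.ideal A C ^ (k + 1)).toAddSubgroup
      (D.liftBaseChange C).toAddMonoidHom
      (fun t ht ↦ mem_diffOp_iff.1 hD t ht) : PrincipalParts A C k →+ M) with
    map_smul' := fun c z ↦ by
      obtain ⟨t, rfl⟩ := PrincipalParts.mk_surjective k z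
      rw [← map_smul]
      exact (D.liftBaseChange C).map_smul c t }

theorem PrincipalParts.lift_mk {k : ℕ} (D : C →ₗ[A] M) (hD : D ∈ diffOp A C M k)
    (t : C ⊗[A] C) : lift D hD (PrincipalParts.mk A C k t) = D.liftBaseChange C t := rfl

theorem PrincipalParts.lift_d {k : ℕ} (D : C →ₗ[A] M) (hD : D ∈ diffOp A C M k) (c : C) :
    lift D hD (PrincipalParts.d A C k c) = D c := by
  refine (lift_mk D hD _).trans ?_
  simp

theorem PrincipalParts.hom_ext {k : ℕ} {f g : PrincipalParts A C k →ₗ[C] M}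
    (h : ∀ c, f (PrincipalParts.d A C k c) = g (PrincipalParts.d A C k c)) : f = g := by
  refine LinearMap.ext fun z ↦ ?_
  obtain ⟨t, rfl⟩ := PrincipalParts.mk_surjective k z
  rw [← liftBaseChange_d]
  induction t with
  | zero => simp
  | add a b ha hb => rw [map_add, map_add, ha, hb, map_add]
  | tmul a b => rw [LinearMap.liftBaseChange_tmul, map_smul, h, map_smul]

theorem comp_mem_diffOp_of_linear {M' : Type*} [AddCommGroup M'] [Module A M'] [Module C M']
    [IsScalarTower A C M'] {k : ℕ} {D : C →ₗ[A] M} (hD : D ∈ diffOp A C M k) (f : M →ₗ[C] M') :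
    f.restrictScalars A ∘ₗ D ∈ diffOp A C M' k := by
  have hb : ∀ x (D : C →ₗ[A] M), bracket A C M' x (f.restrictScalars A ∘ₗ D) =
      f.restrictScalars A ∘ₗ bracket A C M x D := by
    intro x D
    ext c
    simp [bracket_apply]
  induction k generalizing D with
  | zero =>
    rw [mem_diffOp_zero] at *
    intro x
    rw [hb, hD, LinearMap.comp_zero]
  | succ k ih =>
    rw [mem_diffOp_succ] at *
    intro x
    rw [hb]
    exact ih (hD x)

end PrincipalParts

section Localize

variable {p : ℕ} [hp : Fact p.Prime] {A R R' M : Type*} [CommRing A] [CommRing R] [CommRing R']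
  [Algebra A R] [Algebra A R'] [Algebra R R'] [IsScalarTower A R R']
  [AddCommGroup M] [Module A M] [Module R M] [Module R' M]
  [IsScalarTower A R M] [IsScalarTower A R' M] [IsScalarTower R R' M]

/-- Localization of an extension of finite exponent can be done on the base. -/
theorem isLocalizedModule_comap {N : ℕ} (hN : HasExponentLE p A R N) (W : Submonoid R)
    [IsLocalization W R'] :
    IsLocalizedModule (W.comap (algebraMap A R)) (IsScalarTower.toAlgHom A R R').toLinearMap where
  map_units a := by
    rw [Module.End.isUnit_iff]
    obtain ⟨y, hy⟩ := (IsLocalization.map_units R' (⟨_, a.2⟩ : W)).exists_right_inv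
    have ha : ∀ z : R', algebraMap A (Module.End A R') a z = algebraMap R R' (algebraMap A R a) * z := by
      intro z
      rw [Module.algebraMap_end_apply, Algebra.smul_def, ← IsScalarTower.algebraMap_apply]
    refine Function.bijective_iff_has_inverse.2 ⟨fun z ↦ y * z, fun z ↦ ?_, fun z ↦ ?_⟩
    · dsimp only
      rw [ha, ← mul_assoc, mul_comm y, hy, one_mul]
    · dsimp only
      rw [ha, ← mul_assoc, hy, one_mul]
  surj y := by
    obtain ⟨⟨r, g⟩, hg⟩ := IsLocalization.surj W y
    obtain ⟨a, ha⟩ := hN g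
    have hpos : p ^ N = (p ^ N - 1) + 1 :=
      (Nat.sub_add_cancel (Nat.one_le_pow _ _ hp.out.pos)).symm
    -- A fraction r/g is rewritten with denominator g^(p^N), which comes from `A`.
    refine ⟨⟨r * g ^ (p ^ N - 1), a, ?_⟩, ?_⟩
    · rw [Submonoid.mem_comap, ha]
      exact W.pow_mem g.2 _
    · rw [Submonoid.smul_def, Algebra.smul_def, IsScalarTower.algebraMap_apply A R R']
      change algebraMap R R' (algebraMap A R a) * y = algebraMap R R' (r * (g : R) ^ (p ^ N - 1))
      rw [ha, map_mul, ← hg, hpos, pow_succ, map_mul]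
      simp only [add_tsub_cancel_right]
      ring
  exists_of_eq {r₁ r₂} h := by
    obtain ⟨g, hg⟩ := (IsLocalization.eq_iff_exists W R').1 h
    obtain ⟨a, ha⟩ := hN g
    have hpos : p ^ N = (p ^ N - 1) + 1 :=
      (Nat.sub_add_cancel (Nat.one_le_pow _ _ hp.out.pos)).symm
    refine ⟨⟨a, ?_⟩, ?_⟩
    · rw [Submonoid.mem_comap, ha]
      exact W.pow_mem g.2 _
    · rw [Submonoid.smul_def, Submonoid.smul_def, Algebra.smul_def, Algebra.smul_def, ha, hpos,
        pow_succ, mul_assoc, hg, mul_assoc]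

/-- Differential operators extend to localizations. -/
theorem exists_diffOp_localization {N : ℕ} (hN : HasExponentLE p A R N) (W : Submonoid R)
    [IsLocalization W R'] {k : ℕ} {φ : R →ₗ[A] M} (hφ : φ ∈ diffOp A R M k) :
    ∃ φ' ∈ diffOp A R' M k, ∀ r, φ' (algebraMap R R' r) = φ r := by
  have hloc := isLocalizedModule_comap (R' := R') hN W
  set W' := W.comap (algebraMap A R)
  have hu : ∀ a : W', ∃ y : R', algebraMap A R' a * y = 1 := by
    intro a
    rw [IsScalarTower.algebraMap_apply A R R']
    exact (IsLocalization.map_units R' (⟨_, a.2⟩ : W)).exists_right_inv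
  have hM : ∀ a : W', IsUnit (algebraMap A (Module.End A M) a) := by
    intro a
    obtain ⟨y, hy⟩ := hu a
    rw [Module.End.isUnit_iff]
    have ha : ∀ z : M, algebraMap A (Module.End A M) a z = algebraMap A R' a • z := by
      intro z
      rw [Module.algebraMap_end_apply, algebraMap_smul]
    refine Function.bijective_iff_has_inverse.2 ⟨fun z ↦ y • z, fun z ↦ ?_, fun z ↦ ?_⟩
    · dsimp only
      rw [ha, smul_smul, mul_comm, hy, one_smul]
    · dsimp only
      rw [ha, smul_smul, hy, one_smul]
  let e : (R →ₗ[A] M) → (R' →ₗ[A] M) := fun φ ↦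
    IsLocalizedModule.lift W' (IsScalarTower.toAlgHom A R R').toLinearMap φ hM
  have he : ∀ φ r, e φ (algebraMap R R' r) = φ r := fun φ r ↦
    IsLocalizedModule.lift_apply W' (IsScalarTower.toAlgHom A R R').toLinearMap φ hM r
  have hext : ∀ f g : R' →ₗ[A] M, (∀ r, f (algebraMap R R' r) = g (algebraMap R R' r)) → f = g :=
    fun f g h ↦ IsLocalizedModule.ext W' (IsScalarTower.toAlgHom A R R').toLinearMap hM
      (LinearMap.ext h)
  have hbr : ∀ φ r, bracket A R' M (algebraMap R R' r) (e φ) = e (bracket A R M r φ) := by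
    intro φ r
    refine hext _ _ fun c ↦ ?_
    rw [bracket_apply, ← map_mul, he, he, he, bracket_apply, algebraMap_smul]
  -- Inverses of scalars from `A` have zero bracket because `D` is `A`-linear. Together with `R`
  -- they generate `R'`, so localizing does not raise the order.
  have hbi : ∀ (D : R' →ₗ[A] M) (a : W') (y : R'), algebraMap A R' a * y = 1 →
      bracket A R' M y D = 0 := by
    intro D a y hy
    ext c
    rw [bracket_apply, LinearMap.zero_apply, sub_eq_zero]
    have : c = (a : A) • (y * c) := by
      rw [Algebra.smul_def, ← mul_assoc, hy, one_mul]
    conv_lhs => rw [this, map_smul, ← algebraMap_smul R' (a : A), smul_smul, mul_comm, hy, one_smul]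
  let X : Set R' := Set.range (algebraMap R R') ∪ {y | ∃ a : W', algebraMap A R' a * y = 1}
  have hX : Algebra.adjoin A X = ⊤ := by
    rw [eq_top_iff]
    intro z _
    obtain ⟨⟨r, a⟩, hra⟩ := hloc.surj z
    obtain ⟨y, hy⟩ := hu a
    have hz : z = algebraMap R R' r * y := by
      have : algebraMap R R' r = algebraMap A R' a * z := by
        rw [← Algebra.smul_def]
        exact hra.symm
      rw [this, mul_right_comm, hy, one_mul]
    rw [hz]
    exact Subalgebra.mul_mem _ (Algebra.subset_adjoin (Set.mem_union_left _ ⟨r, rfl⟩))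
      (Algebra.subset_adjoin (Set.mem_union_right _ ⟨a, hy⟩))
  refine ⟨e φ, ?_, he φ⟩
  have he0 : e 0 = 0 := hext _ _ fun r ↦ by simp [he]
  induction k generalizing φ with
  | zero =>
    rw [mem_diffOp_zero] at hφ
    refine mem_diffOp_zero_of_adjoin hX ?_
    rintro _ (⟨r, rfl⟩ | ⟨a, ha⟩)
    · rw [hbr, hφ, he0]
    · exact hbi _ a _ ha
  | succ k ih =>
    rw [mem_diffOp_succ] at hφ
    refine mem_diffOp_succ_of_adjoin hX ?_
    rintro _ (⟨r, rfl⟩ | ⟨a, ha⟩)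
    · rw [hbr]
      exact ih (hφ r)
    · rw [hbi _ a _ ha]
      exact zero_mem _

/-- Differential operators of order `k` on `R` extend to operators of order `p k` on `S` when `S`
has a `p`-basis over `R` after a localization that acts invertibly on the values. -/
theorem exists_diffOp_extension {S D : Type*} [CommRing S] [CommRing D] [Algebra A S]
    [Algebra R S] [Algebra A D] [Algebra R D] [Algebra S D] [Algebra R' D]
    [IsScalarTower A R S] [IsScalarTower A S D] [IsScalarTower R S D] [IsScalarTower R R' D]
    [IsScalarTower A R' D] [Module S M] [Module D M] [IsScalarTower S D M]
    [IsScalarTower R' D M] [IsScalarTower A D M] [IsScalarTower A S M]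
    (h : (p : A) = 0) {N : ℕ} (hN : HasExponentLE p A R N) (W : Submonoid R) [IsLocalization W R']
    (hpow : ∀ s : D, s ^ p ∈ (algebraMap R' D).range) {n : ℕ} {x : Fin n → D}
    (hx : IsPBasis p R' D x) {k : ℕ} {φ : R →ₗ[A] M} (hφ : φ ∈ diffOp A R M k) :
    ∃ ψ ∈ diffOp A S M (p * k), ∀ r, ψ (algebraMap R S r) = φ r := by
  obtain ⟨φ', hφ', he⟩ := exists_diffOp_localization (R' := R') hN W hφ
  -- The operator travels from `R` to `R'`, then along the p-basis to `D`, and back down to `S`;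
  -- only the middle move multiplies the order.
  refine ⟨restrictOp A S (extendOp hpow hx φ'),
    restrictOp_mem_diffOp (extendOp_mem_diffOp hpow hx (cast_eq_zero_of_algebra R' h) hφ'),
    fun r ↦ ?_⟩
  rw [restrictOp_apply, ← IsScalarTower.algebraMap_apply, IsScalarTower.algebraMap_apply R R' D,
    extendOp_algebraMap, he]

end Localize

end RingExt

/-! ### Local-to-global arguments and comparison of principal parts -/

namespace RingExt

section Local

/-- Flatness can be tested at primes of flat algebras lying over the maximal ideals. -/
theorem flat_of_forall_maximal.{w} {C M : Type*} [CommRing C] [AddCommGroup M] [Module C M]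
    (H : ∀ (𝔐 : Ideal C) [𝔐.IsMaximal], ∃ (D : Type w) (_ : CommRing D) (_ : Algebra C D)
      (Q : Ideal D) (_ : Q.IsPrime), Q.under C = 𝔐 ∧ Module.Flat C D ∧
        Module.Flat D (D ⊗[C] M)) : Module.Flat C M := by
  refine Module.flat_of_localized_maximal _ fun 𝔐 h𝔐 ↦ ?_
  obtain ⟨D, _, _, Q, _, rfl, _, _⟩ := H 𝔐
  let := Localization.AtPrime.algebraOfLiesOver (Q.under C) Q
  have : IsLocalHom (algebraMap (Localization.AtPrime (Q.under C)) (Localization.AtPrime Q)) :=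
    Localization.isLocalHom_localRingHom _ _ _ Ideal.LiesOver.over
  -- A flat local homomorphism of local rings is faithfully flat, so flatness over the localization
  -- of `D` at `Q` descends to the localization of `C` at its contraction.
  have : Module.FaithfullyFlat (Localization.AtPrime (Q.under C)) (Localization.AtPrime Q) :=
    Module.FaithfullyFlat.of_flat_of_isLocalHom
  let L := Localization.AtPrime (Q.under C)
  let E := Localization.AtPrime Q
  let e : E ⊗[L] (L ⊗[C] M) ≃ₗ[E] E ⊗[D] (D ⊗[C] M) :=
    TensorProduct.AlgebraTensorModule.cancelBaseChange C L E E M ≪≫ₗ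
      (TensorProduct.AlgebraTensorModule.cancelBaseChange C D E E M).symm
  have : Module.Flat E (E ⊗[L] (L ⊗[C] M)) := Module.Flat.of_linearEquiv e
  have : Module.Flat L (L ⊗[C] M) := Module.Flat.of_flat_tensorProduct L _ E
  have : Module.Flat C (L ⊗[C] M) := Module.Flat.trans C L _
  exact Module.Flat.of_linearEquiv
    ((IsLocalizedModule.isBaseChange (Q.under C).primeCompl L
      (LocalizedModule.mkLinearMap (Q.under C).primeCompl M)).equiv.restrictScalars C).symm

/-- Retractions can be constructed locally. -/
theorem exists_retraction_of_localized {S N P : Type*} [CommRing S] [AddCommGroup N]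
    [AddCommGroup P] [Module S N] [Module S P] [Module.Finite S N]
    [Module.FinitePresentation S P] (i : N →ₗ[S] P)
    (H : ∀ (𝔐 : Ideal S) [𝔐.IsMaximal], ∃ ρ : P →ₗ[S] LocalizedModule 𝔐.primeCompl N,
      ρ ∘ₗ i = LocalizedModule.mkLinearMap 𝔐.primeCompl N) :
    ∃ g : P →ₗ[S] N, g ∘ₗ i = LinearMap.id := by
  let I : Ideal S := (LinearMap.range (LinearMap.lcomp S N i)).comap
    (LinearMap.toSpanSingleton S _ LinearMap.id)
  have hI : ∀ a, a ∈ I ↔ ∃ g : P →ₗ[S] N, g ∘ₗ i = a • LinearMap.id := fun a ↦ Iff.rfl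
  have htop : I = ⊤ := by
    by_contra hne
    obtain ⟨𝔐, h𝔐, hle⟩ := Ideal.exists_le_maximal I hne
    obtain ⟨ρ, hρ⟩ := H 𝔐
    obtain ⟨g, s, hg⟩ := Module.FinitePresentation.exists_lift_of_isLocalizedModule
      𝔐.primeCompl (LocalizedModule.mkLinearMap 𝔐.primeCompl N) ρ
    obtain ⟨s', hs'⟩ := Module.Finite.exists_smul_of_comp_eq_of_isLocalizedModule
      𝔐.primeCompl (LocalizedModule.mkLinearMap 𝔐.primeCompl N) (g ∘ₗ i) ((s : S) • LinearMap.id)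
      (by
        rw [← LinearMap.comp_assoc, hg]
        refine LinearMap.ext fun z ↦ ?_
        simp [← hρ, Submonoid.smul_def])
    refine (𝔐.primeCompl.mul_mem s'.2 s.2 : (s' : S) * s ∉ 𝔐) (hle ((hI _).2 ⟨(s' : S) • g, ?_⟩))
    rw [LinearMap.smul_comp, mul_smul]
    exact hs'
  obtain ⟨g, hg⟩ := (hI 1).1 (htop ▸ Submodule.mem_top)
  exact ⟨g, by rw [hg, one_smul]⟩

end Local

set_option linter.unusedSectionVars false

section Step

variable {p : ℕ} [hp : Fact p.Prime] {A R S : Type*} [CommRing A] [CommRing R] [CommRing S]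
  [Algebra A R] [Algebra A S] [Algebra R S] [IsScalarTower A R S]

theorem pow_mem_range_of_localization (h : (p : R) = 0)
    (hpow : ∀ s : S, s ^ p ∈ (algebraMap R S).range)
    (R' : Type*) [CommRing R'] [Algebra R R'] (z : R' ⊗[R] S) :
    z ^ p ∈ (algebraMap R' (R' ⊗[R] S)).range := by
  have h' : (p : R' ⊗[R] S) = 0 := cast_eq_zero_of_algebra _ (cast_eq_zero_of_algebra R' h)
  have key : ∀ z : R' ⊗[R] S, powHom h' 1 z = z ^ p := fun z ↦ by rw [powHom_apply, pow_one]
  rw [← key]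
  induction z with
  | zero => rw [map_zero]; exact zero_mem _
  | add a b ha hb =>
    rw [map_add]
    exact add_mem ha hb
  | tmul a s =>
    obtain ⟨r, hr⟩ := hpow s
    rw [key, Algebra.TensorProduct.tmul_pow, ← hr]
    refine ⟨a ^ p * algebraMap R R' r, ?_⟩
    rw [Algebra.TensorProduct.algebraMap_apply, Algebra.algebraMap_self, RingHom.id_apply, mul_comm,
      ← Algebra.smul_def, TensorProduct.smul_tmul, Algebra.smul_def, mul_one]

/-- p-bases exist only locally on `R`. If the values form a module over a ring in which everything
outside 𝔮 is invertible, a p-basis at 𝔮 suffices to extend operators between the unlocalized rings.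
-/
theorem exists_diffOp_extension_of_isUnit {L M : Type*} [CommRing L] [AddCommGroup M]
    [Algebra A L] [Algebra R L] [Algebra S L] [IsScalarTower A R L] [IsScalarTower A S L]
    [IsScalarTower R S L] [Module A M] [Module R M] [Module S M] [Module L M]
    [IsScalarTower A R M] [IsScalarTower A S M] [IsScalarTower R S M] [IsScalarTower S L M]
    (h : (p : A) = 0) {N : ℕ} (hN : HasExponentLE p A R N)
    (hpow : ∀ s : S, s ^ p ∈ (algebraMap R S).range) (𝔮 : Ideal R) [𝔮.IsPrime]
    (hunit : ∀ r ∉ 𝔮, IsUnit (algebraMap R L r)) {n : ℕ}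
    {x : Fin n → Localization.AtPrime 𝔮 ⊗[R] S}
    (hx : IsPBasis p (Localization.AtPrime 𝔮) (Localization.AtPrime 𝔮 ⊗[R] S) x) {k : ℕ}
    {φ : R →ₗ[A] M} (hφ : φ ∈ diffOp A R M k) :
    ∃ ψ ∈ diffOp A S M (p * k), ∀ r, ψ (algebraMap R S r) = φ r := by
  let R' := Localization.AtPrime 𝔮
  let D := R' ⊗[R] S
  let l : R' →+* L := IsLocalization.lift (M := 𝔮.primeCompl) (fun r ↦ hunit r r.2)
  let : Algebra R' L := l.toAlgebra
  have hl : ∀ r, algebraMap R' L (algebraMap R R' r) = algebraMap R L r := fun r ↦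
    IsLocalization.lift_eq _ r
  have : IsScalarTower R R' L := IsScalarTower.of_algebraMap_eq fun r ↦ (hl r).symm
  let : Algebra S D := Algebra.TensorProduct.rightAlgebra
  let f : D →ₐ[R'] L := Algebra.TensorProduct.lift (Algebra.ofId R' L)
    (IsScalarTower.toAlgHom R S L) (fun _ _ ↦ Commute.all _ _)
  have hf : ∀ s, f (algebraMap S D s) = algebraMap S L s := by
    intro s
    refine (Algebra.TensorProduct.lift_tmul _ _ _ 1 s).trans ?_
    rw [map_one, one_mul]
    rfl
  let : Module R' M := Module.compHom M l
  let : Module D M := Module.compHom M f.toRingHom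
  have h1 : ∀ (r : R') (m : M), r • m = algebraMap R' L r • m := fun _ _ ↦ rfl
  have h2 : ∀ (r : D) (m : M), r • m = f r • m := fun _ _ ↦ rfl
  have h3 : ∀ (r : R) (m : M), algebraMap R L r • m = r • m := by
    intro r m
    rw [IsScalarTower.algebraMap_apply R S L, algebraMap_smul, algebraMap_smul]
  have : IsScalarTower R R' M := .of_algebraMap_smul fun r m ↦ by rw [h1, hl, h3]
  have : IsScalarTower A R' M := .of_algebraMap_smul fun r m ↦ by
    rw [IsScalarTower.algebraMap_apply A R R', algebraMap_smul, algebraMap_smul]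
  have : IsScalarTower S D M := .of_algebraMap_smul fun s m ↦ by
    rw [h2, hf, algebraMap_smul]
  have : IsScalarTower R' D M := .of_algebraMap_smul fun s m ↦ by
    rw [h2, AlgHom.commutes, h1]
  have : IsScalarTower R S D := .of_algebraMap_eq fun r ↦ by
    change algebraMap R' D (algebraMap R R' r) = 1 ⊗ₜ algebraMap R S r
    rw [Algebra.TensorProduct.algebraMap_apply, Algebra.algebraMap_self, RingHom.id_apply,
      Algebra.algebraMap_eq_smul_one, TensorProduct.smul_tmul, Algebra.algebraMap_eq_smul_one]
  have : IsScalarTower A S D := .of_algebraMap_eq fun a ↦ by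
    rw [IsScalarTower.algebraMap_apply A R S, ← IsScalarTower.algebraMap_apply R S D,
      ← IsScalarTower.algebraMap_apply A R D]
  have : IsScalarTower A D M := .of_algebraMap_smul fun a m ↦ by
    rw [IsScalarTower.algebraMap_apply A S D, h2, hf, algebraMap_smul, algebraMap_smul]
  exact exists_diffOp_extension h hN 𝔮.primeCompl
    (pow_mem_range_of_localization (cast_eq_zero_of_algebra R h) hpow R') hx hφ

variable (p A R S) in
/-- The comparison map of principal parts for an extension generated by `p^e`-th powers. -/
noncomputable def principalPartsMap (h : (p : A) = 0) (e : ℕ)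
    (hgen : Algebra.adjoin A {r : R | ∃ s : S, algebraMap R S r = s ^ p ^ e} = ⊤) (k : ℕ) :
    S ⊗[R] PrincipalParts A R k →ₗ[S] PrincipalParts A S (p ^ e * k) :=
  (PrincipalParts.lift (restrictOp A R (PrincipalParts.d A S (p ^ e * k)))
    (restrictOp_mem_diffOp_of_pow (cast_eq_zero_of_algebra S h) e hgen
      (PrincipalParts.d_mem _))).liftBaseChange S

theorem principalPartsMap_tmul_d (h : (p : A) = 0) (e : ℕ)
    (hgen : Algebra.adjoin A {r : R | ∃ s : S, algebraMap R S r = s ^ p ^ e} = ⊤) (k : ℕ) (r : R) :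
    principalPartsMap p A R S h e hgen k (1 ⊗ₜ PrincipalParts.d A R k r) =
      PrincipalParts.d A S (p ^ e * k) (algebraMap R S r) := by
  rw [principalPartsMap, LinearMap.liftBaseChange_tmul, one_smul, PrincipalParts.lift_d,
    restrictOp_apply]

/-- A linear map out of the base change of P^k of `R` is the same as an operator of order k on `R`.
Extending this operator to `S` factors the map through the comparison map; with the identity as map
this would be a retraction. -/
theorem exists_principalPartsMap_extension {M : Type*} [AddCommGroup M]
    [Module A M] [Module R M] [Module S M]
    [IsScalarTower A R M] [IsScalarTower A S M] [IsScalarTower R S M] (h : (p : A) = 0) (e : ℕ)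
    (hgen : Algebra.adjoin A {r : R | ∃ s : S, algebraMap R S r = s ^ p ^ e} = ⊤) {k : ℕ}
    (hext : ∀ φ ∈ diffOp A R M k, ∃ ψ ∈ diffOp A S M (p ^ e * k), ∀ r,
      ψ (algebraMap R S r) = φ r)
    (m : S ⊗[R] PrincipalParts A R k →ₗ[S] M) :
    ∃ ρ : PrincipalParts A S (p ^ e * k) →ₗ[S] M,
      ρ ∘ₗ principalPartsMap p A R S h e hgen k = m := by
  let m' : PrincipalParts A R k →ₗ[R] M :=
    m.restrictScalars R ∘ₗ TensorProduct.mk R S (PrincipalParts A R k) 1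
  obtain ⟨ψ, hψ, he⟩ := hext _ (comp_mem_diffOp_of_linear (PrincipalParts.d_mem (A := A) k) m')
  refine ⟨PrincipalParts.lift ψ hψ, LinearMap.ext fun z ↦ ?_⟩
  have key : (PrincipalParts.lift ψ hψ ∘ₗ principalPartsMap p A R S h e hgen k).restrictScalars R ∘ₗ
      TensorProduct.mk R S (PrincipalParts A R k) 1 = m' := by
    refine PrincipalParts.hom_ext fun r ↦ ?_
    refine (congrArg (PrincipalParts.lift ψ hψ) (principalPartsMap_tmul_d h e hgen k r)).trans ?_
    rw [PrincipalParts.lift_d, he]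
    rfl
  induction z with
  | zero => rw [map_zero, map_zero]
  | add a b ha hb => rw [map_add, map_add, ha, hb]
  | tmul s y =>
    have hs : s ⊗ₜ[R] y = s • (1 ⊗ₜ[R] y) := by
      rw [TensorProduct.smul_tmul', smul_eq_mul, mul_one]
    rw [hs, map_smul, map_smul]
    exact congrArg (s • ·) (LinearMap.congr_fun key y)

-- Operators are extended only for values in localizations at maximal ideals of `S`; the finiteness
-- assumptions glue the resulting local retractions.
universe v w in
theorem exists_retraction_principalPartsMap {R : Type v} {S : Type w} [CommRing R] [CommRing S]
    [Algebra A R] [Algebra A S] [Algebra R S] [IsScalarTower A R S] (h : (p : A) = 0) (e : ℕ)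
    (hgen : Algebra.adjoin A {r : R | ∃ s : S, algebraMap R S r = s ^ p ^ e} = ⊤) (k : ℕ)
    (hext : ∀ (𝔐 : Ideal S) [𝔐.IsMaximal] (M : Type (max w v)) [AddCommGroup M] [Module A M]
      [Module R M] [Module S M] [Module (Localization.AtPrime 𝔐) M] [IsScalarTower A R M]
      [IsScalarTower A S M] [IsScalarTower R S M] [IsScalarTower S (Localization.AtPrime 𝔐) M],
      ∀ φ ∈ diffOp A R M k, ∃ ψ ∈ diffOp A S M (p ^ e * k), ∀ r, ψ (algebraMap R S r) = φ r)
    [Module.Finite R (PrincipalParts A R k)]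
    [Module.FinitePresentation S (PrincipalParts A S (p ^ e * k))] :
    ∃ g, g ∘ₗ principalPartsMap p A R S h e hgen k = LinearMap.id := by
  refine exists_retraction_of_localized _ fun 𝔐 _ ↦ ?_
  exact exists_principalPartsMap_extension h e _ (fun φ hφ ↦ hext 𝔐 _ φ hφ) _

end Step

section Kaehler

variable {A C : Type*} [CommRing A] [CommRing C] [Algebra A C]

theorem kaehlerD_mem_diffOp : (KaehlerDifferential.D A C).toLinearMap ∈ diffOp A C Ω[C⁄A] 1 := by
  rw [mem_diffOp_succ]
  intro x
  rw [mem_diffOp_zero]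
  intro y
  ext c
  simp only [bracket_apply, Derivation.coeFn_coe, Derivation.leibniz,
    LinearMap.zero_apply]
  module

variable (A C) in
/-- The projection from principal parts of order one to differentials. -/
noncomputable def principalPartsToKaehler : PrincipalParts A C 1 →ₗ[C] Ω[C⁄A] :=
  PrincipalParts.lift _ kaehlerD_mem_diffOp

/-- For the universal operator d of order one, c ↦ d(c) - c · d(1) is a derivation, and it induces
the section. -/
theorem exists_section_principalPartsToKaehler :
    ∃ s, principalPartsToKaehler A C ∘ₗ s = LinearMap.id := by
  obtain ⟨d, hd0⟩ : ∃ d, d = PrincipalParts.d A C 1 := ⟨_, rfl⟩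
  have hd : ∀ x y, d (x * y) = x • d y + y • d x - (x * y) • d 1 := by
    intro x y
    have := PrincipalParts.d_mem (A := A) (C := C) 1
    rw [← hd0] at this
    rw [mem_diffOp_succ] at this
    have := mem_diffOp_zero.1 (this x) y
    have := LinearMap.congr_fun this 1
    simp only [bracket_apply, mul_one, LinearMap.zero_apply, smul_sub, smul_smul] at this
    rw [mul_comm y x] at this
    linear_combination (exp := 1) this
  let D : Derivation A C (PrincipalParts A C 1) := Derivation.mk'
    (d - (LinearMap.toSpanSingleton C _ (d 1)).restrictScalars A) (by
      intro x y
      simp only [LinearMap.sub_apply, LinearMap.coe_restrictScalars,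
        LinearMap.toSpanSingleton_apply, hd, smul_sub, smul_smul, mul_comm y x]
      abel)
  refine ⟨D.liftKaehlerDifferential, Derivation.liftKaehlerDifferential_unique _ _ ?_⟩
  ext c
  have h1 : D c = d c - c • d 1 := rfl
  change principalPartsToKaehler A C (D.liftKaehlerDifferential (KaehlerDifferential.D A C c)) =
    KaehlerDifferential.D A C c
  rw [Derivation.liftKaehlerDifferential_comp_D, h1, map_sub, map_smul, hd0,
    principalPartsToKaehler, PrincipalParts.lift_d, PrincipalParts.lift_d]
  simp

end Kaehler

section Tower

variable {p : ℕ} [hp : Fact p.Prime] {A C : Type*} [CommRing A] [CommRing C] [Algebra A C]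

theorem HasExponentLE.subalgebra {N : ℕ} (hN : HasExponentLE p A C N) (B : Subalgebra A C) :
    HasExponentLE p A B N := by
  intro x
  obtain ⟨a, ha⟩ := hN x
  exact ⟨a, Subtype.ext ha⟩

theorem frob_zero : frob p A C 0 = ⊤ := by
  refine eq_top_iff.2 fun x _ ↦ Algebra.subset_adjoin ⟨x, ?_⟩
  simp

theorem pow_mem_frob_succ (h : (p : A) = 0) (e : ℕ) {x : C} (hx : x ∈ frob p A C e) :
    x ^ p ∈ frob p A C (e + 1) := by
  have h' : (p : C) = 0 := cast_eq_zero_of_algebra C h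
  have key : ∀ z : C, powHom h' 1 z = z ^ p := fun z ↦ by rw [powHom_apply, pow_one]
  rw [← key]
  induction hx using Algebra.adjoin_induction with
  | mem x hx =>
    obtain ⟨y, rfl⟩ := hx
    rw [key]
    exact Algebra.subset_adjoin ⟨y, by simp only [pow_succ, pow_mul]⟩
  | algebraMap r => rw [key, ← map_pow]; exact Subalgebra.algebraMap_mem _ _
  | add x y _ _ hx hy => rw [map_add]; exact add_mem hx hy
  | mul x y _ _ hx hy => rw [map_mul]; exact mul_mem hx hy

theorem adjoin_frob (e : ℕ) :
    Algebra.adjoin A {r : frob p A C e | ∃ s : C, algebraMap _ C r = s ^ p ^ e} = ⊤ := by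
  refine eq_top_iff.2 ?_
  rintro ⟨x, hx⟩ -
  induction hx using Algebra.adjoin_induction with
  | mem x hx =>
    obtain ⟨y, rfl⟩ := hx
    exact Algebra.subset_adjoin ⟨y, rfl⟩
  | algebraMap r => exact Subalgebra.algebraMap_mem _ r
  | add x y hx hy h1 h2 => exact add_mem h1 h2
  | mul x y hx hy h1 h2 => exact mul_mem h1 h2

variable (p A C) in
/-- The `C^[e+1]`-algebra structure on `C^[e]`. -/
abbrev frobAlgebra (e : ℕ) : Algebra (frob p A C (e + 1)) (frob p A C e) :=
  (Subalgebra.inclusion (frob_succ_le p A C e)).toRingHom.toAlgebra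

/-- The tower from `C^[e]` to `C` is climbed one Galois step at a time, each multiplying the order
by p. This produces the factor p^e that matches the loss under restriction. -/
theorem exists_diffOp_extension_frob {L M : Type*} [CommRing L] [AddCommGroup M]
    [Algebra A L] [Algebra C L] [IsScalarTower A C L] [Module A M] [Module C M] [Module L M]
    [IsScalarTower A C M] [IsScalarTower C L M] (h : (p : A) = 0) {N : ℕ}
    (hN : HasExponentLE p A C N) (𝔐 : Ideal C) [𝔐.IsPrime]
    (hunit : ∀ r ∉ 𝔐, IsUnit (algebraMap C L r)) {e : ℕ} (hstep : ∀ j < e, IsGaloisStep p A C j)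
    {k : ℕ} {φ : frob p A C e →ₗ[A] M}
    (hφ : φ ∈ diffOp A (frob p A C e) M k) :
    ∃ ψ ∈ diffOp A C M (p ^ e * k), ∀ r, ψ (algebraMap (frob p A C e) C r) = φ r := by
  induction e generalizing k with
  | zero =>
    -- Localization at the trivial submonoid serves to transport operators along the bijection of
    -- `C^[0]` with `C`.
    have : IsLocalization (⊥ : Submonoid (frob p A C 0)) C := by
      refine IsLocalization.of_le_isUnit_of_bijective
        (by rintro _ ⟨y, hy, rfl⟩; obtain rfl := Submonoid.mem_bot.1 hy; simp)
        ⟨Subtype.val_injective, fun x ↦ ?_⟩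
      exact ⟨⟨x, by rw [frob_zero]; trivial⟩, rfl⟩
    rw [pow_zero, one_mul]
    exact exists_diffOp_localization (hN.subalgebra _) ⊥ hφ
  | succ e ih =>
    let := frobAlgebra p A C e
    have : IsScalarTower A (frob p A C (e + 1)) (frob p A C e) := .of_algebraMap_eq fun _ ↦ rfl
    have : IsScalarTower (frob p A C (e + 1)) (frob p A C e) L := .of_algebraMap_eq fun _ ↦ rfl
    have : IsScalarTower (frob p A C (e + 1)) (frob p A C e) M := .of_algebraMap_smul fun _ _ ↦ rfl
    have hg : IsGaloisExponentOne p (frob p A C (e + 1)) (frob p A C e) := hstep e e.lt_succ_self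
    obtain ⟨n, x, hx⟩ := hg.locallyPBasis (𝔐.under _)
    obtain ⟨ψ, hψ, he⟩ := exists_diffOp_extension_of_isUnit (L := L) h (hN.subalgebra _)
      (fun s ↦ ⟨⟨_, pow_mem_frob_succ h e s.2⟩, rfl⟩) (𝔐.under (frob p A C (e + 1)))
      (fun r hr ↦ hunit _ hr) hx hφ
    obtain ⟨ψ', hψ', he'⟩ := ih (fun j hj ↦ hstep j (hj.trans e.lt_succ_self)) hψ
    refine ⟨ψ', ?_, fun r ↦ ?_⟩
    · rwa [pow_succ, mul_assoc]
    · rw [← he, ← he']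
      rfl

end Tower

end RingExt

/-! ### Descent, and extensions of exponent one with projective differentials -/

namespace RingExt

section Descent

theorem projective_trans (R S M : Type*) [CommRing R] [CommRing S] [Algebra R S] [AddCommGroup M]
    [Module R M] [Module S M] [IsScalarTower R S M] [Module.Projective R S]
    [Module.Projective S M] : Module.Projective R M := by
  obtain ⟨s, hs⟩ := Module.projective_def'.1 (inferInstance : Module.Projective S M)
  have : Module.Projective R (M →₀ S) := by
    classical
    exact Module.Projective.of_equiv (finsuppLequivDFinsupp (ι := M) (M := S) R).symm
  exact Module.Projective.of_split (s.restrictScalars R)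
    ((Finsupp.linearCombination S id).restrictScalars R) (LinearMap.ext fun m ↦
      LinearMap.congr_fun hs m)

variable {R S : Type*} [CommRing R] [CommRing S] [Algebra R S]

/-- A finite projective extension splits as a module. -/
theorem exists_linearMap_one (hinj : Function.Injective (algebraMap R S)) [Module.Finite R S]
    [Module.Projective R S] : ∃ π : S →ₗ[R] R, π 1 = 1 := by
  -- `I` is the ideal of values of functionals at 1. Were it inside a maximal ideal 𝔪, a dual basis
  -- would give 1 ∈ 𝔪S, contradicting integrality.
  let I : Ideal R := LinearMap.range (LinearMap.applyₗ (R := R) (M₂ := R) (1 : S))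
  have htop : I = ⊤ := by
    by_contra hne
    obtain ⟨𝔪, h𝔪, hle⟩ := Ideal.exists_le_maximal I hne
    obtain ⟨n, f, g, -, -, hfg⟩ := Module.Finite.exists_comp_eq_id_of_projective R S
    refine h𝔪.ne_top ((Ideal.map_eq_top_iff (algebraMap R S) hinj
      (algebraMap_isIntegral_iff.2 inferInstance)).1 ((Ideal.eq_top_iff_one _).2 ?_))
    have h1 : f (g 1) = 1 := LinearMap.congr_fun hfg 1
    rw [← h1, ← Finset.univ_sum_single (g 1), map_sum]
    refine Ideal.sum_mem _ fun i _ ↦ ?_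
    have : (Pi.single i (g 1 i) : Fin n → R) = g 1 i • Pi.single i 1 := by
      rw [← Pi.single_smul, smul_eq_mul, mul_one]
    rw [this, map_smul, Algebra.smul_def]
    exact Ideal.mul_mem_right _ _ (Ideal.mem_map_of_mem _ (hle ⟨LinearMap.proj i ∘ₗ g, rfl⟩))
  obtain ⟨π, hπ⟩ := (Ideal.eq_top_iff_one I).1 htop
  exact ⟨π, hπ⟩

theorem exists_retract_tensorProduct {π : S →ₗ[R] R} (hπ : π 1 = 1) (M : Type*) [AddCommGroup M]
    [Module R M] : ((TensorProduct.lid R M).toLinearMap ∘ₗ π.rTensor M) ∘ₗ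
      TensorProduct.mk R S M 1 = LinearMap.id := by
  ext m
  simp [hπ]

/-- As 1 splits off from `S`, the module `M` is an `R`-summand of `S ⊗ M`. -/
theorem projective_of_projective_tensorProduct (hinj : Function.Injective (algebraMap R S))
    [Module.Finite R S] [Module.Projective R S] (M : Type*) [AddCommGroup M] [Module R M]
    [Module.Projective S (S ⊗[R] M)] : Module.Projective R M := by
  obtain ⟨π, hπ⟩ := exists_linearMap_one hinj
  have := projective_trans R S (S ⊗[R] M)
  exact Module.Projective.of_split _ _ (exists_retract_tensorProduct hπ M)

end Descent

section Frob

variable {p : ℕ} [hp : Fact p.Prime] {A C : Type*} [CommRing A] [CommRing C] [Algebra A C]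

/-- Frobenius is semilinear. This makes `C^[e]` finite over `A` without Noetherian hypotheses. -/
theorem span_pow_of_span (h : (p : A) = 0) {s : Set C} (hs : Submodule.span A s = ⊤) (e : ℕ) :
    Submodule.span A ((fun x ↦ x ^ p ^ e) '' s) =
      Submodule.span A (Set.range fun x : C ↦ x ^ p ^ e) := by
  have h' : (p : C) = 0 := cast_eq_zero_of_algebra C h
  refine le_antisymm (Submodule.span_mono (Set.image_subset_range _ _)) (Submodule.span_le.2 ?_)
  rintro _ ⟨x, rfl⟩
  have hx : x ∈ Submodule.span A s := hs ▸ Submodule.mem_top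
  induction hx using Submodule.span_induction with
  | mem x hx => exact Submodule.subset_span ⟨x, hx, rfl⟩
  | zero => simp [zero_pow (pow_ne_zero e hp.out.ne_zero)]
  | add x y _ _ hx hy =>
    have := map_add (powHom h' e) x y
    simp only [powHom_apply] at this
    simp only [this]
    exact add_mem hx hy
  | smul a x _ hx =>
    simp only [smul_pow]
    exact Submodule.smul_mem _ _ hx

theorem frob_toSubmodule (h : (p : A) = 0) (e : ℕ) : Subalgebra.toSubmodule (frob p A C e) =
    Submodule.span A (Set.range fun x : C ↦ x ^ p ^ e) := by
  have h' : (p : C) = 0 := cast_eq_zero_of_algebra C h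
  have : (Set.range fun x : C ↦ x ^ p ^ e) = MonoidHom.mrange (powHom h' e : C →* C) := by
    ext; simp [powHom_apply]
  rw [frob, Algebra.adjoin_eq_span, this, Submonoid.closure_eq]

instance finite_frob [CharP A p] [Module.Finite A C] (e : ℕ) : Module.Finite A (frob p A C e) := by
  have h := CharP.cast_eq_zero A p
  obtain ⟨s, hs⟩ := (Module.Finite.fg_top : (⊤ : Submodule A C).FG)
  refine Module.Finite.iff_fg.2 (?_ : (Subalgebra.toSubmodule (frob p A C e)).FG)
  rw [frob_toSubmodule h, ← span_pow_of_span h hs]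
  exact Submodule.fg_span (s.finite_toSet.image _)

end Frob

section QuasiBasis

theorem inv_smul_smul_of_algebraMap {S D M : Type*} [CommRing S] [CommRing D] [Algebra S D]
    [AddCommGroup M] [Module S M] [Module D M] [IsScalarTower S D M] {t : S} {u : Dˣ}
    (hu : (u : D) = algebraMap S D t) (z : M) : (u⁻¹ : Dˣ).1 • t • z = z := by
  rw [← algebraMap_smul D t, ← hu, smul_smul, Units.inv_mul, one_smul]

universe u v w in
/-- A projective module spanned by a family has, near every prime, a basis taken from the family. -/
theorem exists_basis_of_span {S ι : Type u} {M : Type v} [CommRing S] [AddCommGroup M] [Module S M]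
    [Module.FinitePresentation S M] [Module.Flat S M] (v : ι → M)
    (hv : Submodule.span S (Set.range v) = ⊤) (𝔐 : Ideal S) [𝔐.IsPrime] :
    ∃ t ∉ 𝔐, ∃ (n : ℕ) (a : Fin n → ι), ∀ (D : Type w) [CommRing D] [Algebra S D],
      IsUnit (algebraMap S D t) → ∃ b : Module.Basis (Fin n) D (D ⊗[S] M),
        ∀ i, b i = 1 ⊗ₜ v (a i) := by
  let L := Localization.AtPrime 𝔐
  let m := LocalizedModule.mkLinearMap 𝔐.primeCompl M
  obtain ⟨κ, a', b', hb'⟩ := Module.exists_basis_of_span_of_flat (R := L) (m ∘ v) (by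
    rw [Set.range_comp]
    exact span_eq_top_of_isLocalizedModule L 𝔐.primeCompl m hv)
  have : Finite κ := Module.Finite.finite_basis b'
  obtain ⟨n, ⟨e⟩⟩ := Finite.exists_equiv_fin κ
  let a := a' ∘ e.symm
  let b := b'.reindex e
  have hb : ∀ i, b i = m (v (a i)) := fun i ↦ by simp [b, hb', a]
  let fF : (Fin n →₀ S) →ₗ[S] (Fin n →₀ L) := Finsupp.mapRange.linearMap (Algebra.linearMap S L)
  let l : (Fin n →₀ S) →ₗ[S] M := Finsupp.linearCombination S (v ∘ a)
  have hl : m ∘ₗ l = (b.repr.symm.toLinearMap.restrictScalars S) ∘ₗ fF := by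
    ext i
    simp [l, fF, hb]
  have hl' : ∀ x, b.repr (m (l x)) = fF x := fun x ↦ by
    rw [← LinearMap.comp_apply, hl]
    simp
  obtain ⟨l', s₀, H⟩ := Module.FinitePresentation.exists_lift_of_isLocalizedModule 𝔐.primeCompl fF
    ((b.repr.toLinearMap.restrictScalars S) ∘ₗ m)
  have H' : ∀ y, fF (l' y) = (s₀ : S) • b.repr (m y) := LinearMap.congr_fun H
  obtain ⟨s₁, h₁⟩ := Module.Finite.exists_smul_of_comp_eq_of_isLocalizedModule 𝔐.primeCompl m
    (l ∘ₗ l') ((s₀ : S) • LinearMap.id) (LinearMap.ext fun y ↦ b.repr.injective (by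
      simp only [LinearMap.comp_apply, hl', H', LinearMap.smul_apply, LinearMap.id_apply, map_smul]
      exact ((b.repr.toLinearMap.restrictScalars S).map_smul _ _).symm))
  obtain ⟨s₂, h₂⟩ := Module.Finite.exists_smul_of_comp_eq_of_isLocalizedModule 𝔐.primeCompl fF
    (l' ∘ₗ l) ((s₀ : S) • LinearMap.id) (LinearMap.ext fun y ↦ by
      simp only [LinearMap.comp_apply, H', hl']
      simp)
  -- `l` becomes an isomorphism on the localization; `s₀` clears the denominators of the inverse,
  -- and `s₁`, `s₂` turn the two local inverse identities into identities over `S`. Only `t` has to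
  -- be inverted.
  let t : S := s₁ * s₂ * s₀
  let g : M →ₗ[S] (Fin n →₀ S) := ((s₁ : S) * s₂) • l'
  have hlg : l ∘ₗ g = t • LinearMap.id := by
    rw [LinearMap.comp_smul, mul_comm, mul_smul]
    exact (congrArg ((s₂ : S) • ·) h₁).trans (by simp only [t, Submonoid.smul_def]; module)
  have hgl : g ∘ₗ l = t • LinearMap.id := by
    rw [LinearMap.smul_comp, mul_smul]
    exact (congrArg ((s₁ : S) • ·) h₂).trans (by simp only [t, Submonoid.smul_def]; module)
  refine ⟨t, (s₁ * s₂ * s₀).2, n, a, fun D _ _ ht ↦ ?_⟩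
  obtain ⟨u, hu⟩ := ht
  have hbij : Function.Bijective (l.baseChange D) := by
    refine Function.bijective_iff_has_inverse.2
      ⟨(u⁻¹ : Dˣ).1 • g.baseChange D, fun z ↦ ?_, fun z ↦ ?_⟩
    · rw [Pi.smul_apply, ← LinearMap.comp_apply, ← LinearMap.baseChange_comp, hgl,
        LinearMap.baseChange_smul, LinearMap.baseChange_id]
      exact inv_smul_smul_of_algebraMap hu z
    · rw [Pi.smul_apply, map_smul, ← LinearMap.comp_apply, ← LinearMap.baseChange_comp, hlg,
        LinearMap.baseChange_smul, LinearMap.baseChange_id]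
      exact inv_smul_smul_of_algebraMap hu z
  refine ⟨(Finsupp.basisSingleOne.baseChange D).map (LinearEquiv.ofBijective _ hbij), fun i ↦ ?_⟩
  simp [l]

end QuasiBasis

section PBasis

variable {p : ℕ} [hp : Fact p.Prime]

/-- Base change of differentials, as a module over the new algebra. -/
theorem exists_kaehler_equiv (R R' S : Type*) [CommRing R] [CommRing R'] [CommRing S]
    [Algebra R R'] [Algebra R S] :
    let := Algebra.TensorProduct.rightAlgebra (R := R) (A := R') (B := S)
    ∃ f : (R' ⊗[R] S) ⊗[S] Ω[S⁄R] ≃ₗ[R' ⊗[R] S] Ω[(R' ⊗[R] S)⁄R'],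
      ∀ s, f (1 ⊗ₜ KaehlerDifferential.D R S s) = KaehlerDifferential.D R' (R' ⊗[R] S) (1 ⊗ₜ s) := by
  intro _
  refine ⟨KaehlerDifferential.tensorKaehlerEquiv R R' S (R' ⊗[R] S), fun s ↦ ?_⟩
  rw [KaehlerDifferential.tensorKaehlerEquiv_tmul_D, one_smul]
  rfl

theorem injective_algebraMap_tensorProduct {R R' S : Type*} [CommRing R] [CommRing R'] [CommRing S]
    [Algebra R R'] [Algebra R S] [Module.Flat R R'] (hinj : Function.Injective (algebraMap R S)) :
    Function.Injective (algebraMap R' (R' ⊗[R] S)) := by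
  have h := Module.Flat.lTensor_preserves_injective_linearMap (M := R') (Algebra.linearMap R S) hinj
  have : ⇑(algebraMap R' (R' ⊗[R] S)) =
      (Algebra.linearMap R S).lTensor R' ∘ (TensorProduct.rid R R').symm := by
    ext r
    simp [Algebra.TensorProduct.algebraMap_apply]
  rw [this]
  exact h.comp (LinearEquiv.injective _)

/-- Inverting the p-th power r in `R` already inverts t, so localizations of `S` may be replaced by
localizations of the base. -/
theorem isUnit_one_tmul_of_pow {R R' S : Type*} [CommRing R] [CommRing R'] [CommRing S]
    [Algebra R R'] [Algebra R S] {t : S} {r : R} (hr : algebraMap R S r = t ^ p)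
    (hunit : IsUnit (algebraMap R R' r)) : IsUnit (1 ⊗ₜ[R] t : R' ⊗[R] S) := by
  refine (isUnit_pow_iff hp.out.ne_zero).1 ?_
  have : (1 ⊗ₜ[R] t : R' ⊗[R] S) ^ p = algebraMap R' (R' ⊗[R] S) (algebraMap R R' r) := by
    rw [Algebra.TensorProduct.tmul_pow, one_pow, ← hr, Algebra.TensorProduct.algebraMap_apply,
      Algebra.algebraMap_self, RingHom.id_apply, Algebra.algebraMap_eq_smul_one r,
      Algebra.algebraMap_eq_smul_one r, TensorProduct.smul_tmul]
  rw [this]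
  exact hunit.map _

universe u v w in
/-- If the differentials are projective there are `p`-bases near every prime. -/
theorem exists_isPBasis_tensorProduct {R : Type u} {S : Type v} [CommRing R] [CommRing S]
    [Algebra R S] (h : (p : R) = 0) (hinj : Function.Injective (algebraMap R S)) [Module.Finite R S]
    (hpow : ∀ s : S, s ^ p ∈ (algebraMap R S).range) [Module.Projective S Ω[S⁄R]]
    (𝔭 : Ideal R) [𝔭.IsPrime] :
    ∃ r ∉ 𝔭, ∃ (n : ℕ) (x : Fin n → S), ∀ (R' : Type w) [CommRing R'] [Algebra R R']
      [Module.Flat R R'], IsUnit (algebraMap R R' r) →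
        IsPBasis p R' (R' ⊗[R] S) (fun i ↦ 1 ⊗ₜ x i) := by
  obtain ⟨𝔐, -, _, hlies⟩ := Ideal.exists_ideal_over_prime_of_isIntegral 𝔭 (⊥ : Ideal S)
    (by
      change RingHom.ker (algebraMap R S) ≤ 𝔭
      rw [(RingHom.injective_iff_ker_eq_bot _).1 hinj]
      exact bot_le)
  have : Module.FinitePresentation S Ω[S⁄R] := Module.finitePresentation_of_projective _ _
  obtain ⟨t, ht, n, x, hx⟩ := exists_basis_of_span.{v, v, max w v} (KaehlerDifferential.D R S)
    (KaehlerDifferential.span_range_derivation R S) 𝔐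
  -- The basic open set of `S` where Ω is free is traded for one of `R` by taking r = t^p, which
  -- avoids 𝔭 because 𝔐 lies over 𝔭.
  obtain ⟨r, hr⟩ := hpow t
  refine ⟨r, fun hmem ↦ ?_, n, x, fun R' _ _ _ hunit ↦ ?_⟩
  · rw [← hlies, Ideal.mem_comap, hr] at hmem
    exact ht (‹𝔐.IsPrime›.mem_of_pow_mem _ hmem)
  · let := Algebra.TensorProduct.rightAlgebra (R := R) (A := R') (B := S)
    obtain ⟨f, hf⟩ := exists_kaehler_equiv R R' S
    obtain ⟨b, hb⟩ := hx (R' ⊗[R] S) (isUnit_one_tmul_of_pow hr hunit)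
    exact isPBasis_of_basis (cast_eq_zero_of_algebra R' h)
      (injective_algebraMap_tensorProduct hinj) (pow_mem_range_of_localization h hpow R') _
      (b.map f) (fun i ↦ by rw [Module.Basis.map_apply, hb, hf])

-- The p-bases exist on basic open sets and not merely in stalks. Hence finite presentation and
-- flatness of `S` over `R` both follow from local freeness.
universe u v in
theorem projective_of_projective_kaehler {R : Type u} {S : Type v} [CommRing R] [CommRing S]
    [Algebra R S] (h : (p : R) = 0) (hinj : Function.Injective (algebraMap R S)) [Module.Finite R S]
    (hpow : ∀ s : S, s ^ p ∈ (algebraMap R S).range) [Module.Projective S Ω[S⁄R]] :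
    Module.Projective R S := by
  have key : ∀ (𝔭 : Ideal R) [𝔭.IsPrime], ∃ r ∉ 𝔭,
      Module.Free (Localization.Away r) (Localization.Away r ⊗[R] S) := by
    intro 𝔭 _
    obtain ⟨r, hr, n, x, hx⟩ := exists_isPBasis_tensorProduct.{u, v, u} h hinj hpow 𝔭
    have := IsLocalization.flat (Localization.Away r) (.powers r)
    have hx' := hx (Localization.Away r) (IsLocalization.Away.algebraMap_isUnit r)
    exact ⟨r, hr, .of_basis (hx'.basis (pow_mem_range_of_localization h hpow _))⟩
  let s : Set R := {r | Module.Free (Localization.Away r) (Localization.Away r ⊗[R] S)}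
  have hs : Ideal.span s = ⊤ := by
    by_contra hne
    obtain ⟨𝔪, h𝔪, hle⟩ := Ideal.exists_le_maximal _ hne
    obtain ⟨r, hr, hfree⟩ := key 𝔪
    exact hr (hle (Ideal.subset_span hfree))
  have hfp : Module.FinitePresentation R S :=
    Module.FinitePresentation.of_localizationSpan' (M := S) s hs
      (Rₚ := fun g ↦ Localization.Away g.1) (Mₚ := fun g ↦ Localization.Away g.1 ⊗[R] S)
      (fun g ↦ TensorProduct.mk R _ S 1) fun g ↦ by
        have : Module.Free (Localization.Away g.1) (Localization.Away g.1 ⊗[R] S) := g.2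
        exact Module.finitePresentation_of_projective _ _
  have : Module.Flat R S := Module.flat_of_isLocalized_span R S s hs
    (fun g ↦ Localization.Away g.1 ⊗[R] S) (fun g ↦ TensorProduct.mk R _ S 1) fun g ↦ by
      have : Module.Free (Localization.Away g.1) (Localization.Away g.1 ⊗[R] S) := g.2
      have := IsLocalization.flat (Localization.Away g.1) (.powers g.1)
      exact Module.Flat.trans R (Localization.Away g.1) _
  exact Module.Flat.projective_of_finitePresentation

/-- Extensions of exponent one with projective differentials are Galois. -/
theorem isGaloisExponentOne_of_projective_kaehler {R S : Type*} [CommRing R] [CommRing S]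
    [Algebra R S] (h : (p : R) = 0) (hinj : Function.Injective (algebraMap R S)) [Module.Finite R S]
    (hpow : ∀ s : S, s ^ p ∈ (algebraMap R S).range)
    (hne : ¬ Function.Surjective (algebraMap R S)) [Module.Projective S Ω[S⁄R]] :
    IsGaloisExponentOne p R S where
  injective := hinj
  finite := inferInstance
  finiteExponent := ⟨1, hasExponentLE_one hpow⟩
  exponent_eq_one := by
    refine le_antisymm (Nat.sInf_le (hasExponentLE_one hpow)) (Nat.one_le_iff_ne_zero.2 fun h0 ↦ ?_)
    have : HasExponentLE p R S 0 := by
      have := Nat.sInf_mem (s := {e | HasExponentLE p R S e}) ⟨1, hasExponentLE_one hpow⟩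
      rwa [← exponent, h0] at this
    exact hne fun x ↦ by simpa using this x
  projective := projective_of_projective_kaehler h hinj hpow
  locallyPBasis 𝔭 _ := by
    obtain ⟨r, hr, n, x, hx⟩ := exists_isPBasis_tensorProduct h hinj hpow 𝔭
    have := IsLocalization.flat (Localization.AtPrime 𝔭) 𝔭.primeCompl
    exact ⟨n, _, hx (Localization.AtPrime 𝔭) (IsLocalization.map_units _ (⟨r, hr⟩ : 𝔭.primeCompl))⟩

/-- The differentials of a Galois extension of exponent one are projective. -/
theorem IsGaloisExponentOne.projective_kaehler {R S : Type*} [CommRing R] [CommRing S]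
    [Algebra R S] (h : (p : R) = 0) (hpow : ∀ s : S, s ^ p ∈ (algebraMap R S).range)
    (hg : IsGaloisExponentOne p R S) : Module.Projective S Ω[S⁄R] := by
  have := hg.finite
  have := hg.projective
  have : Module.FinitePresentation R S := Module.finitePresentation_of_projective _ _
  have : Algebra.FinitePresentation R S := inferInstance
  have : Module.FinitePresentation S Ω[S⁄R] := inferInstance
  have : Module.Flat S Ω[S⁄R] := by
    refine flat_of_forall_maximal fun 𝔐 _ ↦ ?_
    let 𝔭 := 𝔐.under R
    let R' := Localization.AtPrime 𝔭
    let D := R' ⊗[R] S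
    let L := Localization.AtPrime 𝔐
    let l : R' →ₐ[R] L := IsLocalization.liftAlgHom (M := 𝔭.primeCompl) (f := Algebra.ofId R L)
      (fun r ↦ by
        rw [Algebra.ofId_apply, IsScalarTower.algebraMap_apply R S L]
        exact IsLocalization.map_units L (⟨algebraMap R S r, r.2⟩ : 𝔐.primeCompl))
    let f : D →ₐ[R] L := Algebra.TensorProduct.lift l
      (IsScalarTower.toAlgHom R S L) (fun _ _ ↦ Commute.all _ _)
    let := Algebra.TensorProduct.rightAlgebra (R := R) (A := R') (B := S)
    have hf : ∀ s, f (algebraMap S D s) = algebraMap S L s := by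
      intro s
      refine (Algebra.TensorProduct.lift_tmul _ _ _ 1 s).trans ?_
      rw [map_one, one_mul]
      rfl
    obtain ⟨n, x, hx⟩ := hg.locallyPBasis 𝔭
    obtain ⟨b, -⟩ := IsPBasis.exists_basis_kaehler (cast_eq_zero_of_algebra R' h)
      (pow_mem_range_of_localization h hpow R') hx
    obtain ⟨g, -⟩ := exists_kaehler_equiv R R' S
    -- The map from `D` to the local ring at 𝔐 extends that of `S`, so the maximal ideal pulls back
    -- to a prime of `D` over 𝔐; over `D` the differentials are free by the p-basis.
    refine ⟨D, inferInstance, inferInstance, (IsLocalRing.maximalIdeal L).comap f,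
      inferInstance, ?_, ?_, ?_⟩
    · ext s
      change f (algebraMap S D s) ∈ IsLocalRing.maximalIdeal L ↔ _
      rw [hf]
      exact IsLocalization.AtPrime.to_map_mem_maximal_iff L 𝔐 s
    · have : Algebra.IsPushout R S R' D := Algebra.IsPushout.symm inferInstance
      exact Module.Flat.isBaseChange R S R' D this.out
    · have : Module.Free D Ω[D⁄R'] := .of_basis b
      exact Module.Flat.of_linearEquiv g
  exact Module.Flat.projective_of_finitePresentation

end PBasis

end RingExt

/-! ### From projective principal parts to projective differentials -/

namespace RingExt

set_option linter.unusedSectionVars false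

section Kaehler

variable {p : ℕ} [hp : Fact p.Prime]

/-- `R` is generated over `A` by elements that become p-th powers in `S`, so their differentials
vanish there. In the exact sequence for A → R → S the term coming from Ω of `R` contributes nothing.
-/
theorem exists_kaehler_equiv_of_adjoin_pow {A R S : Type*} [CommRing A] [CommRing R] [CommRing S]
    [Algebra A R] [Algebra A S] [Algebra R S] [IsScalarTower A R S] (h : (p : A) = 0)
    (hgen : Algebra.adjoin A {r : R | ∃ s : S, algebraMap R S r = s ^ p} = ⊤) :
    ∃ f : Ω[S⁄A] ≃ₗ[S] Ω[S⁄R],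
      ∀ s, f (KaehlerDifferential.D A S s) = KaehlerDifferential.D R S s := by
  have hd : ∀ r : R, KaehlerDifferential.D A S (algebraMap R S r) = 0 := by
    intro r
    have hr : r ∈ Algebra.adjoin A {r : R | ∃ s : S, algebraMap R S r = s ^ p} :=
      hgen ▸ Algebra.mem_top
    induction hr using Algebra.adjoin_induction with
    | mem r hr =>
      obtain ⟨s, hs⟩ := hr
      rw [hs, Derivation.leibniz_pow, ← Nat.cast_smul_eq_nsmul S,
        cast_eq_zero_of_algebra S h, zero_smul]
    | algebraMap a => rw [← IsScalarTower.algebraMap_apply, Derivation.map_algebraMap]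
    | add x y _ _ hx hy => rw [map_add, map_add, hx, hy, add_zero]
    | mul x y _ _ hx hy => rw [map_mul, Derivation.leibniz, hx, hy, smul_zero, smul_zero, add_zero]
  refine ⟨LinearEquiv.ofBijective (KaehlerDifferential.map A R S S)
    ⟨?_, KaehlerDifferential.map_surjective A R S⟩, KaehlerDifferential.map_D A R S S⟩
  refine (injective_iff_map_eq_zero _).2 fun z hz ↦ ?_
  obtain ⟨y, rfl⟩ := (KaehlerDifferential.exact_mapBaseChange_map A R S z).1 hz
  have hmap : KaehlerDifferential.map A A R S = 0 := by
    refine Derivation.liftKaehlerDifferential_unique _ _ (Derivation.ext fun r ↦ ?_)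
    exact (KaehlerDifferential.map_D A A R S r).trans (hd r)
  clear hz
  induction y with
  | zero => rw [map_zero]
  | add a b ha hb => rw [map_add, ha, hb, add_zero]
  | tmul s w => rw [KaehlerDifferential.mapBaseChange_tmul, hmap, LinearMap.zero_apply, smul_zero]

-- The section of P^1 → Ω, base changed to `S` and followed by the comparison map, embeds the
-- differentials; its retraction runs back through P^1.
universe v w in
theorem exists_retract_kaehler {A : Type*} [CommRing A]
    {R : Type v} {S : Type w} [CommRing R] [CommRing S]
    [Algebra A R] [Algebra A S] [Algebra R S] [IsScalarTower A R S] (h : (p : A) = 0) (e : ℕ)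
    (hgen : Algebra.adjoin A {r : R | ∃ s : S, algebraMap R S r = s ^ p ^ e} = ⊤)
    (hext : ∀ (𝔐 : Ideal S) [𝔐.IsMaximal] (M : Type (max w v)) [AddCommGroup M] [Module A M]
      [Module R M] [Module S M] [Module (Localization.AtPrime 𝔐) M] [IsScalarTower A R M]
      [IsScalarTower A S M] [IsScalarTower R S M] [IsScalarTower S (Localization.AtPrime 𝔐) M],
      ∀ φ ∈ diffOp A R M 1, ∃ ψ ∈ diffOp A S M (p ^ e * 1), ∀ r, ψ (algebraMap R S r) = φ r)
    [Module.Finite A R] [Module.FinitePresentation S (PrincipalParts A S (p ^ e))] :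
    ∃ (i : S ⊗[R] Ω[R⁄A] →ₗ[S] PrincipalParts A S (p ^ e))
      (g : PrincipalParts A S (p ^ e) →ₗ[S] S ⊗[R] Ω[R⁄A]), g ∘ₗ i = LinearMap.id := by
  have : Module.Finite R (PrincipalParts A R 1) :=
    Module.Finite.of_surjective _ (PrincipalParts.mk_surjective 1)
  have : Module.FinitePresentation S (PrincipalParts A S (p ^ e * 1)) := by
    rwa [mul_one]
  obtain ⟨g, hg⟩ := exists_retraction_principalPartsMap h e hgen 1 hext
  obtain ⟨s, hs⟩ := exists_section_principalPartsToKaehler (A := A) (C := R)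
  rw [← mul_one (p ^ e)]
  refine ⟨principalPartsMap p A R S h e hgen 1 ∘ₗ s.baseChange S,
    (principalPartsToKaehler A R).baseChange S ∘ₗ g, ?_⟩
  rw [LinearMap.comp_assoc, ← LinearMap.comp_assoc _ _ g, hg, LinearMap.id_comp,
    ← LinearMap.baseChange_comp, hs, LinearMap.baseChange_id]

end Kaehler

section Tower

variable {p : ℕ} [hp : Fact p.Prime] {A C : Type*} [CommRing A] [CommRing C] [Algebra A C]

theorem hasExponentLE_of_frob_le_bot {e : ℕ} (he : frob p A C e ≤ ⊥) : HasExponentLE p A C e :=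
  fun x ↦ Algebra.mem_bot.1 (he (Algebra.subset_adjoin ⟨x, rfl⟩))

theorem frob_eq_bot {e : ℕ} (he : HasExponentLE p A C e) : frob p A C e = ⊥ := by
  refine eq_bot_iff.2 (Algebra.adjoin_le ?_)
  rintro _ ⟨x, rfl⟩
  exact Algebra.mem_bot.2 (he x)

theorem frob_antitone : Antitone (frob p A C) := antitone_nat_of_succ_le (frob_succ_le p A C)

theorem hasExponentLE_exponent (hexp : HasFiniteExponent p A C) :
    HasExponentLE p A C (exponent p A C) := Nat.sInf_mem hexp

/-- If two consecutive terms agree, taking p-th powers repeatedly shows that the chain is constant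
from there on, so it has already reached `A` and the exponent is at most `e`. -/
theorem frob_succ_lt (h : (p : A) = 0) (hexp : HasFiniteExponent p A C) {e : ℕ}
    (he : e < exponent p A C) : ¬ frob p A C e ≤ frob p A C (e + 1) := by
  intro hle
  have key : ∀ j, frob p A C e ≤ frob p A C (e + j) := by
    intro j
    induction j with
    | zero => exact le_rfl
    | succ j ih =>
      refine hle.trans (Algebra.adjoin_le ?_)
      rintro _ ⟨x, rfl⟩
      have := pow_mem_frob_succ h _ (ih (Algebra.subset_adjoin ⟨x, rfl⟩))
      simp only at this
      rwa [← pow_mul, ← pow_succ] at this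
  have h1 := key (exponent p A C)
  have h2 := frob_eq_bot (hasExponentLE_exponent hexp)
  have h3 : frob p A C e ≤ ⊥ := h2 ▸ h1.trans (frob_antitone (Nat.le_add_left _ _))
  exact (Nat.sInf_le (hasExponentLE_of_frob_le_bot h3)).not_gt he

theorem adjoin_pow_frob_succ (e : ℕ) :
    let := frobAlgebra p A C e
    Algebra.adjoin A {r : frob p A C (e + 1) | ∃ s : frob p A C e,
      algebraMap _ (frob p A C e) r = s ^ p} = ⊤ := by
  intro _
  refine eq_top_iff.2 ?_
  rintro ⟨x, hx⟩ -
  induction hx using Algebra.adjoin_induction with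
  | mem x hx =>
    obtain ⟨y, rfl⟩ := hx
    exact Algebra.subset_adjoin ⟨⟨_, Algebra.subset_adjoin ⟨y, rfl⟩⟩, Subtype.ext (by
      change y ^ p ^ (e + 1) = (y ^ p ^ e) ^ p
      rw [pow_succ, pow_mul])⟩
  | algebraMap r => exact Subalgebra.algebraMap_mem _ r
  | add x y hx hy h1 h2 => exact add_mem h1 h2
  | mul x y hx hy h1 h2 => exact mul_mem h1 h2

theorem isScalarTower_frob_succ (e : ℕ) :
    let := frobAlgebra p A C e
    IsScalarTower A (frob p A C (e + 1)) (frob p A C e) := by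
  intro _
  exact .of_algebraMap_eq fun _ ↦ rfl

theorem finite_frob_succ [CharP A p] [Module.Finite A C] (e : ℕ) :
    let := frobAlgebra p A C e
    Module.Finite (frob p A C (e + 1)) (frob p A C e) := by
  intro _
  have := isScalarTower_frob_succ (p := p) (A := A) (C := C) e
  exact Module.Finite.of_restrictScalars_finite A _ _

theorem IsGaloisStep.projective_kaehler (h : (p : A) = 0) {e : ℕ} (hg : IsGaloisStep p A C e) :
    Module.Projective (frob p A C e) Ω[frob p A C e⁄A] := by
  let := frobAlgebra p A C e
  have := isScalarTower_frob_succ (p := p) (A := A) (C := C) e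
  have hg : IsGaloisExponentOne p (frob p A C (e + 1)) (frob p A C e) := hg
  have := hg.projective_kaehler (cast_eq_zero_of_algebra _ h)
    (fun s ↦ ⟨⟨_, pow_mem_frob_succ h e s.2⟩, rfl⟩)
  obtain ⟨f, -⟩ := exists_kaehler_equiv_of_adjoin_pow h (adjoin_pow_frob_succ (C := C) e)
  exact Module.Projective.of_equiv f.symm

theorem isGaloisStep_of_projective_kaehler [CharP A p] [Module.Finite A C]
    (hexp : HasFiniteExponent p A C) {e : ℕ} (he : e < exponent p A C)
    [Module.Projective (frob p A C e) Ω[frob p A C e⁄A]] : IsGaloisStep p A C e := by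
  have h := CharP.cast_eq_zero A p
  let := frobAlgebra p A C e
  have := isScalarTower_frob_succ (p := p) (A := A) (C := C) e
  have := finite_frob_succ (p := p) (A := A) (C := C) e
  obtain ⟨f, -⟩ := exists_kaehler_equiv_of_adjoin_pow h (adjoin_pow_frob_succ (C := C) e)
  have := Module.Projective.of_equiv f
  refine isGaloisExponentOne_of_projective_kaehler (R := frob p A C (e + 1)) (S := frob p A C e)
    (cast_eq_zero_of_algebra _ h)
    (Subalgebra.inclusion_injective (frob_succ_le p A C e))
    (fun s ↦ ⟨⟨_, pow_mem_frob_succ h e s.2⟩, rfl⟩) (fun hs ↦ frob_succ_lt h hexp he ?_)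
  intro x hx
  obtain ⟨y, hy⟩ := hs ⟨x, hx⟩
  have : (y : C) = x := congrArg Subtype.val hy
  exact this ▸ y.2

theorem projective_frob {e : ℕ} (hstep : ∀ j < e, IsGaloisStep p A C j) :
    Module.Projective (frob p A C e) C := by
  induction e with
  | zero =>
    refine Module.Projective.of_equiv (LinearEquiv.ofBijective
      (Algebra.linearMap (frob p A C 0) C) ⟨Subtype.val_injective, fun x ↦ ?_⟩)
    exact ⟨⟨x, by rw [frob_zero]; trivial⟩, rfl⟩
  | succ e ih =>
    let := frobAlgebra p A C e
    have hg : IsGaloisExponentOne p (frob p A C (e + 1)) (frob p A C e) := hstep e e.lt_succ_self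
    have := hg.projective
    have := ih fun j hj ↦ hstep j (hj.trans e.lt_succ_self)
    have : IsScalarTower (frob p A C (e + 1)) (frob p A C e) C := .of_algebraMap_eq fun _ ↦ rfl
    exact projective_trans _ (frob p A C e) C

theorem exists_retract_kaehler_frob [CharP A p] [Module.Finite A C]
    (hexp : HasFiniteExponent p A C) {e : ℕ} (hstep : ∀ j < e, IsGaloisStep p A C j)
    [Module.FinitePresentation C (PrincipalParts A C (p ^ e))] :
    ∃ (i : C ⊗[frob p A C e] Ω[frob p A C e⁄A] →ₗ[C] PrincipalParts A C (p ^ e))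
      (g : PrincipalParts A C (p ^ e) →ₗ[C] C ⊗[frob p A C e] Ω[frob p A C e⁄A]),
      g ∘ₗ i = LinearMap.id := by
  obtain ⟨N, hN⟩ := hexp
  have h := CharP.cast_eq_zero A p
  refine exists_retract_kaehler h e (adjoin_frob e) fun 𝔐 _ M _ _ inst _ _ _ _ _ _ φ hφ ↦ ?_
  -- The scalar tower forces the given `C^[e]`-module structure to be the one induced through `C`.
  obtain rfl : inst = Subalgebra.moduleLeft _ :=
    Module.ext (by ext r m; exact (algebraMap_smul C r m).symm)
  exact exists_diffOp_extension_frob (L := Localization.AtPrime 𝔐) h hN 𝔐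
      (fun r hr ↦ IsLocalization.map_units _ (⟨r, hr⟩ : 𝔐.primeCompl)) hstep hφ

/-- By strong induction the steps below `e` are Galois, which is what the retraction onto the
base-changed differentials requires; projectivity then descends from `C` to `C^[e]`. -/
theorem projective_kaehler_frob_of_principalParts [CharP A p] [Module.Finite A C]
    (hexp : HasFiniteExponent p A C)
    (H : ∀ e < exponent p A C, Module.Projective C (PrincipalParts A C (p ^ e))) :
    ∀ e < exponent p A C, Module.Projective (frob p A C e) Ω[frob p A C e⁄A] := by
  intro e
  induction e using Nat.strong_induction_on with
  | _ e ih =>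
    intro he
    have hstep : ∀ j < e, IsGaloisStep p A C j := fun j hj ↦ by
      have := ih j hj (hj.trans he)
      exact isGaloisStep_of_projective_kaehler hexp (hj.trans he)
    have := H e he
    have : Module.Finite C (PrincipalParts A C (p ^ e)) :=
      Module.Finite.of_surjective _ (PrincipalParts.mk_surjective (p ^ e))
    have : Module.FinitePresentation C (PrincipalParts A C (p ^ e)) :=
      Module.finitePresentation_of_projective _ _
    obtain ⟨i, g, hgi⟩ := exists_retract_kaehler_frob hexp hstep
    have := projective_frob hstep
    have : Module.Finite (frob p A C e) C := Module.Finite.of_restrictScalars_finite A _ _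
    have := Module.Projective.of_split i g hgi
    exact projective_of_projective_tensorProduct (S := C) Subtype.val_injective _

end Tower

end RingExt

/-! ### Modules without functionals, and the local rank argument -/

namespace RingExt

section Annihilator

/-- A finitely presented module without functionals has a non-nilpotent annihilator. -/
theorem exists_not_isNilpotent_smul_eq_zero {S K : Type*} [CommRing S] [Nontrivial S]
    [AddCommGroup K] [Module S K] [Module.FinitePresentation S K]
    (hK : ∀ f : K →ₗ[S] S, f = 0) : ∃ t : S, ¬ IsNilpotent t ∧ ∀ y : K, t • y = 0 := by
  obtain ⟨n, V', e, V, hV⟩ := Module.FinitePresentation.exists_fin S K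
  let f : (Fin n → S) →ₗ[S] K := e.symm.toLinearMap ∘ₗ V'.mkQ
  have hf : Function.Surjective f := e.symm.surjective.comp V'.mkQ_surjective
  replace hV : Submodule.span S V = LinearMap.ker f := by
    rw [hV, LinearEquiv.ker_comp, Submodule.ker_mkQ]
  let X : Set S := ⋃ v ∈ V, Set.range v
  have hX : X.Finite := V.finite_toSet.biUnion fun v _ ↦ Set.finite_range v
  -- The entries of a finite presentation generate a Noetherian subring over which `K` is already
  -- defined.
  let S₀ : Subalgebra ℤ S := Algebra.adjoin ℤ X
  have : IsNoetherianRing S₀ := isNoetherianRing_of_fg (Subalgebra.fg_def.2 ⟨X, hX, rfl⟩)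
  let ι : (Fin n → S₀) →ₗ[S₀] (Fin n → S) := (Algebra.linearMap S₀ S).compLeft (Fin n)
  let V₀ : Submodule S₀ (Fin n → S₀) := Submodule.span S₀ {w | ι w ∈ V}
  have hlift : ∀ v ∈ V, ∃ w, ι w = v := by
    intro v hv
    refine ⟨fun i ↦ ⟨v i, Algebra.subset_adjoin ?_⟩, rfl⟩
    exact Set.mem_biUnion hv ⟨i, rfl⟩
  have hV₀ : ∀ w ∈ V₀, f (ι w) = 0 := by
    intro w hw
    induction hw using Submodule.span_induction with
    | mem w hw =>
      rw [← LinearMap.mem_ker, ← hV]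
      exact Submodule.subset_span hw
    | zero => simp
    | add _ _ _ _ h1 h2 => rw [map_add, map_add, h1, h2, add_zero]
    | smul a w _ h =>
      have : ι (a • w) = (a : S) • ι w := rfl
      rw [this, map_smul, h, smul_zero]
  -- The model over `S₀` has zero dual too: a functional on it extends linearly to one on `K`, which
  -- vanishes, and `S₀` sits inside `S`.
  have hsub : Subsingleton (((Fin n → S₀) ⧸ V₀) →ₗ[S₀] S₀) := by
    refine subsingleton_of_forall_eq 0 fun φ ↦ ?_
    let ψ : (Fin n → S₀) →ₗ[S₀] S₀ := φ ∘ₗ V₀.mkQ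
    let ψ' : (Fin n → S) →ₗ[S] S := (Pi.basisFun S (Fin n)).constr S fun i ↦
      (ψ (Pi.single i 1) : S)
    have hψ : ∀ w, ψ' (ι w) = ψ w := by
      intro w
      rw [Module.Basis.constr_apply_fintype]
      conv_rhs => rw [← Finset.univ_sum_single w, map_sum]
      push_cast
      refine Finset.sum_congr rfl fun i _ ↦ ?_
      have : (Pi.single i (w i) : Fin n → S₀) = w i • Pi.single i 1 := by
        rw [← Pi.single_smul, smul_eq_mul, mul_one]
      rw [this, map_smul]
      rfl
    have hker : LinearMap.ker f ≤ LinearMap.ker ψ' := by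
      rw [← hV, Submodule.span_le]
      intro v hv
      obtain ⟨w, rfl⟩ := hlift v hv
      have : ψ w = 0 := by
        have : V₀.mkQ w = 0 := (Submodule.Quotient.mk_eq_zero _).2 (Submodule.subset_span hv)
        rw [LinearMap.comp_apply, this, map_zero]
      change ψ' (ι w) = 0
      rw [hψ, this, ZeroMemClass.coe_zero]
    let g : K →ₗ[S] S := (LinearMap.ker f).liftQ ψ' hker ∘ₗ
      (f.quotKerEquivOfSurjective hf).symm.toLinearMap
    have hg : ∀ z, g (f z) = ψ' z := by
      intro z
      have : (f.quotKerEquivOfSurjective hf).symm (f z) = (LinearMap.ker f).mkQ z := by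
        rw [LinearEquiv.symm_apply_eq]
        rfl
      simp only [g, LinearMap.comp_apply, LinearEquiv.coe_coe, this]
      rfl
    refine Submodule.linearMap_qext _ (LinearMap.ext fun w ↦ Subtype.ext ?_)
    change (ψ w : S) = 0
    rw [← hψ, ← hg, hK g, LinearMap.zero_apply]
  -- Over a Noetherian ring a finite module with zero dual is killed by a regular element; regular
  -- elements of a nonzero ring are not nilpotent, and this persists from `S₀` to `S`.
  obtain ⟨t, ht, hreg⟩ := IsSMulRegular.subsingleton_linearMap_iff.1 hsub
  refine ⟨t, fun hnil ↦ ?_, fun y ↦ ?_⟩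
  · obtain ⟨m, hm⟩ := hnil
    have := hreg.pow m
    have h0 : t ^ m = 0 := Subtype.ext (by simpa using hm)
    rw [h0] at this
    exact one_ne_zero (this (by simp : (0 : S₀) • (1 : S₀) = (0 : S₀) • 0))
  · obtain ⟨z, rfl⟩ := hf y
    have hz : z = ∑ i, z i • ι (Pi.single i 1) := by
      ext j
      simp [ι, Finset.sum_apply, Pi.single_apply, apply_ite]
    have hi : ∀ i, (t : S) • f (ι (Pi.single i 1)) = 0 := by
      intro i
      rw [← map_smul]
      refine hV₀ (t • Pi.single i 1) ?_
      rw [← Submodule.Quotient.mk_eq_zero, Submodule.Quotient.mk_smul]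
      exact Module.mem_annihilator.1 ht _
    rw [hz, map_sum, Finset.smul_sum]
    refine Finset.sum_eq_zero fun i _ ↦ ?_
    rw [map_smul, smul_comm, hi, smul_zero]

end Annihilator

section LocalCase

variable {p : ℕ} [hp : Fact p.Prime]

/-- The ideal 𝔪S is stable under `R`-derivations, so dual derivations force the coefficients of a
relation modulo 𝔪 into 𝔪S; by integrality 𝔪S contains no unit coming from `R`. -/
theorem linearIndependent_residue_monomials {R S : Type*} [CommRing R] [CommRing S] [Algebra R S]
    [IsLocalRing R] (h : (p : R) = 0) (hinj : Function.Injective (algebraMap R S))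
    [Module.Finite R S] {n : ℕ} (x : Fin n → S) (D : Fin n → Derivation R S S)
    (hD : ∀ i j, D i (x j) = if i = j then 1 else 0) :
    LinearIndependent (IsLocalRing.ResidueField R) (fun α : Fin n → Fin p ↦
      (1 ⊗ₜ[R] ∏ i, x i ^ (α i : ℕ) : IsLocalRing.ResidueField R ⊗[R] S)) := by
  rw [Fintype.linearIndependent_iff]
  intro c hc α
  choose r hr using fun α ↦ IsLocalRing.residue_surjective (c α)
  let 𝔪 := IsLocalRing.maximalIdeal R
  have hmem : ∑ α, r α • ∏ i, x i ^ (α i : ℕ) ∈ 𝔪.map (algebraMap R S) := by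
    have h1 : (1 ⊗ₜ[R] ∑ α, r α • ∏ i, x i ^ (α i : ℕ) : (R ⧸ 𝔪) ⊗[R] S) = 0 := by
      change (1 ⊗ₜ[R] _ : IsLocalRing.ResidueField R ⊗[R] S) = 0
      rw [← hc, TensorProduct.tmul_sum]
      refine Finset.sum_congr rfl fun α _ ↦ ?_
      rw [← hr α, TensorProduct.tmul_smul, TensorProduct.smul_tmul', TensorProduct.smul_tmul',
        smul_eq_mul, mul_one, ← IsLocalRing.ResidueField.algebraMap_eq,
        Algebra.algebraMap_eq_smul_one]
    have h2 := (LinearEquiv.map_eq_zero_iff (TensorProduct.quotTensorEquivQuotSMul S 𝔪)).2 h1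
    have h3 := (Submodule.Quotient.mk_eq_zero _).1
      ((TensorProduct.quotTensorEquivQuotSMul_mk_tmul 𝔪 1 _).symm.trans h2)
    rwa [one_smul, Ideal.smul_top_eq_map] at h3
  have h2 : algebraMap R S (r α) ∈ 𝔪.map (algebraMap R S) :=
    mem_of_sum_monomials_mem h x D hD _ (fun i s hs ↦ by
      have hs' : s ∈ (𝔪.map (algebraMap R S)).restrictScalars R := hs
      rw [← Ideal.smul_top_eq_map] at hs'
      refine Submodule.smul_induction_on hs' (fun a ha y _ ↦ ?_) fun a b ha hb ↦ ?_
      · rw [Derivation.map_smul, Algebra.smul_def]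
        exact Ideal.mul_mem_right _ _ (Ideal.mem_map_of_mem _ ha)
      · rw [map_add]
        exact add_mem ha hb) r hmem α
  rw [← hr α, IsLocalRing.residue_eq_zero_iff]
  by_contra hne
  refine (IsLocalRing.maximalIdeal.isMaximal R).ne_top ((Ideal.map_eq_top_iff (algebraMap R S) hinj
      (algebraMap_isIntegral_iff.2 inferInstance)).1 ?_)
  exact Ideal.eq_top_of_isUnit_mem _ h2 ((IsLocalRing.notMem_maximalIdeal.1 hne).map _)

-- The rank of `S` is found to be p^n, n the rank of `L`, on an open set where `K` disappears.
-- Freeness carries this number to the closed point, where it forces the n variables chosen for `L`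
-- to generate `S`, leaving no room for `K`.
universe u v in
theorem subsingleton_of_kaehler_equiv_prod {R : Type u} {S : Type v} [CommRing R] [CommRing S]
    [Algebra R S]
    [IsLocalRing R] (h : (p : R) = 0) (hinj : Function.Injective (algebraMap R S))
    [Module.Finite R S] [Module.Free R S] (hpow : ∀ s : S, s ^ p ∈ (algebraMap R S).range)
    {L K : Type*} [AddCommGroup L] [AddCommGroup K] [Module S L] [Module S K]
    [Module.Projective S L] [Module.FinitePresentation S K] (e : Ω[S⁄R] ≃ₗ[S] L × K)
    (hK : ∀ f : K →ₗ[S] S, f = 0) : Subsingleton K := by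
  have : IsLocalRing S := isLocalRing_of_hasExponentLE h (hasExponentLE_one hpow) hinj
  let d := KaehlerDifferential.D R S
  let q : Ω[S⁄R] →ₗ[S] L := LinearMap.fst S L K ∘ₗ e.toLinearMap
  have hq : Function.Surjective q := Prod.fst_surjective.comp e.surjective
  have : Module.Finite S L := Module.Finite.of_surjective q hq
  have : Module.FinitePresentation S L := Module.finitePresentation_of_projective _ _
  obtain ⟨κ, a', b', hb'⟩ := Module.exists_basis_of_span_of_flat (R := S) (fun s ↦ q (d s)) (by
    rw [Set.range_comp' q d, ← Submodule.map_span, KaehlerDifferential.span_range_derivation,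
      Submodule.map_top, LinearMap.range_eq_top.2 hq])
  have : Finite κ := Module.Finite.finite_basis b'
  obtain ⟨n, ⟨ε⟩⟩ := Finite.exists_equiv_fin κ
  let x := a' ∘ ε.symm
  let b := b'.reindex ε
  have hb : ∀ i, b i = q (d (x i)) := fun i ↦ by simp [b, hb', x]
  let D : Fin n → Derivation R S S := fun i ↦ (b.coord i ∘ₗ q).compDer d
  have hD : ∀ i j, D i (x j) = if i = j then 1 else 0 := by
    intro i j
    change b.coord i (q (d (x j))) = _
    rw [← hb, Module.Basis.coord_apply, Module.Basis.repr_self, Finsupp.single_apply]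
    simp only [eq_comm]
  have hli := linearIndependent_residue_monomials h hinj x D hD
  -- A non-nilpotent `t` kills `K`. Over the nonzero ring `R[1/t^p]` the differentials reduce to
  -- `L`, so `x` becomes a p-basis.
  have hrank : Module.finrank R S = p ^ n := by
    obtain ⟨t, ht, htK⟩ := exists_not_isNilpotent_smul_eq_zero hK
    obtain ⟨r, hr⟩ := hpow t
    have : Nontrivial (Localization.Away r) := by
      refine not_subsingleton_iff_nontrivial.1 fun hs ↦ ht ?_
      obtain ⟨m, hm⟩ := (IsLocalization.subsingleton_iff (S := Localization.Away r) (M := .powers r)).1 hs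
      refine ⟨p * m, ?_⟩
      rw [pow_mul, ← hr, ← map_pow]
      exact (congrArg _ hm).trans (map_zero _)
    let R' := Localization.Away r
    have := IsLocalization.flat R' (.powers r)
    let := Algebra.TensorProduct.rightAlgebra (R := R) (A := R') (B := S)
    obtain ⟨f, hf⟩ := exists_kaehler_equiv R R' S
    have hKs : Subsingleton ((R' ⊗[R] S) ⊗[S] K) := by
      obtain ⟨u, hu⟩ := isUnit_one_tmul_of_pow hr (IsLocalization.Away.algebraMap_isUnit (S := R') r)
      refine subsingleton_of_forall_eq 0 fun z ↦ ?_
      have hu' : (u : R' ⊗[R] S) = algebraMap S (R' ⊗[R] S) t := hu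
      rw [← inv_smul_smul_of_algebraMap hu' z]
      suffices t • z = 0 by rw [this, smul_zero]
      induction z with
      | zero => rw [smul_zero]
      | add a b ha hb => rw [smul_add, ha, hb, add_zero]
      | tmul a y => rw [TensorProduct.smul_tmul', TensorProduct.smul_tmul, htK, TensorProduct.tmul_zero]
    have hbij : Function.Bijective (q.baseChange (R' ⊗[R] S)) := by
      let s : L →ₗ[S] Ω[S⁄R] := e.symm.toLinearMap ∘ₗ LinearMap.inl S L K
      let j : K →ₗ[S] Ω[S⁄R] := e.symm.toLinearMap ∘ₗ LinearMap.inr S L K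
      let k : Ω[S⁄R] →ₗ[S] K := LinearMap.snd S L K ∘ₗ e.toLinearMap
      have hqs : q ∘ₗ s = LinearMap.id := by ext; simp [q, s]
      have hsq : s ∘ₗ q + j ∘ₗ k = LinearMap.id := by
        refine LinearMap.ext fun z ↦ e.injective ?_
        simp [s, q, j, k]
      refine Function.bijective_iff_has_inverse.2 ⟨s.baseChange _, fun z ↦ ?_, fun z ↦ ?_⟩
      · have h1 := LinearMap.congr_fun (congrArg (LinearMap.baseChange (R' ⊗[R] S)) hsq) z
        have h2 : (s ∘ₗ q).baseChange (R' ⊗[R] S) = s.baseChange _ ∘ₗ q.baseChange _ :=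
          LinearMap.baseChange_comp ..
        have h3 : (j ∘ₗ k).baseChange (R' ⊗[R] S) = j.baseChange _ ∘ₗ k.baseChange _ :=
          LinearMap.baseChange_comp ..
        rw [LinearMap.baseChange_add, h2, h3,
          LinearMap.baseChange_id, LinearMap.add_apply, LinearMap.comp_apply, LinearMap.comp_apply,
          Subsingleton.elim (k.baseChange _ z) 0, map_zero, add_zero] at h1
        exact h1
      · rw [← LinearMap.comp_apply, ← LinearMap.baseChange_comp, hqs, LinearMap.baseChange_id]
        rfl
    let b₁ := (b.baseChange (R' ⊗[R] S)).map (LinearEquiv.ofBijective _ hbij).symm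
    have hb₁ : ∀ i, b₁ i = 1 ⊗ₜ d (x i) := fun i ↦ by
      rw [Module.Basis.map_apply, LinearEquiv.symm_apply_eq]
      simp [hb]
    have hp := isPBasis_of_basis (cast_eq_zero_of_algebra R' h)
      (injective_algebraMap_tensorProduct hinj) (pow_mem_range_of_localization h hpow R')
      (fun i ↦ 1 ⊗ₜ x i) (b₁.map f) (fun i ↦ by rw [Module.Basis.map_apply, hb₁, hf])
    rw [← hp.finrank_eq (pow_mem_range_of_localization h hpow R'), Module.finrank_baseChange]
  -- p^n independent elements in a fibre of dimension p^n form a basis, and Nakayama lifts the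
  -- spanning.
  have hspan : Submodule.span R (Set.range fun α : Fin n → Fin p ↦ ∏ i, x i ^ (α i : ℕ)) = ⊤ := by
    have hcard : Fintype.card (Fin n → Fin p) =
        Module.finrank (IsLocalRing.ResidueField R) (IsLocalRing.ResidueField R ⊗[R] S) := by
      rw [Module.finrank_baseChange, hrank]
      simp
    refine IsLocalRing.span_eq_top_of_tmul_eq_basis _
      (basisOfLinearIndependentOfCardEqFinrank' _ hli hcard) fun α ↦ ?_
    rw [coe_basisOfLinearIndependentOfCardEqFinrank']
  have hadj : Algebra.adjoin R (Set.range x) = ⊤ := by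
    rw [← Algebra.toSubmodule_eq_top, eq_top_iff, ← hspan, Submodule.span_le]
    rintro _ ⟨α, rfl⟩
    exact Subalgebra.prod_mem _ fun i _ ↦ Subalgebra.pow_mem _ (Algebra.subset_adjoin (Set.mem_range_self i)) _
  have hdx := span_kaehler_eq_top x hadj
  refine subsingleton_of_forall_eq 0 fun y ↦ ?_
  have hy : e.symm (0, y) ∈ Submodule.span S (Set.range fun i ↦ d (x i)) := hdx ▸ Submodule.mem_top
  obtain ⟨c, hc⟩ := (Submodule.mem_span_range_iff_exists_fun S).1 hy
  -- Every differential is a combination of the dx_i. Projecting one that comes from `K` to `L`,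
  -- where the dx_i become a basis, shows that its coefficients vanish.
  have h0 : ∑ i, c i • b i = 0 := by
    have := congrArg q hc
    rw [map_sum] at this
    simpa [hb, q] using this
  have hc0 := Fintype.linearIndependent_iff.1 b.linearIndependent c h0
  have : e.symm (0, y) = 0 := by
    rw [← hc]
    exact Finset.sum_eq_zero fun i _ ↦ by rw [hc0, zero_smul]
  rw [LinearEquiv.map_eq_zero_iff] at this
  exact congrArg Prod.snd this

end LocalCase

end RingExt

/-! ### From split differential operators to projective differentials -/

namespace RingExt

section DualSplit

/-- The dual of `M` is split by functionals and elements of `M`: there are `a_i` in the dual and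
`b_i` in `M` with `f = ∑ f(b_i) a_i` for all functionals `f`. -/
def IsDualSplit (S M : Type*) [CommRing S] [AddCommGroup M] [Module S M] : Prop :=
  (LinearMap.id : (M →ₗ[S] S) →ₗ[S] (M →ₗ[S] S)) ∈
    Submodule.span S {φ | ∃ (a : M →ₗ[S] S) (b : M), ∀ f : M →ₗ[S] S, φ f = f b • a}

variable {S M : Type*} [CommRing S] [AddCommGroup M] [Module S M]

theorem isDualSplit_of_sum {ι : Type*} [Fintype ι] (a : ι → M →ₗ[S] S) (b : ι → M)
    (h : ∀ f : M →ₗ[S] S, f = ∑ i, f (b i) • a i) : IsDualSplit S M := by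
  let φ : ι → (M →ₗ[S] S) →ₗ[S] (M →ₗ[S] S) := fun i ↦
    (LinearMap.applyₗ (b i)).smulRight (a i)
  have : LinearMap.id = ∑ i, φ i := by
    refine LinearMap.ext fun f ↦ ?_
    rw [LinearMap.sum_apply]
    exact h f
  rw [IsDualSplit, this]
  exact Submodule.sum_mem _ fun i _ ↦ Submodule.subset_span ⟨a i, b i, fun f ↦ rfl⟩

theorem IsDualSplit.exists_sum (h : IsDualSplit S M) :
    ∃ (n : ℕ) (a : Fin n → M →ₗ[S] S) (b : Fin n → M), ∀ f : M →ₗ[S] S,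
      f = ∑ i, f (b i) • a i := by
  obtain ⟨n, c, g, hg⟩ := Submodule.mem_span_set'.1 h
  choose a b hab using fun i ↦ (g i).2
  refine ⟨n, fun i ↦ c i • a i, b, fun f ↦ ?_⟩
  conv_lhs => rw [← LinearMap.id_apply (R := S) f, ← hg, LinearMap.sum_apply]
  refine Finset.sum_congr rfl fun i _ ↦ ?_
  rw [LinearMap.smul_apply, hab, smul_comm]

theorem IsDualSplit.of_retract {N : Type*} [AddCommGroup N] [Module S N] (h : IsDualSplit S M)
    (i : N →ₗ[S] M) (g : M →ₗ[S] N) (hgi : g ∘ₗ i = LinearMap.id) : IsDualSplit S N := by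
  obtain ⟨n, a, b, hab⟩ := h.exists_sum
  refine isDualSplit_of_sum (fun j ↦ a j ∘ₗ i) (fun j ↦ g (b j)) fun f ↦ ?_
  have := hab (f ∘ₗ g)
  conv_lhs => rw [← LinearMap.comp_id f, ← hgi, ← LinearMap.comp_assoc, this]
  ext z
  simp [LinearMap.sum_apply]

/-- An endomorphism of the dual over `S` is compressed to one over `R`: extend a functional to `S ⊗
N`, apply it, restrict to `N` and project by π. Since π(1) = 1, the identity is compressed to the
identity; rank-one maps go to sums of rank-one maps. -/
theorem IsDualSplit.of_tensorProduct {R S N : Type*} [CommRing R] [CommRing S] [Algebra R S]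
    [AddCommGroup N] [Module R N] (hd : IsDualSplit S (S ⊗[R] N)) {π : S →ₗ[R] R} (hπ : π 1 = 1) :
    IsDualSplit R N := by
  let B : (N →ₗ[R] R) →ₗ[R] (S ⊗[R] N →ₗ[S] S) :=
    { toFun := fun f ↦ (Algebra.linearMap R S ∘ₗ f).liftBaseChange S
      map_add' := fun f g ↦ by ext; simp
      map_smul' := fun r f ↦ by ext; simp [Algebra.smul_def] }
  have hB : ∀ f s n, B f (s ⊗ₜ n) = s * algebraMap R S (f n) := fun f s n ↦ by
    simp [B]
  let T : ((S ⊗[R] N →ₗ[S] S) →ₗ[S] (S ⊗[R] N →ₗ[S] S)) → (N →ₗ[R] R) →ₗ[R] (N →ₗ[R] R) := fun φ ↦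
    { toFun := fun f ↦ π ∘ₗ (φ (B f)).restrictScalars R ∘ₗ TensorProduct.mk R S N 1
      map_add' := fun f g ↦ by ext; simp
      map_smul' := fun r f ↦ by
        ext n
        simp only [map_smul, RingHom.id_apply, LinearMap.comp_apply, LinearMap.smul_apply,
          LinearMap.coe_restrictScalars, LinearMap.map_smul_of_tower] }
  have hT : ∀ φ f n, T φ f n = π (φ (B f) (1 ⊗ₜ n)) := fun _ _ _ ↦ rfl
  -- The scalar `s` is kept general because `T` is not `S`-linear, while membership is an induction
  -- on an `S`-span.
  have key : ∀ φ ∈ Submodule.span S {φ : (S ⊗[R] N →ₗ[S] S) →ₗ[S] (S ⊗[R] N →ₗ[S] S) |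
      ∃ (a : S ⊗[R] N →ₗ[S] S) (b : S ⊗[R] N), ∀ f : S ⊗[R] N →ₗ[S] S, φ f = f b • a}, ∀ s : S,
      T (s • φ) ∈ Submodule.span R {φ : (N →ₗ[R] R) →ₗ[R] (N →ₗ[R] R) |
        ∃ (a : N →ₗ[R] R) (b : N), ∀ f : N →ₗ[R] R, φ f = f b • a} := by
    intro φ hφ
    induction hφ using Submodule.span_induction with
    | zero =>
      intro s
      have : T (s • 0) = 0 := by
        ext
        simp [hT]
      rw [this]
      exact zero_mem _
    | add φ ψ _ _ h1 h2 =>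
      intro s
      convert! add_mem (h1 s) (h2 s)
      ext
      simp [hT]
    | smul c φ _ h1 =>
      intro s
      rw [smul_smul]
      exact h1 _
    | mem φ hφ =>
      obtain ⟨a, b, hab⟩ := hφ
      induction b generalizing φ with
      | zero =>
        intro s
        have : T (s • φ) = 0 := by
          ext
          simp [hT, hab]
        rw [this]
        exact zero_mem _
      | add b₁ b₂ h1 h2 =>
        intro s
        convert! add_mem (h1 ((LinearMap.applyₗ b₁).smulRight a) (fun _ ↦ rfl) s)
          (h2 ((LinearMap.applyₗ b₂).smulRight a) (fun _ ↦ rfl) s)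
        ext
        simp [hT, hab, add_mul, mul_add]
      | tmul c n =>
        intro s
        refine Submodule.subset_span ⟨π ∘ₗ ((s * c) • a).restrictScalars R ∘ₗ
          TensorProduct.mk R S N 1, n, fun f ↦ ?_⟩
        ext m
        simp only [hT, hab, hB, LinearMap.smul_apply, LinearMap.comp_apply, smul_eq_mul,
          LinearMap.coe_restrictScalars, TensorProduct.mk_apply]
        rw [← smul_eq_mul (f n), ← map_smul, Algebra.smul_def]
        congr 1
        ring
  have h1 := key _ hd 1
  rw [one_smul] at h1
  have : T LinearMap.id = LinearMap.id := by
    ext f n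
    simp only [hT, LinearMap.id_apply, hB, one_mul]
    rw [Algebra.algebraMap_eq_smul_one, map_smul, hπ, smul_eq_mul, mul_one]
  rwa [this] at h1

/-- The endomorphism ε = ∑ a_i(·) b_i leaves every functional unchanged, hence is idempotent. Its
image is a summand of a finite free module. A functional on its kernel extends to `M` through id -
ε, is invariant under ε, and so vanishes on the kernel. -/
theorem IsDualSplit.exists_equiv_prod (h : IsDualSplit S M) :
    ∃ L K : Submodule S M, IsCompl L K ∧ Module.Projective S L ∧ Module.Finite S L ∧
      ∀ f : K →ₗ[S] S, f = 0 := by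
  obtain ⟨n, a, b, hab⟩ := h.exists_sum
  let q : M →ₗ[S] (Fin n → S) := LinearMap.pi a
  let s : (Fin n → S) →ₗ[S] M := Fintype.linearCombination S b
  let ε := s ∘ₗ q
  have hε : ∀ f : M →ₗ[S] S, f ∘ₗ ε = f := by
    intro f
    conv_rhs => rw [hab f]
    ext z
    simp [ε, q, s, Fintype.linearCombination_apply, mul_comm]
  have hq : ∀ z, q (ε z) = q z := fun z ↦ funext fun i ↦ LinearMap.congr_fun (hε (a i)) z
  have hid : ∀ z, ε (ε z) = ε z := fun z ↦ congrArg s (hq z)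
  refine ⟨LinearMap.range ε, LinearMap.ker ε,
    LinearMap.IsIdempotentElem.isCompl (LinearMap.ext hid), ?_, ?_, fun f ↦ ?_⟩
  · refine Module.Projective.of_split (q ∘ₗ (LinearMap.range ε).subtype) (ε.rangeRestrict ∘ₗ s) ?_
    refine LinearMap.ext ?_
    rintro ⟨_, z, rfl⟩
    exact Subtype.ext ((hid (ε z)).trans (hid z))
  · refine Module.Finite.of_surjective (ε.rangeRestrict ∘ₗ s) ?_
    rintro ⟨_, z, rfl⟩
    exact ⟨q z, Subtype.ext (hid z)⟩
  · let g : M →ₗ[S] LinearMap.ker ε := (LinearMap.id - ε).codRestrict _ fun z ↦ by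
      simp [hid]
    ext ⟨z, hz⟩
    have h1 := LinearMap.congr_fun (hε (f ∘ₗ g)) z
    have h2 : g z = ⟨z, hz⟩ := Subtype.ext (by simp [g, LinearMap.mem_ker.1 hz])
    rw [LinearMap.comp_apply, LinearMap.mem_ker.1 hz, map_zero, LinearMap.comp_apply, h2] at h1
    exact h1.symm

end DualSplit

section PrincipalParts

/-- A dual basis of `C` over `A` writes every endomorphism as D = ∑ D(c_i) φ_i. Applying the
`C`-linear projection onto the operators of order k to those of the form F ∘ d gives the splitting,
with a_i induced by the projected φ_i and b_i = d(c_i). -/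
theorem isDualSplit_principalParts {A C : Type*} [CommRing A] [CommRing C] [Algebra A C]
    [Module.Finite A C] [Module.Projective A C] {k : ℕ} (hk : IsComplemented (diffOp A C C k)) :
    IsDualSplit C (PrincipalParts A C k) := by
  obtain ⟨Q, hQ⟩ := hk
  let π := (diffOp A C C k).projectionOnto Q hQ
  obtain ⟨n, f, g, -, -, hfg⟩ := Module.Finite.exists_comp_eq_id_of_projective A C
  let φ : Fin n → C →ₗ[A] C := fun i ↦ Algebra.linearMap A C ∘ₗ LinearMap.proj i ∘ₗ g
  have hφ : ∀ D : C →ₗ[A] C, D = ∑ i, D (f (Pi.single i 1)) • φ i := by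
    intro D
    ext c
    conv_lhs => rw [← LinearMap.id_apply (R := A) c, ← hfg, LinearMap.comp_apply,
      ← Finset.univ_sum_single (g c), map_sum, map_sum]
    rw [LinearMap.sum_apply]
    refine Finset.sum_congr rfl fun i _ ↦ ?_
    have : (Pi.single i (g c i) : Fin n → A) = g c i • Pi.single i 1 := by
      rw [← Pi.single_smul, smul_eq_mul, mul_one]
    rw [this, map_smul, map_smul, Algebra.smul_def, mul_comm]
    rfl
  refine isDualSplit_of_sum (fun i ↦ PrincipalParts.lift _ (π (φ i)).2)
    (fun i ↦ PrincipalParts.d A C k (f (Pi.single i 1))) fun F ↦ ?_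
  have hF := comp_mem_diffOp_of_linear (PrincipalParts.d_mem (A := A) (C := C) k) F
  refine PrincipalParts.hom_ext fun c ↦ ?_
  have h1 := congrArg (fun D ↦ (π D : C →ₗ[A] C)) (hφ (F.restrictScalars A ∘ₗ PrincipalParts.d A C k))
  simp only [map_sum, map_smul] at h1
  rw [Submodule.projectionOnto_apply_left hQ ⟨_, hF⟩] at h1
  have h2 := LinearMap.congr_fun h1 c
  simp only [LinearMap.sum_apply, LinearMap.smul_apply, PrincipalParts.lift_d]
  simpa [LinearMap.sum_apply] using h2

end PrincipalParts

section Projective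

variable {p : ℕ} [hp : Fact p.Prime]

theorem projective_kaehler_of_isDualSplit {R S : Type*} [CommRing R] [CommRing S] [Algebra R S]
    (h : (p : R) = 0) (hinj : Function.Injective (algebraMap R S)) [Module.Finite R S]
    [Module.Projective R S] (hpow : ∀ s : S, s ^ p ∈ (algebraMap R S).range)
    (hd : IsDualSplit S Ω[S⁄R]) : Module.Projective S Ω[S⁄R] := by
  have : Module.FinitePresentation R S := Module.finitePresentation_of_projective _ _
  have : Algebra.FinitePresentation R S := inferInstance
  have : Module.FinitePresentation S Ω[S⁄R] := inferInstance
  obtain ⟨L, K, hLK, _, _, hK⟩ := hd.exists_equiv_prod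
  have : Module.FinitePresentation S K := by
    refine Module.finitePresentation_of_projective_of_exact K.subtype (L.projectionOnto K hLK)
      K.subtype_injective ?_ ?_
    · rw [← LinearMap.range_eq_top, Submodule.range_projectionOnto]
    · rw [LinearMap.exact_iff, Submodule.ker_projectionOnto, Submodule.range_subtype]
  let e := (Submodule.prodEquivOfIsCompl L K hLK).symm
  have hsub : Subsingleton K := by
    refine subsingleton_of_forall_eq 0 fun y ↦ ?_
    by_contra hy
    let I : Ideal R := LinearMap.ker (LinearMap.toSpanSingleton R K y)
    obtain ⟨𝔪, h𝔪, hle⟩ := Ideal.exists_le_maximal I fun h1 ↦ hy (by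
      have : (1 : R) ∈ I := h1 ▸ Submodule.mem_top
      simpa [I] using this)
    let R' := Localization.AtPrime 𝔪
    have := IsLocalization.flat R' 𝔪.primeCompl
    let D := R' ⊗[R] S
    let := Algebra.TensorProduct.rightAlgebra (R := R) (A := R') (B := S)
    let T := Algebra.algebraMapSubmonoid S 𝔪.primeCompl
    have : IsLocalization T D := inferInstance
    obtain ⟨f, -⟩ := exists_kaehler_equiv R R' S
    have : Module.Free R' D := Module.free_of_flat_of_isLocalRing
    have hsubD : Subsingleton (D ⊗[S] K) := by
      refine subsingleton_of_kaehler_equiv_prod (cast_eq_zero_of_algebra R' h)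
        (injective_algebraMap_tensorProduct hinj) (pow_mem_range_of_localization h hpow R')
        (L := D ⊗[S] L)
        (f.symm ≪≫ₗ e.baseChange S D _ _ ≪≫ₗ TensorProduct.prodRight S D D L K) fun g ↦ ?_
      -- As `K` is finitely presented, a functional on its localization is, up to a denominator, the
      -- localization of one on `K`, hence zero.
      let g₁ : K →ₗ[S] D := g.restrictScalars S ∘ₗ TensorProduct.mk S D K 1
      obtain ⟨g₂, s, hg₂⟩ := Module.FinitePresentation.exists_lift_of_isLocalizedModule T
        (Algebra.linearMap S D) g₁
      rw [hK g₂, LinearMap.comp_zero] at hg₂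
      ext y
      have h1 : (s : S) • g₁ y = 0 := (LinearMap.congr_fun hg₂ y).symm
      rw [Algebra.smul_def] at h1
      exact (IsLocalization.map_units D s).mul_right_eq_zero.1 h1
    obtain ⟨t, ht⟩ := (IsLocalizedModule.eq_iff_exists T (TensorProduct.mk S D K 1)).1
      (Subsingleton.elim (TensorProduct.mk S D K 1 y) (TensorProduct.mk S D K 1 0))
    obtain ⟨r, hr, hrt⟩ := t.2
    refine hr (hle (LinearMap.mem_ker.2 ?_))
    rw [LinearMap.toSpanSingleton_apply, ← algebraMap_smul S, hrt]
    exact ht.trans (smul_zero _)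
  have : Unique K := uniqueOfSubsingleton 0
  have e' : Ω[S⁄R] ≃ₗ[S] L := e ≪≫ₗ LinearEquiv.prodUnique
  exact Module.Projective.of_equiv e'.symm

end Projective

set_option linter.unusedSectionVars false

section Tower

theorem projective_of_projective_tower (R S C : Type*) [CommRing R] [CommRing S] [CommRing C]
    [Algebra R S] [Algebra S C] [Algebra R C] [IsScalarTower R S C] [Module.Finite S C]
    [Module.Projective S C] [Module.Projective R C] (hinj : Function.Injective (algebraMap S C)) :
    Module.Projective R S := by
  obtain ⟨π, hπ⟩ := exists_linearMap_one hinj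
  refine Module.Projective.of_split ((Algebra.linearMap S C).restrictScalars R)
    (π.restrictScalars R) (LinearMap.ext fun x ↦ ?_)
  change π (algebraMap S C x) = x
  rw [Algebra.algebraMap_eq_smul_one, map_smul, hπ, smul_eq_mul, mul_one]

variable {p : ℕ} [hp : Fact p.Prime] {A C : Type*} [CommRing A] [CommRing C] [Algebra A C]

theorem finitePresentation_principalParts [Module.Finite A C] [Module.Projective A C] (k : ℕ) :
    Module.FinitePresentation C (PrincipalParts A C k) := by
  have : Module.FinitePresentation C (C ⊗[A] C) := Module.finitePresentation_of_projective _ _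
  have : Module.FinitePresentation (C ⊗[A] C) (PrincipalParts A C k) := by
    refine Module.finitePresentation_of_surjective
      (Submodule.mkQ (KaehlerDifferential.ideal A C ^ (k + 1))) (Submodule.mkQ_surjective _) ?_
    rw [Submodule.ker_mkQ]
    exact (KaehlerDifferential.ideal_fg A C).pow
  exact Module.FinitePresentation.trans _ _ (C ⊗[A] C)

theorem IsFExtension.projective (hinj : Function.Injective (algebraMap A C))
    (hF : IsFExtension p A C) (hexp : HasFiniteExponent p A C) : Module.Projective A C := by
  obtain ⟨N, hN⟩ := hexp
  have h1 := hF N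
  rw [frob_eq_bot hN] at h1
  have : Module.Projective A (⊥ : Subalgebra A C) :=
    Module.Projective.of_equiv (Algebra.botEquivOfInjective hinj).symm.toLinearEquiv
  exact projective_trans A (⊥ : Subalgebra A C) C

theorem projective_inclusion {B B' : Subalgebra A C} (hle : B' ≤ B) [Module.Finite B C]
    [Module.Projective B C] [Module.Projective B' C] :
    let := (Subalgebra.inclusion hle).toRingHom.toAlgebra
    Module.Projective B' B := by
  intro _
  have : IsScalarTower B' B C := .of_algebraMap_eq fun _ ↦ rfl
  exact projective_of_projective_tower B' B C Subtype.val_injective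

theorem IsFExtension.projective_frob_succ [Module.Finite A C] (hF : IsFExtension p A C) (e : ℕ) :
    let := frobAlgebra p A C e
    Module.Projective (frob p A C (e + 1)) (frob p A C e) := by
  have := hF e
  have := hF (e + 1)
  have : Module.Finite (frob p A C e) C := Module.Finite.of_restrictScalars_finite A _ _
  exact projective_inclusion (frob_succ_le p A C e)

/-- The induction is as for projective principal parts, but what passes through the retracts and
descends to `C^[e]` is only dual splitness. The F-extension hypothesis makes `C^[e]` projective over
`C^[e+1]`, which the rank argument needs. -/
theorem projective_kaehler_frob_of_isComplemented [CharP A p] [Module.Finite A C]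
    (hinj : Function.Injective (algebraMap A C)) (hexp : HasFiniteExponent p A C)
    (hF : IsFExtension p A C)
    (H : ∀ e < exponent p A C, IsComplemented (diffOp A C C (p ^ e))) :
    ∀ e < exponent p A C, Module.Projective (frob p A C e) Ω[frob p A C e⁄A] := by
  have h := CharP.cast_eq_zero A p
  have := hF.projective hinj hexp
  intro e
  induction e using Nat.strong_induction_on with
  | _ e ih =>
    intro he
    have hstep : ∀ j < e, IsGaloisStep p A C j := fun j hj ↦ by
      have := ih j hj (hj.trans he)
      exact isGaloisStep_of_projective_kaehler hexp (hj.trans he)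
    have := finitePresentation_principalParts (A := A) (C := C) (p ^ e)
    obtain ⟨i, g, hgi⟩ := exists_retract_kaehler_frob hexp hstep
    have := projective_frob hstep
    have : Module.Finite (frob p A C e) C := Module.Finite.of_restrictScalars_finite A _ _
    obtain ⟨π, hπ⟩ := exists_linearMap_one (R := frob p A C e) (S := C) Subtype.val_injective
    have hd := ((isDualSplit_principalParts (H e he)).of_retract i g hgi).of_tensorProduct hπ
    let := frobAlgebra p A C e
    have := isScalarTower_frob_succ (p := p) (A := A) (C := C) e
    have := finite_frob_succ (p := p) (A := A) (C := C) e
    have := hF.projective_frob_succ e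
    obtain ⟨f, -⟩ := exists_kaehler_equiv_of_adjoin_pow h (adjoin_pow_frob_succ (C := C) e)
    have := projective_kaehler_of_isDualSplit (R := frob p A C (e + 1)) (S := frob p A C e)
      (cast_eq_zero_of_algebra _ h) (Subalgebra.inclusion_injective (frob_succ_le p A C e))
      (fun s ↦ ⟨⟨_, pow_mem_frob_succ h e s.2⟩, rfl⟩)
      (hd.of_retract f.symm.toLinearMap f.toLinearMap (by ext; simp))
    exact Module.Projective.of_equiv f.symm

theorem isFExtension_of_isGaloisStep (hexp : HasFiniteExponent p A C)
    (hstep : ∀ e < exponent p A C, IsGaloisStep p A C e) : IsFExtension p A C := by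
  intro e
  rcases le_or_gt e (exponent p A C) with he | he
  · exact projective_frob fun j hj ↦ hstep j (hj.trans_le he)
  · have h1 := frob_eq_bot (hasExponentLE_exponent hexp)
    have h2 : frob p A C e = frob p A C (exponent p A C) := by
      rw [h1, eq_bot_iff, ← h1]
      exact frob_antitone he.le
    rw [h2]
    exact projective_frob hstep

/-- A section s of C ⊗ C → P^k defines a `C`-linear projection: linearize an endomorphism,
precompose with s, and read the result as an operator on `C`. Operators of order k already factor
through P^k and are unchanged. -/
theorem isComplemented_diffOp (k : ℕ) [Module.Projective C (PrincipalParts A C k)] :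
    IsComplemented (diffOp A C C k) := by
  obtain ⟨s, hs⟩ := Module.projective_lifting_property (PrincipalParts.mk A C k) LinearMap.id
    (PrincipalParts.mk_surjective k)
  let lb : (C →ₗ[A] C) →ₗ[C] (C ⊗[A] C →ₗ[C] C) :=
    (LinearMap.liftBaseChangeEquiv C).toLinearMap
  let r : (C →ₗ[A] C) →ₗ[C] diffOp A C C k := LinearMap.codRestrict _
    { toFun := fun D ↦ (lb D ∘ₗ s).restrictScalars A ∘ₗ PrincipalParts.d A C k
      map_add' := fun D E ↦ by rw [map_add]; rfl
      map_smul' := fun a D ↦ by rw [map_smul]; rfl }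
    fun D ↦ comp_mem_diffOp_of_linear (PrincipalParts.d_mem k) _
  refine ⟨_, LinearMap.isCompl_of_proj (f := r) fun D ↦ Subtype.ext (LinearMap.ext fun c ↦ ?_)⟩
  change (D : C →ₗ[A] C).liftBaseChange C (s (PrincipalParts.d A C k c)) = D.1 c
  rw [← PrincipalParts.lift_mk _ D.2]
  have := LinearMap.congr_fun hs (PrincipalParts.d A C k c)
  rw [LinearMap.comp_apply, LinearMap.id_apply] at this
  rw [this, PrincipalParts.lift_d]

end Tower

end RingExt

/-! ### Truncated polynomial algebras -/

namespace RingExt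

section TruncatedGenerators

theorem ker_lmul'_eq_span {R S : Type*} [CommRing R] [CommRing S] [Algebra R S] {s : Set S}
    (hs : Algebra.adjoin R s = ⊤) :
    RingHom.ker (Algebra.TensorProduct.lmul' R : S ⊗[R] S →ₐ[R] S) =
      Ideal.span ((fun x ↦ 1 ⊗ₜ[R] x - x ⊗ₜ[R] 1) '' s) := by
  refine (KaehlerDifferential.span_range_eq_ideal R S).symm.trans
    (le_antisymm (Ideal.span_le.2 ?_) (Ideal.span_mono (Set.image_subset_range _ _)))
  rintro _ ⟨x, rfl⟩
  have hx : x ∈ Algebra.adjoin R s := hs ▸ Algebra.mem_top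
  simp only [SetLike.mem_coe]
  induction hx using Algebra.adjoin_induction with
  | mem x hx => exact Ideal.subset_span ⟨x, hx, rfl⟩
  | algebraMap r =>
    rw [Algebra.algebraMap_eq_smul_one, TensorProduct.tmul_smul, TensorProduct.smul_tmul', sub_self]
    exact zero_mem _
  | add x y _ _ hx hy =>
    rw [TensorProduct.tmul_add, TensorProduct.add_tmul, add_sub_add_comm]
    exact add_mem hx hy
  | mul x y _ _ hx hy =>
    have : (1 ⊗ₜ[R] (x * y) - (x * y) ⊗ₜ[R] 1 : S ⊗[R] S) =
        1 ⊗ₜ[R] x * (1 ⊗ₜ[R] y - y ⊗ₜ[R] 1) + y ⊗ₜ[R] 1 * (1 ⊗ₜ[R] x - x ⊗ₜ[R] 1) := by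
      simp only [mul_sub, Algebra.TensorProduct.tmul_mul_tmul, one_mul, mul_one, mul_comm y x]
      abel
    rw [this]
    exact add_mem (Ideal.mul_mem_left _ _ hy) (Ideal.mul_mem_left _ _ hx)

/-- A surjective endomorphism of a finite module is injective. This replaces direct independence
proofs by counting monomials against the rank. -/
theorem linearIndependent_of_span_of_basis {R M ι : Type*} [CommRing R] [AddCommGroup M]
    [Module R M] [Finite ι] (b : Module.Basis ι R M) {v : ι → M}
    (hv : Submodule.span R (Set.range v) = ⊤) : LinearIndependent R v := by
  have := Module.Finite.of_basis b
  let f : M →ₗ[R] M := b.constr R v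
  have hf : Function.Surjective f := by
    rw [← LinearMap.range_eq_top, eq_top_iff, ← hv, Submodule.span_le]
    rintro _ ⟨i, rfl⟩
    exact ⟨b i, b.constr_basis R v i⟩
  have := b.linearIndependent.map' f
    (LinearMap.ker_eq_bot.2 (OrzechProperty.injective_of_surjective_endomorphism f hf))
  rwa [show f ∘ b = v from funext fun i ↦ b.constr_basis R v i] at this

variable {R S : Type*} [CommRing R] [CommRing S] [Algebra R S]

theorem free_quotient_span_image {M ι : Type*} [AddCommGroup M] [Module R M] {v : ι → M}
    (hli : LinearIndependent R v) (hv : Submodule.span R (Set.range v) = ⊤) (s : Set ι) :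
    Module.Free R (M ⧸ Submodule.span R (v '' s)) := by
  have hc : IsCompl (Submodule.span R (v '' s)) (Submodule.span R (v '' sᶜ)) := by
    refine ⟨hli.disjoint_span_image disjoint_compl_right, ?_⟩
    rw [codisjoint_iff, ← Submodule.span_union, ← Set.image_union, Set.union_compl_self,
      Set.image_univ, hv]
  have hr : v '' sᶜ = Set.range fun i : ↥sᶜ ↦ v i := Set.image_eq_range _ _
  rw [hr] at hc
  have : Module.Free R (Submodule.span R (Set.range fun i : ↥sᶜ ↦ v i)) :=
    Module.Free.of_basis
      (Module.Basis.span (hli.comp (fun i : ↥sᶜ ↦ (i : ι)) Subtype.val_injective))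
  exact Module.Free.of_equiv (Submodule.quotientEquivOfIsCompl _ _ hc).symm

theorem restrictScalars_span_range_pow_eq {n : ℕ} (x : Fin n → S)
    (hx : Submodule.span R (Set.range (mon x)) = ⊤) (k : ℕ) :
    ((Ideal.span (Set.range x)) ^ k).restrictScalars R =
      Submodule.span R (mon x '' {m | k ≤ ∑ i, m i}) := by
  have hmul : ∀ k l, Submodule.span R (mon x '' {m | k ≤ ∑ i, m i}) *
      Submodule.span R (mon x '' {m | l ≤ ∑ i, m i}) ≤
        Submodule.span R (mon x '' {m | k + l ≤ ∑ i, m i}) := by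
    intro k l
    rw [Submodule.span_mul_span, Submodule.span_le]
    rintro _ ⟨_, ⟨m, hm, rfl⟩, _, ⟨m', hm', rfl⟩, rfl⟩
    refine Submodule.subset_span ⟨m + m', ?_, mon_add _ _ _⟩
    simp only [Set.mem_ofPred_eq, Pi.add_apply, Finset.sum_add_distrib] at *
    omega
  have htop : ∀ s, s ∈ Submodule.span R (mon x '' {m | 0 ≤ ∑ i, m i}) := by
    simp [hx]
  have hone : ∀ a ∈ Ideal.span (Set.range x),
      a ∈ Submodule.span R (mon x '' {m | 1 ≤ ∑ i, m i}) := by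
    intro a ha
    induction ha using Submodule.span_induction with
    | mem a ha =>
      obtain ⟨j, rfl⟩ := ha
      exact Submodule.subset_span ⟨Pi.single j 1, by simp, by rw [mon_single, pow_one]⟩
    | zero => exact zero_mem _
    | add a b _ _ ha hb => exact add_mem ha hb
    | smul s a _ ha =>
      have := hmul 0 1 (Submodule.mul_mem_mul (htop s) ha)
      rwa [zero_add] at this
  refine le_antisymm (fun a ha ↦ ?_) (Submodule.span_le.2 ?_)
  · rw [Submodule.restrictScalars_mem] at ha
    induction k generalizing a with
    | zero => exact htop a
    | succ k ih =>
      rw [pow_succ] at ha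
      induction ha using Submodule.mul_induction_on' with
      | mem_mul_mem a ha b hb => exact hmul k 1 (Submodule.mul_mem_mul (ih _ ha) (hone b hb))
      | add a _ b _ ha hb => exact add_mem ha hb
  · rintro _ ⟨m, hm, rfl⟩
    refine Ideal.pow_le_pow_right hm ?_
    simp only [mon]
    rw [← Finset.prod_pow_eq_pow_sum]
    exact Ideal.prod_mem_prod fun i _ ↦
      Ideal.pow_mem_pow (Ideal.subset_span (Set.mem_range_self i)) _

/-- `x` generates `S`, `x_i ^ q_i = 0`, and the reduced monomials are linearly independent. -/
structure IsTruncatedBasis (R : Type*) {S : Type*} [CommRing R] [CommRing S] [Algebra R S] {n : ℕ}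
    (x : Fin n → S) (q : Fin n → ℕ) : Prop where
  pos : ∀ i, 0 < q i
  pow_eq_zero : ∀ i, x i ^ q i = 0
  adjoin_eq_top : Algebra.adjoin R (Set.range x) = ⊤
  linearIndependent :
    LinearIndependent R fun α : (i : Fin n) → Fin (q i) ↦ mon x fun i ↦ (α i : ℕ)

namespace IsTruncatedBasis

variable {n : ℕ} {x : Fin n → S} {q : Fin n → ℕ}

theorem span_eq_top (hx : IsTruncatedBasis R x q) : Submodule.span R
    (Set.range fun α : (i : Fin n) → Fin (q i) ↦ mon x fun i ↦ (α i : ℕ)) = ⊤ :=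
  span_monomials_eq_top x q hx.pos (fun i ↦ hx.pow_eq_zero i ▸ zero_mem _) hx.adjoin_eq_top

theorem map (hx : IsTruncatedBasis R x q) {S' : Type*} [CommRing S'] [Algebra R S']
    (f : S ≃ₐ[R] S') : IsTruncatedBasis R (f ∘ x) q where
  pos := hx.pos
  pow_eq_zero i := by rw [Function.comp_apply, ← map_pow, hx.pow_eq_zero, map_zero]
  adjoin_eq_top := by
    rw [Set.range_comp, ← AlgEquiv.coe_toAlgHom, ← AlgHom.map_adjoin, hx.adjoin_eq_top,
      Algebra.map_top, AlgHom.range_eq_top]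
    exact f.surjective
  linearIndependent := by
    have := hx.linearIndependent.map' f.toLinearMap (LinearMap.ker_eq_bot.2 f.injective)
    rwa [show f.toLinearMap ∘ (fun α : (i : Fin n) → Fin (q i) ↦ mon x fun i ↦ (α i : ℕ)) =
      fun α ↦ mon (f ∘ x) fun i ↦ (α i : ℕ) from funext fun α ↦ by simp [mon]] at this

/-- The power of the ideal is spanned by the reduced monomials of degree at least k, the others
being zero, so the remaining reduced monomials form a basis of the quotient. -/
theorem free_quotient (hx : IsTruncatedBasis R x q) (k : ℕ) :
    Module.Free R (S ⧸ (Ideal.span (Set.range x)) ^ k) := by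
  let v := fun α : (i : Fin n) → Fin (q i) ↦ mon x fun i ↦ (α i : ℕ)
  let s := {α : (i : Fin n) → Fin (q i) | k ≤ ∑ i, (α i : ℕ)}
  have htop : Submodule.span R (Set.range (mon x)) = ⊤ := by
    rw [eq_top_iff, ← hx.span_eq_top]
    refine Submodule.span_mono ?_
    rintro _ ⟨α, rfl⟩
    exact ⟨_, rfl⟩
  have hI : ((Ideal.span (Set.range x)) ^ k).restrictScalars R = Submodule.span R (v '' s) := by
    rw [restrictScalars_span_range_pow_eq x htop]
    refine le_antisymm (Submodule.span_le.2 ?_) (Submodule.span_mono ?_)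
    · rintro _ ⟨m, hm, rfl⟩
      by_cases h : ∀ i, m i < q i
      · exact Submodule.subset_span ⟨fun i ↦ ⟨m i, h i⟩, hm, rfl⟩
      · push Not at h
        obtain ⟨i, hi⟩ := h
        have : mon x m = 0 := Finset.prod_eq_zero (Finset.mem_univ i) (by
          rw [← Nat.sub_add_cancel hi, pow_add, hx.pow_eq_zero, mul_zero])
        rw [this]
        exact zero_mem _
    · rintro _ ⟨α, hα, rfl⟩
      exact ⟨_, hα, rfl⟩
  have := free_quotient_span_image hx.linearIndependent hx.span_eq_top s
  exact Module.Free.of_equiv (Submodule.quotEquivOfEq _ _ hI.symm ≪≫ₗ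
    Submodule.Quotient.restrictScalarsEquiv R (Ideal.span (Set.range x) ^ k))

/-- By additivity of Frobenius the differences of the two copies of x_i keep the same truncation,
and over the left factor they generate the same algebra; independence follows by rank. -/
theorem tensor_self {p : ℕ} [hp : Fact p.Prime] (h : (p : R) = 0) {e : Fin n → ℕ}
    (hx : IsTruncatedBasis R x (fun i ↦ p ^ e i)) :
    IsTruncatedBasis S (fun i ↦ (1 ⊗ₜ[R] x i - x i ⊗ₜ[R] 1 : S ⊗[R] S)) (fun i ↦ p ^ e i) := by
  have h' : (p : S ⊗[R] S) = 0 := cast_eq_zero_of_algebra _ h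
  have hzero : ∀ i, (1 ⊗ₜ[R] x i - x i ⊗ₜ[R] 1 : S ⊗[R] S) ^ p ^ e i = 0 := by
    intro i
    have := map_sub (powHom h' (e i)) (1 ⊗ₜ[R] x i) (x i ⊗ₜ[R] 1)
    simp only [powHom_apply, Algebra.TensorProduct.tmul_pow, one_pow, hx.pow_eq_zero,
      TensorProduct.tmul_zero, TensorProduct.zero_tmul, sub_zero] at this
    exact this
  have hgen : Algebra.adjoin S
      (Set.range fun i ↦ (1 ⊗ₜ[R] x i - x i ⊗ₜ[R] 1 : S ⊗[R] S)) = ⊤ := by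
    rw [eq_top_iff, ← Algebra.TensorProduct.adjoin_one_tmul_image_eq_top _ hx.adjoin_eq_top]
    refine Algebra.adjoin_le ?_
    rintro _ ⟨_, ⟨i, rfl⟩, rfl⟩
    have : (1 ⊗ₜ[R] x i : S ⊗[R] S) = (1 ⊗ₜ[R] x i - x i ⊗ₜ[R] 1) + algebraMap S _ (x i) := by
      rw [Algebra.TensorProduct.algebraMap_apply, Algebra.algebraMap_self, RingHom.id_apply,
        sub_add_cancel]
    change (1 ⊗ₜ[R] x i : S ⊗[R] S) ∈ Algebra.adjoin S _
    rw [this]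
    exact add_mem (Algebra.subset_adjoin ⟨i, rfl⟩) (Subalgebra.algebraMap_mem _ _)
  refine ⟨hx.pos, hzero, hgen, linearIndependent_of_span_of_basis
    ((Module.Basis.mk hx.linearIndependent hx.span_eq_top.ge).baseChange S)
    (span_monomials_eq_top _ _ hx.pos (fun i ↦ hzero i ▸ zero_mem _) hgen)⟩

end IsTruncatedBasis

theorem isTruncatedBasis_truncatedPolynomial (p : ℕ) [hp : Fact p.Prime] (R : Type*) [CommRing R]
    {n : ℕ} (e : Fin n → ℕ) :
    IsTruncatedBasis R (S := TruncatedPolynomial p R e)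
      (fun i ↦ Ideal.Quotient.mk _ (MvPolynomial.X i)) (fun i ↦ p ^ e i) where
  pos i := pow_pos hp.out.pos _
  pow_eq_zero i := by
    rw [← map_pow, Ideal.Quotient.eq_zero_iff_mem]
    exact Ideal.subset_span ⟨i, rfl⟩
  adjoin_eq_top := by
    have := (Ideal.Quotient.mkₐ R (Ideal.span (Set.range fun i : Fin n =>
      (MvPolynomial.X i : MvPolynomial (Fin n) R) ^ p ^ e i))).map_adjoin (Set.range MvPolynomial.X)
    rw [MvPolynomial.adjoin_range_X, Algebra.map_top,
      (AlgHom.range_eq_top _).2 (Ideal.Quotient.mkₐ_surjective _ _), ← Set.range_comp] at this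
    exact this.symm
  linearIndependent := by
    rw [Fintype.linearIndependent_iff]
    intro g hg α
    let m : ((i : Fin n) → Fin (p ^ e i)) → Fin n →₀ ℕ := fun α ↦
      Finsupp.equivFunOnFinite.symm fun i ↦ (α i : ℕ)
    have hm : Function.Injective m := fun α β h ↦ funext fun i ↦ Fin.ext (DFunLike.congr_fun h i)
    let f : MvPolynomial (Fin n) R := ∑ α, MvPolynomial.monomial (m α) (g α)
    have hf : f ∈ Ideal.span (Set.range fun i : Fin n =>
        (MvPolynomial.X i : MvPolynomial (Fin n) R) ^ p ^ e i) := by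
      rw [← Ideal.Quotient.eq_zero_iff_mem, ← hg, map_sum]
      refine Finset.sum_congr rfl fun α _ ↦ ?_
      rw [MvPolynomial.monomial_eq, Finsupp.prod_fintype _ _ (by simp), map_mul, map_prod,
        Algebra.smul_def]
      simp only [map_pow]
      rfl
    have hs : (Set.range fun i : Fin n => (MvPolynomial.X i : MvPolynomial (Fin n) R) ^ p ^ e i) =
        (fun s ↦ MvPolynomial.monomial s (1 : R)) ''
          (Set.range fun i ↦ Finsupp.single i (p ^ e i)) := by
      rw [← Set.range_comp]
      simp only [MvPolynomial.X_pow_eq_monomial]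
      rfl
    rw [hs, MvPolynomial.mem_ideal_span_monomial_image] at hf
    have hcoeff : f.coeff (m α) = g α := by
      classical
      simp only [f, MvPolynomial.coeff_sum, MvPolynomial.coeff_monomial, hm.eq_iff]
      simp
    by_contra hne
    obtain ⟨_, ⟨i, rfl⟩, hi⟩ := hf (m α) (by rwa [MvPolynomial.mem_support_iff, hcoeff])
    have := hi i
    rw [Finsupp.single_eq_same] at this
    exact absurd this (not_le.2 (α i).2)

end TruncatedGenerators

end RingExt

/-! ### Purely inseparable extensions have projective principal parts -/

namespace RingExt

section BaseChange

variable {A A' C D : Type*} [CommRing A] [CommRing A'] [CommRing C] [CommRing D] [Algebra A A']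
  [Algebra A C] [Algebra A D] [Algebra A' D] [Algebra C D] [IsScalarTower A A' D]
  [IsScalarTower A C D] [Algebra.IsPushout A A' C D]

theorem adjoin_range_algebraMap_of_isPushout (A A' C D : Type*) [CommRing A] [CommRing A']
    [CommRing C] [CommRing D] [Algebra A A'] [Algebra A C] [Algebra A D] [Algebra A' D]
    [Algebra C D] [IsScalarTower A A' D] [IsScalarTower A C D] [Algebra.IsPushout A A' C D] :
    Algebra.adjoin A' (Set.range (algebraMap C D)) = ⊤ := by
  let f := Algebra.IsPushout.equiv A A' C D
  rw [eq_top_iff, ← (AlgHom.range_eq_top f.toAlgHom).2 f.surjective]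
  rintro _ ⟨z, rfl⟩
  induction z with
  | zero => rw [map_zero]; exact zero_mem _
  | add a b ha hb => rw [map_add]; exact add_mem ha hb
  | tmul a c =>
    have : f (a ⊗ₜ c) = a • algebraMap C D c := by
      rw [Algebra.smul_def]
      exact Algebra.IsPushout.equiv_tmul A A' C D a c
    change f (a ⊗ₜ c) ∈ _
    rw [this]
    exact Subalgebra.smul_mem _ (Algebra.subset_adjoin (Set.mem_range_self c)) a

/-- Base change turns C ⊗ C and its diagonal ideal into D ⊗ D and its diagonal ideal, where the
truncated generators give explicit coordinates vanishing on the diagonal. -/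
theorem free_baseChange_principalParts {p : ℕ} [hp : Fact p.Prime] (h : (p : A') = 0) {n : ℕ}
    {x : Fin n → D} {e : Fin n → ℕ} (hx : IsTruncatedBasis A' x (fun i ↦ p ^ e i)) (k : ℕ) :
    Module.Free D (D ⊗[C] PrincipalParts A C k) := by
  let f : D ⊗[C] (C ⊗[A] C) ≃ₐ[D] D ⊗[A'] D :=
    (Algebra.TensorProduct.cancelBaseChange A C D D C).trans
      ((Algebra.TensorProduct.cancelBaseChange A A' D D C).symm.trans
        (Algebra.TensorProduct.congr .refl (Algebra.IsPushout.equiv A A' C D)))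
  have hf : ∀ c, f (1 ⊗ₜ (1 ⊗ₜ c - c ⊗ₜ 1)) =
      1 ⊗ₜ algebraMap C D c - algebraMap C D c ⊗ₜ 1 := by
    intro c
    simp only [TensorProduct.tmul_sub, map_sub, f]
    simp [Algebra.IsPushout.equiv_tmul, Algebra.algebraMap_eq_smul_one]
  let J := RingHom.ker (Algebra.TensorProduct.lmul' A : C ⊗[A] C →ₐ[A] C)
  let ι : C ⊗[A] C →ₐ[C] D ⊗[C] (C ⊗[A] C) := Algebra.TensorProduct.includeRight
  have hJ : (J.map ι).map f =
      Ideal.span (Set.range fun i ↦ (1 ⊗ₜ[A'] x i - x i ⊗ₜ[A'] 1 : D ⊗[A'] D)) := by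
    have h1 := ker_lmul'_eq_span (R := A) (S := C) (s := Set.univ) (by simp)
    have h2 := ker_lmul'_eq_span hx.adjoin_eq_top
    have h3 := ker_lmul'_eq_span (adjoin_range_algebraMap_of_isPushout A A' C D)
    rw [← Set.range_comp] at h2 h3
    refine Eq.trans ?_ (h3.symm.trans h2)
    rw [show J = _ from h1, Ideal.map_span, Ideal.map_span, Set.image_univ,
      ← Set.range_comp, ← Set.range_comp]
    congr 2
    exact funext hf
  have hJk : Ideal.span (Set.range fun i ↦ (1 ⊗ₜ[A'] x i - x i ⊗ₜ[A'] 1 : D ⊗[A'] D)) ^ (k + 1) =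
      ((J ^ (k + 1)).map ι).map f := by
    rw [Ideal.map_pow, Ideal.map_pow, hJ]
  have := (hx.tensor_self h).free_quotient (k + 1)
  exact Module.Free.of_equiv ((Algebra.TensorProduct.tensorQuotientEquiv D (C ⊗[A] C) D
    (J ^ (k + 1))).trans (Ideal.quotientEquivAlg _ _ f hJk)).symm.toLinearEquiv

end BaseChange

section PrincipalParts

universe u v

theorem IsPurelyInseparable.projective_principalParts {p : ℕ} [hp : Fact p.Prime] {A : Type u}
    {C : Type v} [CommRing A] [CommRing C] [Algebra A C] (h : (p : A) = 0)
    (hinj : Function.Injective (algebraMap A C)) (H : IsPurelyInseparable p A C) (k : ℕ) :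
    Module.Projective C (PrincipalParts A C k) := by
  have := H.finite
  have := H.projective
  have := finitePresentation_principalParts (A := A) (C := C) k
  obtain ⟨N, hN⟩ := H.finiteExponent
  suffices Module.Flat C (PrincipalParts A C k) from
    Module.Flat.projective_of_finitePresentation
  refine flat_of_forall_maximal.{max u v} fun 𝔐 _ ↦ ?_
  obtain ⟨A', _, _, _, n, e, -, ⟨φ⟩⟩ := H.locallyTruncated (𝔐.under A)
  let L := Localization.AtPrime (𝔐.under A)
  let : Algebra A A' := Algebra.compHom A' (algebraMap A L)
  have : IsScalarTower A L A' := .of_algebraMap_eq fun _ ↦ rfl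
  have : Module.Flat A A' := Module.Flat.trans A L A'
  let D := A' ⊗[A] C
  let : Algebra C D := Algebra.TensorProduct.rightAlgebra
  have hx := (isTruncatedBasis_truncatedPolynomial p A' e).map
    (φ.symm.trans (Algebra.TensorProduct.cancelBaseChange A L A' A' C))
  obtain ⟨Q', _, ⟨hQ'⟩⟩ := Ideal.exists_isPrime_liesOver_of_faithfullyFlat (B := A')
    (IsLocalRing.maximalIdeal L)
  obtain ⟨Q, -, hQ, hQQ'⟩ := Ideal.exists_ideal_over_prime_of_isIntegral (S := D) Q' ⊥ (by
    rw [← RingHom.ker_eq_comap_bot,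
      (RingHom.injective_iff_ker_eq_bot _).1 (injective_algebraMap_tensorProduct hinj)]
    exact bot_le)
  have : Algebra.IsPushout A C A' D := .symm inferInstance
  have : Module.Flat C D := Module.Flat.isBaseChange A C A' D this.out
  have hfree := free_baseChange_principalParts (A := A) (C := C)
    (cast_eq_zero_of_algebra A' h) hx k
  refine ⟨D, _, _, Q, hQ, ?_, inferInstance, @Module.Flat.of_free _ _ _ _ _ hfree⟩
  -- Primes of `C` and `D` are determined by p^N-th powers, which lie in the base; hence `Q`, chosen
  -- over the maximal ideal of `L`, contracts to 𝔐.
  ext c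
  obtain ⟨a, ha⟩ := hN c
  have hpN : p ^ N ≠ 0 := pow_ne_zero _ hp.out.ne_zero
  rw [Ideal.under_def, Ideal.mem_comap, ← hQ.pow_mem_iff_mem _ (Nat.pos_of_ne_zero hpN), ← map_pow,
    ← ha, ← IsScalarTower.algebraMap_apply A C D, IsScalarTower.algebraMap_apply A A' D,
    ← Ideal.mem_comap, hQQ', IsScalarTower.algebraMap_apply A L A', ← Ideal.mem_comap,
    ← Ideal.under_def, ← hQ', IsLocalization.AtPrime.to_map_mem_maximal_iff L (𝔐.under A),
    Ideal.under_def, Ideal.mem_comap, ha,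
    Ideal.IsPrime.pow_mem_iff_mem inferInstance _ (Nat.pos_of_ne_zero hpN)]

end PrincipalParts

end RingExt

/-! ### Splitting a normal generating system by adjoining roots -/

namespace RingExt

section Splitting

universe u v

/-- Finitely many elements have `q`-th roots in a faithfully flat extension. -/
theorem exists_faithfullyFlat_roots {A : Type u} [CommRing A] [Nontrivial A] {q : ℕ} (hq : q ≠ 0)
    (s : Finset A) : ∃ (A' : Type (max u v)) (_ : CommRing A') (_ : Algebra A A'),
      Module.FaithfullyFlat A A' ∧ ∀ a ∈ s, ∃ b : A', b ^ q = algebraMap A A' a := by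
  classical
  induction s using Finset.induction_on with
  | empty =>
    exact ⟨ULift.{v} A, inferInstance, inferInstance,
      .of_linearEquiv A A ULift.moduleEquiv, by simp⟩
  | insert a s _ ih =>
    obtain ⟨A', _, _, hff, hs⟩ := ih
    let f : Polynomial A' := Polynomial.X ^ q - Polynomial.C (algebraMap A A' a)
    have hf : f.Monic := Polynomial.monic_X_pow_sub_C _ hq
    have : Nontrivial A' := (FaithfulSMul.algebraMap_injective A A').nontrivial
    -- Free and nonzero together give faithful flatness of the new extension.
    have : Nontrivial (AdjoinRoot f) := Ideal.Quotient.nontrivial_iff.2 fun hf1 ↦ by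
      have h1 := hf.eq_one_of_isUnit (Ideal.span_singleton_eq_top.1 hf1)
      refine hq ?_
      rw [← Polynomial.natDegree_X_pow_sub_C (n := q) (r := algebraMap A A' a)]
      exact (congrArg Polynomial.natDegree h1).trans Polynomial.natDegree_one
    have := hf.free_adjoinRoot
    refine ⟨AdjoinRoot f, inferInstance, inferInstance, .trans A A' _, fun c hc ↦ ?_⟩
    rcases Finset.mem_insert.1 hc with rfl | hc
    · refine ⟨AdjoinRoot.root f, ?_⟩
      have := AdjoinRoot.eval₂_root f
      rw [Polynomial.eval₂_sub, Polynomial.eval₂_pow, Polynomial.eval₂_X, Polynomial.eval₂_C,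
        sub_eq_zero] at this
      rw [this, IsScalarTower.algebraMap_apply A A' (AdjoinRoot f)]
      rfl
    · obtain ⟨b, hb⟩ := hs c hc
      refine ⟨algebraMap A' _ b, ?_⟩
      rw [← map_pow, hb, ← IsScalarTower.algebraMap_apply]

variable {p : ℕ} [hp : Fact p.Prime]

/-- Once finitely many elements of `A` have roots, so does a given element of
`A[x ^ (p ^ k) : x ∈ t]`. -/
theorem exists_finset_root {A : Type u} {S : Type v} [CommRing A] [CommRing S] [Algebra A S]
    (h : (p : A) = 0) {k M : ℕ} (hk : k ≤ M) (t : Set S) {z : S}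
    (hz : z ∈ Algebra.adjoin A ((fun x ↦ x ^ p ^ k) '' t)) :
    ∃ s : Finset A, ∀ (A' : Type (max u v)) [CommRing A'] [Algebra A A'],
      (∀ a ∈ s, ∃ b : A', b ^ p ^ M = algebraMap A A' a) →
        ∃ w ∈ Algebra.adjoin A' ((fun x ↦ (1 ⊗ₜ x : A' ⊗[A] S)) '' t), w ^ p ^ k = 1 ⊗ₜ z := by
  classical
  induction hz using Algebra.adjoin_induction with
  | mem z hz =>
    obtain ⟨x, hx, rfl⟩ := hz
    refine ⟨∅, fun A' _ _ _ ↦ ⟨1 ⊗ₜ x, Algebra.subset_adjoin ⟨x, hx, rfl⟩, ?_⟩⟩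
    rw [Algebra.TensorProduct.tmul_pow, one_pow]
  | algebraMap a =>
    refine ⟨{a}, fun A' _ _ H ↦ ?_⟩
    obtain ⟨b, hb⟩ := H a (Finset.mem_singleton_self a)
    -- A p^M-th root supplies p^k-th roots for every k ≤ M, so one exponent serves all generators.
    refine ⟨algebraMap A' _ (b ^ p ^ (M - k)), Subalgebra.algebraMap_mem _ _, ?_⟩
    rw [← map_pow, ← pow_mul, ← pow_add, Nat.sub_add_cancel hk, hb,
      ← IsScalarTower.algebraMap_apply]
    exact (Algebra.TensorProduct.includeRight.commutes a).symm
  | add y z _ _ hy hz =>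
    obtain ⟨s, hs⟩ := hy
    obtain ⟨s', hs'⟩ := hz
    refine ⟨s ∪ s', fun A' _ _ H ↦ ?_⟩
    obtain ⟨w, hw, hwy⟩ := hs A' fun a ha ↦ H a (Finset.mem_union_left _ ha)
    obtain ⟨w', hw', hwz⟩ := hs' A' fun a ha ↦ H a (Finset.mem_union_right _ ha)
    refine ⟨w + w', add_mem hw hw', ?_⟩
    have h' : (p : A' ⊗[A] S) = 0 := cast_eq_zero_of_algebra _ h
    rw [TensorProduct.tmul_add, ← hwy, ← hwz, ← powHom_apply h', map_add, powHom_apply,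
      powHom_apply]
  | mul y z _ _ hy hz =>
    obtain ⟨s, hs⟩ := hy
    obtain ⟨s', hs'⟩ := hz
    refine ⟨s ∪ s', fun A' _ _ H ↦ ?_⟩
    obtain ⟨w, hw, hwy⟩ := hs A' fun a ha ↦ H a (Finset.mem_union_left _ ha)
    obtain ⟨w', hw', hwz⟩ := hs' A' fun a ha ↦ H a (Finset.mem_union_right _ ha)
    refine ⟨w * w', mul_mem hw hw', ?_⟩
    rw [mul_pow, hwy, hwz, Algebra.TensorProduct.tmul_mul_tmul, one_mul]

theorem IsTruncatedBasis.nonempty_algEquiv {R T : Type*} [CommRing R] [CommRing T] [Algebra R T]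
    {n : ℕ} {x : Fin n → T} {e : Fin n → ℕ} (hx : IsTruncatedBasis R x (fun i ↦ p ^ e i)) :
    Nonempty (T ≃ₐ[R] TruncatedPolynomial p R e) := by
  have hX := isTruncatedBasis_truncatedPolynomial p R e
  let f : TruncatedPolynomial p R e →ₐ[R] T := Ideal.Quotient.liftₐ _ (MvPolynomial.aeval x) (by
    intro a ha
    rw [← RingHom.mem_ker]
    refine Ideal.span_le.2 ?_ ha
    rintro _ ⟨i, rfl⟩
    simp [hx.pow_eq_zero])
  have hf : ∀ i, f (Ideal.Quotient.mk _ (MvPolynomial.X i)) = x i := fun i ↦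
    (Ideal.Quotient.liftₐ_apply _ _ _ _).trans ((Ideal.Quotient.lift_mk _ _ _).trans
      (MvPolynomial.aeval_X x i))
  let b := Module.Basis.mk hX.linearIndependent hX.span_eq_top.ge
  let b' := Module.Basis.mk hx.linearIndependent hx.span_eq_top.ge
  have hbb : f.toLinearMap = (b.equiv b' (Equiv.refl _)).toLinearMap := by
    refine b.ext fun α ↦ ?_
    rw [LinearEquiv.coe_coe, Module.Basis.equiv_apply, Module.Basis.mk_apply,
      Module.Basis.mk_apply]
    simp only [mon, AlgHom.toLinearMap_apply, map_prod, map_pow, hf]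
    rfl
  have hbij : Function.Bijective f := by
    have : (f : TruncatedPolynomial p R e → T) = b.equiv b' (Equiv.refl _) :=
      congrArg DFunLike.coe hbb
    rw [this]
    exact LinearEquiv.bijective _
  exact ⟨(AlgEquiv.ofBijective f hbij).symm⟩

/-- `x` generates `S`, the rank of `S` is `∏ p ^ e_i`, and
`x_i ^ (p ^ e_i) ∈ A[x_j ^ (p ^ e_i) : e_j > e_i]`. -/
structure IsNormalGeneratingSystem (p : ℕ) (A : Type*) {S : Type*} [CommRing A] [CommRing S]
    [Algebra A S] {n : ℕ} (x : Fin n → S) (e : Fin n → ℕ) : Prop where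
  pos : ∀ i, 0 < e i
  adjoin_eq_top : Algebra.adjoin A (Set.range x) = ⊤
  pow_mem : ∀ i, x i ^ p ^ e i ∈
    Algebra.adjoin A ((fun y ↦ y ^ p ^ e i) '' (x '' {j | e i < e j}))
  free : Module.Free A S
  finrank_eq : Module.finrank A S = p ^ ∑ i, e i

/-- An algebra with a normal generating system is a truncated polynomial algebra after a
faithfully flat base change. -/
theorem IsNormalGeneratingSystem.exists_truncated {A : Type u} {S : Type v} [CommRing A]
    [Nontrivial A] [CommRing S] [Algebra A S] [Module.Finite A S] (h : (p : A) = 0) {n : ℕ}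
    {x : Fin n → S} {e : Fin n → ℕ} (hx : IsNormalGeneratingSystem p A x e) :
    ∃ (A' : Type (max u v)) (_ : CommRing A') (_ : Algebra A A'), Module.FaithfullyFlat A A' ∧
      Nonempty (A' ⊗[A] S ≃ₐ[A'] TruncatedPolynomial p A' e) := by
  classical
  let M := ∑ i, e i
  have hM : ∀ i, e i ≤ M := fun i ↦ Finset.single_le_sum (fun _ _ ↦ Nat.zero_le _)
    (Finset.mem_univ i)
  choose s hs using fun i ↦ exists_finset_root h (hM i) _ (hx.pow_mem i)
  obtain ⟨A', _, _, hff, hroot⟩ := exists_faithfullyFlat_roots.{u, v}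
    (pow_ne_zero M hp.out.ne_zero) (Finset.univ.biUnion s)
  choose w hw hwx using fun i ↦ hs i A' fun a ha ↦
    hroot a (Finset.mem_biUnion.2 ⟨i, Finset.mem_univ i, ha⟩)
  refine ⟨A', _, _, hff, ?_⟩
  -- `w i` has the same p^e_i-th power as x_i and involves only the x_j with e_j > e_i; the
  -- difference is the new truncated variable.
  let y : Fin n → A' ⊗[A] S := fun i ↦ 1 ⊗ₜ x i - w i
  have h' : (p : A' ⊗[A] S) = 0 := cast_eq_zero_of_algebra _ h
  have hzero : ∀ i, y i ^ p ^ e i = 0 := by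
    intro i
    simp only [y]
    rw [← powHom_apply h', map_sub, powHom_apply, powHom_apply, hwx,
      Algebra.TensorProduct.tmul_pow, one_pow, sub_self]
  -- Generators are recovered in order of decreasing e_i, from x_i = y_i + w_i.
  have hmem : ∀ m i, M - e i < m → 1 ⊗ₜ x i ∈ Algebra.adjoin A' (Set.range y) := by
    intro m
    induction m with
    | zero => exact fun i hi ↦ absurd hi (Nat.not_lt_zero _)
    | succ m ih =>
      intro i hi
      have hwi : w i ∈ Algebra.adjoin A' (Set.range y) := by
        refine Algebra.adjoin_le ?_ (hw i)
        rintro _ ⟨_, ⟨j, hj, rfl⟩, rfl⟩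
        have := hM j
        have hj : e i < e j := hj
        exact ih j (by omega)
      have := add_mem (Algebra.subset_adjoin (R := A') (Set.mem_range_self (f := y) i)) hwi
      rwa [sub_add_cancel] at this
  have hgen : Algebra.adjoin A' (Set.range y) = ⊤ := by
    rw [eq_top_iff, ← Algebra.TensorProduct.adjoin_one_tmul_image_eq_top _ hx.adjoin_eq_top]
    refine Algebra.adjoin_le ?_
    rintro _ ⟨_, ⟨i, rfl⟩, rfl⟩
    exact hmem _ i (Nat.lt_succ_self _)
  have hpos : ∀ i, 0 < p ^ e i := fun i ↦ pow_pos hp.out.pos _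
  have := hx.free
  let b : Module.Basis ((i : Fin n) → Fin (p ^ e i)) A S :=
    (Module.finBasisOfFinrankEq A S hx.finrank_eq).reindex (Fintype.equivOfCardEq (by
      simp [Finset.prod_pow_eq_pow_sum]))
  exact IsTruncatedBasis.nonempty_algEquiv (x := y) ⟨hpos, hzero, hgen,
    linearIndependent_of_span_of_basis (b.baseChange A')
      (span_monomials_eq_top _ _ hpos (fun i ↦ hzero i ▸ zero_mem _) hgen)⟩

end Splitting

end RingExt

/-! ### Normal generating systems over a local ring -/

namespace RingExt

section NormalGenerators

variable {p : ℕ} [hp : Fact p.Prime]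

/-- Generators of an algebra with free differentials contain a `p`-basis which still generates. -/
theorem exists_generating_subfamily {A R S : Type*} [CommRing A] [CommRing R] [CommRing S]
    [Algebra A R] [Algebra A S] [Algebra R S] [IsScalarTower A R S] [IsLocalRing A]
    [Module.Finite A S] [Module.Free A R] (h : (p : A) = 0)
    (hinj : Function.Injective (algebraMap A S)) {N : ℕ} (hN : HasExponentLE p A S N)
    (hinjR : Function.Injective (algebraMap R S))
    (hpow : ∀ s : S, s ^ p ∈ (algebraMap R S).range)
    (hgen : Algebra.adjoin A {r : R | ∃ s : S, algebraMap R S r = s ^ p} = ⊤)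
    [Module.Projective S Ω[S⁄A]] {m : ℕ} (g : Fin m → S)
    (hg : Algebra.adjoin A (Set.range g) = ⊤) :
    ∃ (n : ℕ) (a : Fin n → Fin m), Function.Injective a ∧
      Algebra.adjoin A (Set.range (g ∘ a)) = ⊤ ∧ Module.Free A S ∧
        Module.finrank A S = Module.finrank A R * p ^ n := by
  have := isLocalRing_of_hasExponentLE h hN hinj
  have : Nontrivial R := (algebraMap R S).domain_nontrivial
  have : Module.FinitePresentation S Ω[S⁄A] := Module.finitePresentation_of_projective _ _
  have hspan := span_kaehler_eq_top g hg
  obtain ⟨κ, c, b, hb⟩ := Module.exists_basis_of_span_of_flat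
    (fun s : Set.range g ↦ KaehlerDifferential.D A S s) (by
      rw [← hspan]
      congr 1
      ext z
      simp)
  have : Finite κ := Module.Finite.finite_basis b
  obtain ⟨n, ⟨e⟩⟩ := Finite.exists_equiv_fin κ
  choose c' hc' using fun i ↦ (c i).2
  let a := c' ∘ e.symm
  have hba : ∀ i, b.reindex e i = KaehlerDifferential.D A S (g (a i)) := fun i ↦ by
    rw [Module.Basis.reindex_apply, hb]
    exact congrArg _ (hc' _).symm
  -- The same differentials play two roles: over `R` they give a p-basis and hence the rank, over
  -- `A` they give generation.
  obtain ⟨f, hf⟩ := exists_kaehler_equiv_of_adjoin_pow h hgen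
  have : Module.Finite R S := Module.Finite.of_restrictScalars_finite A R S
  have hx := isPBasis_of_basis (cast_eq_zero_of_algebra R h) hinjR hpow (g ∘ a)
    ((b.reindex e).map f) (fun i ↦ by rw [Module.Basis.map_apply, hba, hf, Function.comp_apply])
  have : Module.Free R S := .of_basis (hx.basis hpow)
  refine ⟨n, a, fun i j hij ↦ (b.reindex e).injective (by rw [hba, hba, hij]),
    adjoin_eq_top_of_span_kaehler h hN _ ?_, Module.Free.trans (S := R), ?_⟩
  · rw [← (b.reindex e).span_eq]
    congr 2
    exact funext fun i ↦ (hba i).symm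
  · rw [← hx.finrank_eq hpow, Module.finrank_mul_finrank]

variable {A C : Type*} [CommRing A] [CommRing C] [Algebra A C]

theorem pow_mem_adjoin_pow (h : (p : A) = 0) (k : ℕ) {t : Set C} {y : C}
    (hy : y ∈ Algebra.adjoin A t) : y ^ p ^ k ∈ Algebra.adjoin A ((fun x ↦ x ^ p ^ k) '' t) := by
  have h' : (p : C) = 0 := cast_eq_zero_of_algebra C h
  induction hy using Algebra.adjoin_induction with
  | mem x hx => exact Algebra.subset_adjoin ⟨x, hx, rfl⟩
  | algebraMap r =>
    rw [← map_pow]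
    exact Subalgebra.algebraMap_mem _ _
  | add x y _ _ hx hy =>
    rw [← powHom_apply h', map_add, powHom_apply, powHom_apply]
    exact add_mem hx hy
  | mul x y _ _ hx hy =>
    rw [mul_pow]
    exact mul_mem hx hy

theorem adjoin_pow_eq_frob_succ (h : (p : A) = 0) {k : ℕ} {t : Set C}
    (ht : Algebra.adjoin A ((fun x ↦ x ^ p ^ k) '' t) = frob p A C k) :
    Algebra.adjoin A ((fun x ↦ x ^ p ^ (k + 1)) '' t) = frob p A C (k + 1) := by
  refine le_antisymm (Algebra.adjoin_mono (Set.image_subset_range _ _)) (Algebra.adjoin_le ?_)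
  rintro _ ⟨x, rfl⟩
  have hx : x ^ p ^ k ∈ Algebra.adjoin A ((fun x ↦ x ^ p ^ k) '' t) :=
    ht ▸ Algebra.subset_adjoin ⟨x, rfl⟩
  have := pow_mem_adjoin_pow h 1 hx
  rw [Set.image_image] at this
  rw [SetLike.mem_coe]
  simpa only [pow_one, ← pow_mul, ← pow_succ] using this

theorem exists_generating_subfamily_frob [IsLocalRing A] [CharP A p] [Module.Finite A C]
    (hinj : Function.Injective (algebraMap A C)) {N : ℕ} (hN : HasExponentLE p A C N) (k : ℕ)
    [Module.Projective (frob p A C k) Ω[frob p A C k⁄A]] [Module.Free A (frob p A C (k + 1))]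
    {m : ℕ} (g : Fin m → C)
    (hg : Algebra.adjoin A ((fun x ↦ x ^ p ^ k) '' Set.range g) = frob p A C k) :
    ∃ (n : ℕ) (a : Fin n → Fin m), Function.Injective a ∧
      Algebra.adjoin A ((fun x ↦ x ^ p ^ k) '' Set.range (g ∘ a)) = frob p A C k ∧
        Module.Free A (frob p A C k) ∧
          Module.finrank A (frob p A C k) = Module.finrank A (frob p A C (k + 1)) * p ^ n := by
  have h := CharP.cast_eq_zero A p
  let := frobAlgebra p A C k
  have := isScalarTower_frob_succ (p := p) (A := A) (C := C) k
  have hval : ∀ {l : ℕ} (u : Fin l → C) (u' : Fin l → frob p A C k),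
      (∀ i, (u' i : C) = u i ^ p ^ k) → (Algebra.adjoin A (Set.range u') = ⊤ ↔
        Algebra.adjoin A ((fun x ↦ x ^ p ^ k) '' Set.range u) = frob p A C k) := by
    intro l u u' hu
    have h1 : (fun x ↦ x ^ p ^ k) '' Set.range u = (frob p A C k).val '' Set.range u' := by
      rw [← Set.range_comp, ← Set.range_comp]
      exact congrArg Set.range (funext fun i ↦ (hu i).symm)
    rw [h1, ← AlgHom.map_adjoin]
    constructor
    · intro h2
      rw [h2, Algebra.map_top, Subalgebra.range_val]
    · intro h2
      refine Subalgebra.map_injective (f := (frob p A C k).val) Subtype.val_injective ?_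
      rw [h2, Algebra.map_top, Subalgebra.range_val]
  let g' : Fin m → frob p A C k := fun i ↦ ⟨g i ^ p ^ k, Algebra.subset_adjoin ⟨g i, rfl⟩⟩
  obtain ⟨n, a, ha, hadj, hfree, hrank⟩ := exists_generating_subfamily
    (R := frob p A C (k + 1)) h (fun x y hxy ↦ hinj (congrArg Subtype.val hxy)) (N := N)
    (hN.subalgebra _) (Subalgebra.inclusion_injective (frob_succ_le p A C k))
    (fun s ↦ ⟨⟨_, pow_mem_frob_succ h k s.2⟩, rfl⟩) (adjoin_pow_frob_succ k) g'
    ((hval g g' fun _ ↦ rfl).2 hg)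
  exact ⟨n, a, ha, (hval (g ∘ a) (g' ∘ a) fun _ ↦ rfl).1 hadj, hfree, hrank⟩

/-- Descending along the levels from `C^[N]`, a minimal family for `C^[k]` is chosen first and then
thinned for `C^[k+1]`; e_i counts the levels that generator i survives. A generator dropped at the
next level has its power in the algebra of the survivors, which have larger e_j. -/
theorem exists_normal_subfamily [IsLocalRing A] [CharP A p] [Module.Finite A C]
    (hinj : Function.Injective (algebraMap A C)) {N : ℕ} (hN : HasExponentLE p A C N)
    (hΩ : ∀ k, Module.Projective (frob p A C k) Ω[frob p A C k⁄A]) (d : ℕ) :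
    ∀ k, k + d = N → ∀ {m : ℕ} (g : Fin m → C),
      Algebra.adjoin A ((fun x ↦ x ^ p ^ k) '' Set.range g) = frob p A C k →
      ∃ (n : ℕ) (a : Fin n → Fin m) (e : Fin n → ℕ), Function.Injective a ∧ (∀ i, 0 < e i) ∧
        Algebra.adjoin A ((fun x ↦ x ^ p ^ k) '' Set.range (g ∘ a)) = frob p A C k ∧
        (∀ i, g (a i) ^ p ^ (k + e i) ∈ Algebra.adjoin A
          ((fun x ↦ x ^ p ^ (k + e i)) '' ((g ∘ a) '' {j | e i < e j}))) ∧
        Module.Free A (frob p A C k) ∧ Module.finrank A (frob p A C k) = p ^ ∑ i, e i := by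
  have h := CharP.cast_eq_zero A p
  have : Nontrivial C := hinj.nontrivial
  induction d with
  | zero =>
    rintro k rfl m g -
    have hbot := frob_eq_bot hN
    refine ⟨0, Fin.elim0, Fin.elim0, fun i ↦ i.elim0, fun i ↦ i.elim0, ?_, fun i ↦ i.elim0, ?_, ?_⟩
    · rw [Set.range_eq_empty, Set.image_empty, Algebra.adjoin_empty]
      exact hbot.symm
    · rw [add_zero] at hbot
      rw [hbot]
      exact .of_equiv (Algebra.botEquivOfInjective hinj).symm.toLinearEquiv
    · rw [add_zero] at hbot
      rw [hbot, (Algebra.botEquivOfInjective hinj).toLinearEquiv.finrank_eq]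
      simp
  | succ d ih =>
    intro k hk m g hg
    -- This first use of the induction only supplies freeness, needed before the subfamily at level
    -- k can be chosen.
    have hfree : Module.Free A (frob p A C (k + 1)) := by
      obtain ⟨-, -, -, -, -, -, -, hfree, -⟩ := ih (k + 1) (by omega) g
        (adjoin_pow_eq_frob_succ h hg)
      exact hfree
    have := hΩ k
    obtain ⟨n, a, ha, hadj, hfree', hrank⟩ := exists_generating_subfamily_frob hinj hN k g hg
    obtain ⟨n', a', e', ha', he', hadj', hpow', -, hrank'⟩ := ih (k + 1) (by omega) (g ∘ a)
      (adjoin_pow_eq_frob_succ h hadj)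
    -- By injectivity of `a'` the sum has at most one nonzero term: 1 for dropped generators, one
    -- more than before for survivors. The n ones account for the factor p^n in the rank.
    let e : Fin n → ℕ := fun i ↦ 1 + ∑ j, if a' j = i then e' j else 0
    have hea : ∀ j, e (a' j) = 1 + e' j := fun j ↦ by simp [e, ha'.eq_iff]
    refine ⟨n, a, e, ha, fun i ↦ by simp only [e]; omega, hadj, fun i ↦ ?_, hfree', ?_⟩
    · by_cases hi : ∃ j, a' j = i
      · obtain ⟨j, rfl⟩ := hi
        rw [hea, ← add_assoc]
        refine Algebra.adjoin_mono (Set.image_mono ?_) (hpow' j)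
        rintro _ ⟨l, hl, rfl⟩
        refine ⟨a' l, ?_, rfl⟩
        change 1 + e' j < e (a' l)
        rw [hea]
        exact Nat.add_lt_add_left hl 1
      · have hei : e i = 1 := by
          simp only [e, Nat.add_eq_left]
          exact Finset.sum_eq_zero fun j _ ↦ if_neg fun hj ↦ hi ⟨j, hj⟩
        rw [hei]
        have : g (a i) ^ p ^ (k + 1) ∈ frob p A C (k + 1) := Algebra.subset_adjoin ⟨_, rfl⟩
        rw [← hadj'] at this
        refine Algebra.adjoin_mono (Set.image_mono ?_) this
        rintro _ ⟨l, rfl⟩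
        refine ⟨a' l, ?_, rfl⟩
        change 1 < e (a' l)
        rw [hea]
        have := he' l
        omega
    · rw [hrank, hrank', ← pow_add]
      congr 1
      simp only [e, Finset.sum_add_distrib]
      rw [Finset.sum_comm]
      simp [add_comm]

/-- Over a local ring, the conditions on differentials yield a normal generating system. -/
theorem exists_isNormalGeneratingSystem [IsLocalRing A] [CharP A p] [Module.Finite A C]
    (hinj : Function.Injective (algebraMap A C)) (hexp : HasFiniteExponent p A C)
    (hΩ : ∀ k, Module.Projective (frob p A C k) Ω[frob p A C k⁄A]) :
    ∃ (n : ℕ) (x : Fin n → C) (e : Fin n → ℕ), IsNormalGeneratingSystem p A x e := by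
  obtain ⟨N, hN⟩ := hexp
  obtain ⟨m, g, hg⟩ := Module.Finite.exists_fin (R := A) (M := C)
  have hg' : Algebra.adjoin A (Set.range g) = ⊤ := by
    rw [eq_top_iff, ← Subalgebra.toSubmodule.le_iff_le, Algebra.top_toSubmodule, ← hg]
    exact Algebra.span_le_adjoin _ _
  obtain ⟨n, a, e, -, he, hadj, hpow, hfree, hrank⟩ := exists_normal_subfamily hinj hN hΩ N 0
    (Nat.zero_add N) g (by simpa [frob_zero] using hg')
  rw [frob_zero] at hadj hfree hrank
  refine ⟨n, g ∘ a, e, he, by simpa using hadj, fun i ↦ ?_,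
    .of_equiv Subalgebra.topEquiv.toLinearEquiv, ?_⟩
  · simpa only [zero_add, Function.comp_apply] using hpow i
  · rw [← hrank]
    exact Subalgebra.topEquiv.toLinearEquiv.finrank_eq.symm

end NormalGenerators

end RingExt

/-! ### Localization, and projective differentials imply pure inseparability -/

namespace RingExt

section Localization

theorem projective_kaehler_of_algEquiv {R R' S T : Type*} [CommRing R] [CommRing R'] [CommRing S]
    [CommRing T] [Algebra R R'] [Algebra R S] [Algebra R T] [Algebra R' T] [IsScalarTower R R' T]
    (g : R' ⊗[R] S ≃ₐ[R'] T) [Module.Projective S Ω[S⁄R]] : Module.Projective T Ω[T⁄R'] := by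
  let : Algebra S T := ((g : R' ⊗[R] S →+* T).comp
    (Algebra.TensorProduct.includeRight : S →ₐ[R] R' ⊗[R] S).toRingHom).toAlgebra
  have hg : ∀ s, algebraMap S T s = g (1 ⊗ₜ s) := fun _ ↦ rfl
  have : IsScalarTower R S T := .of_algebraMap_eq fun r ↦ by
    rw [hg, IsScalarTower.algebraMap_apply R R' T, ← g.commutes]
    exact congrArg g (Algebra.TensorProduct.includeRight.commutes r).symm
  have : Algebra.IsPushout R R' S T :=
    ⟨IsBaseChange.of_equiv g.toLinearEquiv fun _ ↦ rfl⟩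
  exact Module.Projective.of_equiv (KaehlerDifferential.tensorKaehlerEquiv R R' S T)

variable {p : ℕ} [hp : Fact p.Prime]

/-- Forming `C^[k]` commutes with flat base change: flatness gives injectivity, and additivity of
Frobenius shows that powers of the 1 ⊗ c suffice on the other side. Differentials then base change.
-/
theorem projective_kaehler_frob_tensorProduct {A C L : Type*} [CommRing A] [CommRing C]
    [CommRing L] [Algebra A C] [Algebra A L] [Module.Flat A L] (h : (p : A) = 0) (k : ℕ)
    [Module.Projective (frob p A C k) Ω[frob p A C k⁄A]] :
    Module.Projective (frob p L (L ⊗[A] C) k) Ω[frob p L (L ⊗[A] C) k⁄L] := by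
  let B := frob p A C k
  let f : L ⊗[A] B →ₐ[L] L ⊗[A] C := Algebra.TensorProduct.map (AlgHom.id L L) B.val
  have hf : Function.Injective f :=
    Module.Flat.lTensor_preserves_injective_linearMap (M := L) B.val.toLinearMap
      Subtype.val_injective
  have hrange : f.range = frob p L (L ⊗[A] C) k := by
    refine le_antisymm ?_ ?_
    · rintro _ ⟨z, rfl⟩
      induction z with
      | zero => rw [map_zero]; exact zero_mem _
      | add a b ha hb => rw [map_add]; exact add_mem ha hb
      | tmul a b =>
        obtain ⟨b, hb⟩ := b
        have h1 : f (a ⊗ₜ ⟨b, hb⟩) = a • (1 ⊗ₜ b : L ⊗[A] C) := by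
          rw [TensorProduct.smul_tmul', smul_eq_mul, mul_one]
          rfl
        refine h1 ▸ Subalgebra.smul_mem _ ?_ a
        clear h1
        induction hb using Algebra.adjoin_induction with
        | mem x hx =>
          obtain ⟨y, rfl⟩ := hx
          refine Algebra.subset_adjoin ⟨1 ⊗ₜ y, ?_⟩
          exact (Algebra.TensorProduct.tmul_pow _ _ _).trans (by rw [one_pow])
        | algebraMap r =>
          have : (1 ⊗ₜ algebraMap A C r : L ⊗[A] C) = algebraMap L _ (algebraMap A L r) := by
            rw [← IsScalarTower.algebraMap_apply]
            exact Algebra.TensorProduct.includeRight.commutes r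
          exact this ▸ Subalgebra.algebraMap_mem _ _
        | add x y _ _ hx hy =>
          have : (1 ⊗ₜ (x + y) : L ⊗[A] C) = 1 ⊗ₜ x + 1 ⊗ₜ y := TensorProduct.tmul_add _ _ _
          exact this ▸ add_mem hx hy
        | mul x y _ _ hx hy =>
          have : (1 ⊗ₜ (x * y) : L ⊗[A] C) = 1 ⊗ₜ x * 1 ⊗ₜ y := by simp
          exact this ▸ mul_mem hx hy
    · have hspan : Submodule.span L (Set.range fun c : C ↦ (1 ⊗ₜ c : L ⊗[A] C)) = ⊤ := by
        rw [eq_top_iff]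
        rintro z -
        induction z with
        | zero => exact zero_mem _
        | add a b ha hb => exact add_mem ha hb
        | tmul a c =>
          have : a ⊗ₜ[A] c = a • (1 ⊗ₜ c : L ⊗[A] C) := by
            rw [TensorProduct.smul_tmul', smul_eq_mul, mul_one]
          exact this ▸ Submodule.smul_mem _ a (Submodule.subset_span ⟨c, rfl⟩)
      rw [← Subalgebra.toSubmodule.le_iff_le,
        frob_toSubmodule (cast_eq_zero_of_algebra L h),
        ← span_pow_of_span (cast_eq_zero_of_algebra L h) hspan, Submodule.span_le]
      rintro _ ⟨_, ⟨c, rfl⟩, rfl⟩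
      refine ⟨1 ⊗ₜ ⟨c ^ p ^ k, Algebra.subset_adjoin ⟨c, rfl⟩⟩, ?_⟩
      simp [f, Algebra.TensorProduct.tmul_pow]
  exact projective_kaehler_of_algEquiv
    ((AlgEquiv.ofInjective f hf).trans (Subalgebra.equivOfEq _ _ hrange))

theorem HasExponentLE.tensorProduct {A C L : Type*} [CommRing A] [CommRing C]
    [CommRing L] [Algebra A C] [Algebra A L] (h : (p : A) = 0) {N : ℕ} (hN : HasExponentLE p A C N) :
    HasExponentLE p L (L ⊗[A] C) N := by
  intro z
  have h' : (p : L ⊗[A] C) = 0 := cast_eq_zero_of_algebra _ h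
  induction z with
  | zero => rw [zero_pow (pow_ne_zero _ hp.out.ne_zero)]; exact zero_mem _
  | add a b ha hb =>
    rw [← powHom_apply h', map_add, powHom_apply, powHom_apply]
    exact add_mem ha hb
  | tmul a c =>
    obtain ⟨r, hr⟩ := hN c
    refine ⟨a ^ p ^ N * algebraMap A L r, ?_⟩
    rw [Algebra.TensorProduct.tmul_pow, ← hr, Algebra.TensorProduct.algebraMap_apply,
      Algebra.algebraMap_self, RingHom.id_apply, mul_comm, ← Algebra.smul_def,
      TensorProduct.smul_tmul, ← Algebra.algebraMap_eq_smul_one]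

universe u v

theorem isPurelyInseparable_of_projective_kaehler {A : Type u} {C : Type v} [CommRing A]
    [CommRing C] [CharP A p] [Algebra A C] (hinj : Function.Injective (algebraMap A C))
    [Module.Finite A C] (hexp : HasFiniteExponent p A C)
    (H : ∀ e < exponent p A C, Module.Projective (frob p A C e) Ω[frob p A C e⁄A]) :
    IsPurelyInseparable p A C where
  finite := inferInstance
  finiteExponent := hexp
  projective := (isFExtension_of_isGaloisStep hexp fun e he ↦ by
    have := H e he
    exact isGaloisStep_of_projective_kaehler hexp he).projective hinj hexp
  locallyTruncated 𝔭 _ := by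
    have h := CharP.cast_eq_zero A p
    -- From the exponent on, `C^[e]` is the image of `A` and has no differentials, so the condition
    -- extends to all levels.
    have H' : ∀ e, Module.Projective (frob p A C e) Ω[frob p A C e⁄A] := by
      intro e
      rcases lt_or_ge e (exponent p A C) with he | he
      · exact H e he
      · have hbot : frob p A C e ≤ ⊥ :=
          (frob_antitone he).trans (frob_eq_bot (hasExponentLE_exponent hexp)).le
        have : Subsingleton Ω[frob p A C e⁄A] :=
          KaehlerDifferential.subsingleton_of_surjective A _ fun x ↦ by
            obtain ⟨a, ha⟩ := hbot x.2
            exact ⟨a, Subtype.ext ha⟩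
        infer_instance
    let L := Localization.AtPrime 𝔭
    have : Module.Flat A L := IsLocalization.flat L 𝔭.primeCompl
    have hL : (p : L) = 0 := cast_eq_zero_of_algebra L h
    have : CharP L p := (CharP.charP_iff_prime_eq_zero hp.out).2 hL
    obtain ⟨N, hN⟩ := hexp
    obtain ⟨n, x, e, hx⟩ := exists_isNormalGeneratingSystem (p := p) (A := L) (C := L ⊗[A] C)
      (injective_algebraMap_tensorProduct hinj) ⟨N, hN.tensorProduct h⟩ (fun k ↦ by
        have := H' k
        exact projective_kaehler_frob_tensorProduct h k)
    obtain ⟨A', _, _, hff, hA'⟩ := hx.exists_truncated hL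
    exact ⟨A', _, _, hff, n, e, hx.pos, hA'⟩

end Localization

end RingExt

/-! ### The equivalence -/

theorem theoremA {p : ℕ} [Fact p.Prime] (A : Type*) (C : Type*) [CommRing A] [CommRing C]
    [CharP A p] [Algebra A C] (hinj : Function.Injective (algebraMap A C))
    (hfin : Module.Finite A C) (hexp : RingExt.HasFiniteExponent p A C) :
    List.TFAE [
      RingExt.IsPurelyInseparable p A C,
      ∀ k : ℕ, Module.Projective C (RingExt.PrincipalParts A C k),
      ∀ e < RingExt.exponent p A C, Module.Projective C (RingExt.PrincipalParts A C (p ^ e)),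
      RingExt.IsFExtension p A C ∧ ∀ k : ℕ, IsComplemented (RingExt.diffOp A C C k),
      RingExt.IsFExtension p A C ∧
        ∀ e < RingExt.exponent p A C, IsComplemented (RingExt.diffOp A C C (p ^ e)),
      ∀ e < RingExt.exponent p A C, RingExt.IsGaloisStep p A C e,
      ∀ e < RingExt.exponent p A C,
        Module.Projective (RingExt.frob p A C e) (Ω[RingExt.frob p A C e⁄A])
    ] := by
  have h := CharP.cast_eq_zero A p
  tfae_have 1 → 2 := fun H k ↦ H.projective_principalParts h hinj k
  tfae_have 2 → 3 := fun H e _ ↦ H _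
  tfae_have 3 → 7 := RingExt.projective_kaehler_frob_of_principalParts hexp
  tfae_have 7 → 6 := fun H e he ↦
    have := H e he
    RingExt.isGaloisStep_of_projective_kaehler hexp he
  tfae_have 6 → 7 := fun H e he ↦ (H e he).projective_kaehler h
  -- Only the complement comes directly from projective P^k; the F-extension property is obtained
  -- through the Galois steps.
  tfae_have 2 → 4 := fun H ↦
    ⟨RingExt.isFExtension_of_isGaloisStep hexp (tfae_7_to_6 (tfae_3_to_7 (tfae_2_to_3 H))),
      fun k ↦ have := H k; RingExt.isComplemented_diffOp k⟩
  tfae_have 4 → 5 := fun H ↦ ⟨H.1, fun e _ ↦ H.2 _⟩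
  tfae_have 5 → 7 := fun H ↦
    RingExt.projective_kaehler_frob_of_isComplemented hinj hexp H.1 H.2
  tfae_have 7 → 1 := RingExt.isPurelyInseparable_of_projective_kaehler hinj hexp
  tfae_finish
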